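/- **Setting.** All systems are real, linear and time-invariant, $E\dot x=Ax+Bu,\ y=Cx+Du$ with $E$ nonsingular and transfer function $C(sE-A)^{-1}B+D$; such a system is *stable* if all eigenvalues of the pencil $sE-A$ have negative real part, and its *order* is its number of states. Put $$\|G\|_{\mathcal H_2}=\Big(\frac1{2\pi}\int_{-\infty}^{\infty}\|G(\imath\omega)\|_F^2\,d\omega\Big)^{1/2}.$$ Let $W(s)$ be the $m\times q$ transfer function of a stable system of order $n_w$ with feed-through matrix $D_w$ and pole-residue form $$W(s)=\sum_{k=1}^{n_w}\frac{e_kf_k^T}{s-\gamma_k}+D_w .$$ Put $\|G\|_{\mathcal H_2(W)}=\|G\,W\|_{\mathcal H_2}$, and write $H\in\mathcal H_2(W)$ if $H$ is the $p\times m$ transfer function of a stable system and $\|H\|_{\mathcal H_2(W)}<\infty$. For $H\in\mathcal H_2(W)$ let $\mathfrak F[H]$ be the rational function $$\mathfrak F[H](s)=H(s)W(s)W(-s)^T+\sum_{k=1}^{n_w}H(-\gamma_k)W(-\gamma_k)\frac{f_ke_k^T}{s+\gamma_k}$$ (with its removable singularities, such as those at the points $-\gamma_k$, filled in). Its impulse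 response is the continuous function on $[0,\infty)$ whose Laplace transform is $\mathfrak F[H]$. **Theorem.** Let $H\in\mathcal H_2(W)$, and let $H_r\in\mathcal H_2(W)$, of order $r$, be a best order-$r$ approximation of $H$ in the weighted norm: $\|H-H_r\|_{\mathcal H_2(W)}\le\|H-\widetilde H_r\|_{\mathcal H_2(W)}$ for every $\widetilde H_r\in\mathcal H_2(W)$ of order $r$. Suppose that $$H_r(s)=\sum_{k=1}^{r}\frac{c_kb_k^T}{s-\lambda_k}+D_r,\qquad c_k\in\mathbb C^p,\ b_k\in\mathbb C^m,$$ where $D_r$ is the feed-through matrix of $H_r$ and $\lambda_1,\dots,\lambda_r$ are distinct and lie in the open left half plane. Then, for $k=1,\dots,r$, $\mathfrak F[H]$ and $\mathfrak F[H_r]$ are holomorphic at $-\lambda_k$ and $$\mathfrak F[H](-\lambda_k)\,b_k=\mathfrak F[H_r](-\lambda_k)\,b_k,\qquad c_k^T\,\mathfrak F[H](-\lambda_k)=c_k^T\,\mathfrak F[H_r](-\lambda_k),$$ $$c_k^T\,\mathfrak F'[H](-\lambda_k)\,b_k=c_k^T\,\mathfrak F'[H_r](-\lambda_k)\,b_k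 .$$ Moreover $\mathfrak F[H]$ and $\mathfrak F[H_r]$ have impulse responses $F$ and $F_r$, and these satisfy $$F(0)\,n=F_r(0)\,n\qquad\text{for all } n\in\mathrm{Ker}(D_w^T).$$ -/

import Mathlib

open scoped Topology Matrix

noncomputable section

/-- A real linear time-invariant system `E x' = A x + B u`, `y = C x + D u` with `n` states,
`m` inputs and `p` outputs. -/
structure LTISystem (n m p : ℕ) where
  E : Matrix (Fin n) (Fin n) ℝ
  A : Matrix (Fin n) (Fin n) ℝ
  B : Matrix (Fin n) (Fin m) ℝ
  C : Matrix (Fin p) (Fin n) ℝ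
  D : Matrix (Fin p) (Fin m) ℝ

namespace LTISystem

variable {n m p : ℕ}

/-- The pencil `s E - A`, as a complex matrix. -/
def pencil (S : LTISystem n m p) (s : ℂ) : Matrix (Fin n) (Fin n) ℂ :=
  s • S.E.map Complex.ofReal - S.A.map Complex.ofReal

/-- The transfer function `H(s) = C (s E - A)⁻¹ B + D`. -/
def transfer (S : LTISystem n m p) (s : ℂ) : Matrix (Fin p) (Fin m) ℂ :=
  S.C.map Complex.ofReal * (S.pencil s)⁻¹ * S.B.map Complex.ofReal + S.D.map Complex.ofReal

/-- `E` is nonsingular and all eigenvalues of the pencil `s E - A` lie in the open left half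
plane. -/
def IsStable (S : LTISystem n m p) : Prop :=
  IsUnit S.E.det ∧ ∀ s : ℂ, (S.pencil s).det = 0 → s.re < 0

end LTISystem

/-- The squared Frobenius norm of a complex matrix. -/
def frobSq {p m : ℕ} (M : Matrix (Fin p) (Fin m) ℂ) : ℝ :=
  ∑ i, ∑ j, ‖M i j‖ ^ 2

/-- The `H₂` norm `((1 / 2π) ∫ ‖G(iω)‖_F² dω)^{1/2}`, with values in `[0, ∞]`. -/
def h2Norm {p m : ℕ} (G : ℂ → Matrix (Fin p) (Fin m) ℂ) : ENNReal :=
  (ENNReal.ofReal (1 / (2 * Real.pi)) *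
    ∫⁻ ω : ℝ, ENNReal.ofReal (frobSq (G (Complex.I * (ω : ℂ))))) ^ (1 / 2 : ℝ)

/-- The input-weighted norm `‖G‖_{H₂(W)} = ‖G · W‖_{H₂}`. -/
def weightedH2Norm {p m q : ℕ} (W : ℂ → Matrix (Fin m) (Fin q) ℂ)
    (G : ℂ → Matrix (Fin p) (Fin m) ℂ) : ENNReal :=
  h2Norm fun s => G s * W s

/-- `S ∈ H₂(W)`: the system `S` is stable and its weighted norm is finite. -/
def MemWeightedH2 {n m p q : ℕ} (W : ℂ → Matrix (Fin m) (Fin q) ℂ) (S : LTISystem n m p) :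
    Prop :=
  S.IsStable ∧ weightedH2Norm W S.transfer < ⊤

/-- `Sr` is a best order-`r` approximation of `S` in `H₂(W)`. -/
def IsBestWeightedH2Approx {n r m p q : ℕ} (W : ℂ → Matrix (Fin m) (Fin q) ℂ)
    (S : LTISystem n m p) (Sr : LTISystem r m p) : Prop :=
  MemWeightedH2 W Sr ∧ ∀ T : LTISystem r m p, MemWeightedH2 W T →
    weightedH2Norm W (fun s => S.transfer s - Sr.transfer s) ≤
      weightedH2Norm W (fun s => S.transfer s - T.transfer s)

/-- The rational function `G` has the pole-residue form
`G(s) = ∑ₖ (left k) (right k)ᵀ / (s - pole k) + D`.  Identity of rational functions is identity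
off a finite set of points. -/
def HasPoleResidueForm {N p m : ℕ} (G : ℂ → Matrix (Fin p) (Fin m) ℂ) (pole : Fin N → ℂ)
    (left : Fin N → Fin p → ℂ) (right : Fin N → Fin m → ℂ) (D : Matrix (Fin p) (Fin m) ℝ) :
    Prop :=
  ∀ᶠ s in Filter.cofinite,
    G s = (∑ k, (s - pole k)⁻¹ • Matrix.vecMulVec (left k) (right k)) + D.map Complex.ofReal

/-- The expression
`H(s) W(s) W(-s)ᵀ + ∑ₖ H(-γₖ) W(-γₖ) fₖ eₖᵀ / (s + γₖ)`,
literally, so with no meaningful value at its singularities. -/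
def weightMapExpr {p m q N : ℕ} (H : ℂ → Matrix (Fin p) (Fin m) ℂ)
    (W : ℂ → Matrix (Fin m) (Fin q) ℂ) (γ : Fin N → ℂ) (e : Fin N → Fin m → ℂ)
    (f : Fin N → Fin q → ℂ) (s : ℂ) : Matrix (Fin p) (Fin m) ℂ :=
  H s * W s * (W (-s))ᵀ +
    ∑ k, (s + γ k)⁻¹ • (H (-γ k) * W (-γ k) * Matrix.vecMulVec (f k) (e k))

/-- The transformed map `𝔉[H]`.  The singularities of the defining expression at the points `-γₖ`
are removable; as for any rational function, the value at a point is the limit of the expression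
there. -/
def weightMap {p m q N : ℕ} (H : ℂ → Matrix (Fin p) (Fin m) ℂ)
    (W : ℂ → Matrix (Fin m) (Fin q) ℂ) (γ : Fin N → ℂ) (e : Fin N → Fin m → ℂ)
    (f : Fin N → Fin q → ℂ) (s : ℂ) : Matrix (Fin p) (Fin m) ℂ :=
  Filter.limUnder (𝓝[≠] s) (weightMapExpr H W γ e f)

/-- The entrywise complex derivative of a matrix-valued function. -/
def matDeriv {p m : ℕ} (G : ℂ → Matrix (Fin p) (Fin m) ℂ) (s : ℂ) : Matrix (Fin p) (Fin m) ℂ :=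
  Matrix.of fun i j => deriv (fun z => G z i j) s

/-- All entries of `G` are holomorphic at `s`. -/
def MatAnalyticAt {p m : ℕ} (G : ℂ → Matrix (Fin p) (Fin m) ℂ) (s : ℂ) : Prop :=
  ∀ i j, AnalyticAt ℂ (fun z => G z i j) s

/-- `F` is the impulse response with transfer function `G`: it is continuous on `[0, ∞)`, and `G`
is its Laplace transform `∫₀^∞ exp(-s t) F(t) dt` on some right half plane. -/
def IsImpulseResponse {p m : ℕ} (F : ℝ → Matrix (Fin p) (Fin m) ℂ)
    (G : ℂ → Matrix (Fin p) (Fin m) ℂ) : Prop :=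
  (∀ i j, ContinuousOn (fun t => F t i j) (Set.Ici 0)) ∧
    ∃ σ : ℝ, ∀ s : ℂ, σ < s.re → ∀ i j,
      MeasureTheory.IntegrableOn (fun t : ℝ => Complex.exp (-(s * (t : ℂ))) * F t i j)
        (Set.Ioi 0) ∧
      ∫ t in Set.Ioi (0 : ℝ), Complex.exp (-(s * (t : ℂ))) * F t i j = G s i j

end

/-! A best approximation is a stationary point of the squared norm, and stationarity is read off
with Cauchy's formula. After passing to E = 1, the weighted norm of a stable system is finite
exactly when its feed-through satisfies D D_w = 0 (`LTISystem.memWeightedH2_iff`). Stability is an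
open condition, so H_r may be moved along every direction (A₁, B₁, C₁, D₁) with D₁ D_w = 0. Put X =
(H - H_r) W and let V be the first variation of the transfer function. Then the integral over the
imaginary axis of the entrywise product of X(s) with V(-s) W(-s) vanishes
(`LTISystem.integral_weightedError_eq_zero`).

Next W is moved to the other factor. The product X(s) W(-s)ᵀ has poles at the points -γ_k of the
right half plane. The sum in 𝔉 removes exactly these, so Δ = 𝔉[H] - 𝔉[H_r] is holomorphic and
O(1/|s|) on the closed right half plane. For strictly proper V the removed terms, multiplied by
V(-s), are holomorphic and O(|s|⁻²) there as functions of -s, so they integrate to zero. Hence Δ is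
orthogonal to V (`LTISystem.axisPairing_eq_integral`).

If no residue of H_r vanishes, the λ_k are the eigenvalues of A, and right and left eigenvectors x,
y yield directions with V = u (yᵀB)/(s - λ), (Cx) vᵀ/(s - λ) and (Cx)(yᵀB)/(s - λ)². Pairing with
them evaluates Δ, or its derivative, at -λ (`RHPDecay.exists_cauchy_const`): these are the three
interpolation conditions. If some residue vanishes, the Markov parameters come from fewer than r
terms, so the realization is unreachable or unobservable (`LTISystem.reachable_ne_top_or`). Its idle
state can then be used to move towards any first-order system with a negative real pole, so Δ
vanishes on the positive reals and hence on the open right half plane.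

The condition at time 0 comes from D₁ = e_i nᵀ. Now V is constant and the removed terms decay only
like 1/|s|. The vanishing of the integral forces the coefficient of 1/s in Δ n to vanish
(`tendsto_mul_of_integral_eq_zero`), and by the initial value theorem
(`IsImpulseResponse.tendsto_mul`) this coefficient is F(0) n - F_r(0) n. -/

/-! ### Scalar functions with decay on the closed right half plane; Cauchy's formula on the axis. -/

/-- `g` is holomorphic on the closed right half plane and `O((1 + |s|)⁻ᵏ)` there. -/
structure RHPDecay (k : ℕ) (g : ℂ → ℂ) : Prop where
  analyticAt : ∀ s : ℂ, 0 ≤ s.re → AnalyticAt ℂ g s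
  bound : ∃ K : ℝ, ∀ s : ℂ, 0 ≤ s.re → ‖g s‖ ≤ K / (1 + ‖s‖) ^ k

namespace RHPDecay

variable {k l : ℕ} {g h : ℂ → ℂ}

theorem isClosed_rhp : IsClosed {s : ℂ | 0 ≤ s.re} :=
  isClosed_le continuous_const Complex.continuous_re

/-- Only the behaviour at infinity has to be estimated: on the compact half disc of radius ρ,
continuity bounds (1 + |s|)ᵏ g(s). -/
theorem of_large (ha : ∀ s : ℂ, 0 ≤ s.re → AnalyticAt ℂ g s)
    (hb : ∃ K ρ : ℝ, ∀ s : ℂ, 0 ≤ s.re → ρ ≤ ‖s‖ → ‖g s‖ ≤ K / (1 + ‖s‖) ^ k) :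
    RHPDecay k g := by
  refine ⟨ha, ?_⟩
  obtain ⟨K, ρ, hK⟩ := hb
  have hcomp : IsCompact ({s : ℂ | 0 ≤ s.re} ∩ Metric.closedBall 0 ρ) :=
    (isCompact_closedBall (0 : ℂ) ρ).inter_left isClosed_rhp
  obtain ⟨M, hM⟩ := hcomp.exists_bound_of_continuousOn (f := fun s => (1 + (‖s‖ : ℂ)) ^ k * g s)
    (fun s hs => (ContinuousAt.mul (by fun_prop) (ha s hs.1).continuousAt).continuousWithinAt)
  refine ⟨max K M, fun s hs => ?_⟩
  have hp : 0 < (1 + ‖s‖) ^ k := by positivity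
  rcases le_total ρ ‖s‖ with h1 | h1
  · exact (hK s hs h1).trans (by gcongr; exact le_max_left _ _)
  · have := hM s ⟨hs, by simpa using h1⟩
    rw [le_div_iff₀ hp]
    refine le_trans (le_of_eq ?_) (this.trans (le_max_right _ _))
    rw [norm_mul, norm_pow, mul_comm]
    congr 2
    have : (1 + (‖s‖ : ℂ)) = ((1 + ‖s‖ : ℝ) : ℂ) := by push_cast; ring
    rw [this, Complex.norm_real, Real.norm_of_nonneg (by positivity)]

theorem bound_nonneg (hg : RHPDecay k g) :
    ∃ K : ℝ, 0 ≤ K ∧ ∀ s : ℂ, 0 ≤ s.re → ‖g s‖ ≤ K / (1 + ‖s‖) ^ k := by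
  obtain ⟨K, hK⟩ := hg.bound
  refine ⟨K, ?_, hK⟩
  have := hK 0 (by simp)
  simpa using (norm_nonneg _).trans this

theorem add (hg : RHPDecay k g) (hh : RHPDecay k h) : RHPDecay k (fun s => g s + h s) := by
  obtain ⟨K, hK⟩ := hg.bound
  obtain ⟨M, hM⟩ := hh.bound
  refine ⟨fun s hs => (hg.analyticAt s hs).add (hh.analyticAt s hs), K + M, fun s hs => ?_⟩
  rw [add_div]
  exact (norm_add_le _ _).trans (add_le_add (hK s hs) (hM s hs))

theorem mul (hg : RHPDecay k g) (hh : RHPDecay l h) : RHPDecay (k + l) (fun s => g s * h s) := by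
  obtain ⟨K, hK0, hK⟩ := hg.bound_nonneg
  obtain ⟨M, hM⟩ := hh.bound
  refine ⟨fun s hs => (hg.analyticAt s hs).mul (hh.analyticAt s hs), K * M, fun s hs => ?_⟩
  rw [norm_mul, pow_add, ← div_mul_div_comm]
  exact mul_le_mul (hK s hs) (hM s hs) (norm_nonneg _) (by positivity)

theorem const (a : ℂ) : RHPDecay 0 (fun _ => a) :=
  ⟨fun _ _ => analyticAt_const, ‖a‖, by simp⟩

theorem const_mul (a : ℂ) (hg : RHPDecay k g) : RHPDecay k (fun s => a * g s) := by
  simpa using (const a).mul hg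

theorem mul_const (hg : RHPDecay k g) (a : ℂ) : RHPDecay k (fun s => g s * a) := by
  simpa using hg.mul (const a)

theorem neg (hg : RHPDecay k g) : RHPDecay k (fun s => -g s) := by
  simpa using hg.const_mul (-1)

theorem sub (hg : RHPDecay k g) (hh : RHPDecay k h) : RHPDecay k (fun s => g s - h s) := by
  simpa [sub_eq_add_neg] using hg.add hh.neg

theorem zero : RHPDecay k (fun _ => 0) :=
  ⟨fun _ _ => analyticAt_const, 0, by simp⟩

theorem sum {ι : Type*} (t : Finset ι) {g : ι → ℂ → ℂ} (hg : ∀ i ∈ t, RHPDecay k (g i)) :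
    RHPDecay k (fun s => ∑ i ∈ t, g i s) := by
  classical
  induction t using Finset.induction_on with
  | empty => simpa using zero
  | insert a t ha ih =>
    simp only [Finset.sum_insert ha]
    exact (hg a (Finset.mem_insert_self _ _)).add
      (ih fun i hi => hg i (Finset.mem_insert_of_mem hi))

theorem mono (hkl : k ≤ l) (hg : RHPDecay l g) : RHPDecay k g := by
  obtain ⟨K, hK0, hK⟩ := hg.bound_nonneg
  refine ⟨hg.analyticAt, K, fun s hs => (hK s hs).trans ?_⟩
  gcongr
  linarith [norm_nonneg s]

theorem sub_ne_zero {lam s : ℂ} (hl : lam.re < 0) (hs : 0 ≤ s.re) : s - lam ≠ 0 := by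
  intro h
  have := congrArg Complex.re h
  simp at this
  linarith

theorem add_ne_zero {γ s : ℂ} (hl : γ.re < 0) (hs : s.re ≤ 0) : s + γ ≠ 0 := by
  intro h
  have := congrArg Complex.re h
  simp at this
  linarith

/-- The constant is 2 · 2, from |s - lam| ≥ |s|/2 and |s| ≥ (1 + |s|)/2. -/
theorem norm_inv_sub_le {lam s : ℂ} (h1 : 1 ≤ ‖s‖) (h2 : 2 * ‖lam‖ ≤ ‖s‖) :
    ‖(s - lam)⁻¹‖ ≤ 4 / (1 + ‖s‖) ^ 1 := by
  have := norm_sub_norm_le s lam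
  rw [norm_inv, pow_one, inv_eq_one_div, div_le_div_iff₀ (by linarith) (by linarith)]
  linarith

theorem inv_sub {lam : ℂ} (hl : lam.re < 0) : RHPDecay 1 (fun s => (s - lam)⁻¹) := by
  refine of_large (fun s hs => AnalyticAt.inv (by fun_prop) (sub_ne_zero hl hs)) ?_
  refine ⟨4, max 1 (2 * ‖lam‖), fun s hs h => ?_⟩
  exact norm_inv_sub_le ((le_max_left _ _).trans h) ((le_max_right _ _).trans h)

/-- Dividing out a zero keeps holomorphy and gains one power of decay. This lifts an O(1/|s|)
function to the class whose integral along the axis vanishes. -/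
theorem dslope (hg : RHPDecay k g) {c : ℂ} (hgc : g c = 0) :
    RHPDecay (k + 1) (dslope g c) := by
  refine of_large (fun s hs => ?_) ?_
  · rw [Complex.analyticAt_iff_eventually_differentiableAt]
    have h1 := Complex.analyticAt_iff_eventually_differentiableAt.1 (hg.analyticAt s hs)
    by_cases hsc : s = c
    · subst hsc
      have h2 : DifferentiableOn ℂ (_root_.dslope g s) {z | DifferentiableAt ℂ g z} :=
        (Complex.differentiableOn_dslope h1).2 fun z hz => hz.differentiableWithinAt
      filter_upwards [eventually_mem_nhds_iff.2 h1] with z hz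
      exact h2.differentiableAt hz
    · filter_upwards [h1, isOpen_ne.mem_nhds hsc] with z hz hzc
      exact (differentiableAt_dslope_of_ne hzc).2 hz
  · obtain ⟨K, hK0, hK⟩ := hg.bound_nonneg
    refine ⟨K * 4, max (2 * ‖c‖ + 1) 1, fun s hs h => ?_⟩
    have h1 : 1 ≤ ‖s‖ := (le_max_right _ _).trans h
    have h2 : 2 * ‖c‖ + 1 ≤ ‖s‖ := (le_max_left _ _).trans h
    have hsc : s ≠ c := by
      rintro rfl
      linarith
    rw [dslope_of_ne _ hsc, slope_def_field, hgc, sub_zero, div_eq_mul_inv, norm_mul, pow_add,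
      ← div_mul_div_comm]
    exact mul_le_mul (hK s hs) (norm_inv_sub_le h1 (by linarith)) (norm_nonneg _) (by positivity)

theorem continuous_imag (hg : RHPDecay k g) : Continuous fun ω : ℝ => g (Complex.I * ω) := by
  rw [continuous_iff_continuousAt]
  intro ω
  exact ContinuousAt.comp (f := fun ω : ℝ => Complex.I * (ω : ℂ)) (g := g)
    (hg.analyticAt _ (by simp)).continuousAt (by fun_prop)

theorem continuous_imag_neg (hg : RHPDecay k g) :
    Continuous fun ω : ℝ => g (-(Complex.I * ω)) := by
  have := hg.continuous_imag.comp continuous_neg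
  simpa [Function.comp_def] using this

theorem integrable_of_bound {φ : ℝ → ℂ} (hφ : Continuous φ) {K : ℝ}
    (hK : ∀ ω, ‖φ ω‖ ≤ K / (1 + |ω|) ^ 2) : MeasureTheory.Integrable φ := by
  have hK0 : 0 ≤ K := by simpa using (norm_nonneg _).trans (hK 0)
  refine (integrable_inv_one_add_sq.const_mul K).mono' hφ.aestronglyMeasurable
    (Filter.Eventually.of_forall fun ω => (hK ω).trans ?_)
  rw [div_eq_mul_inv]
  gcongr
  nlinarith [abs_nonneg ω, sq_abs ω]

theorem integrable_imag (hg : RHPDecay 2 g) :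
    MeasureTheory.Integrable fun ω : ℝ => g (Complex.I * ω) := by
  obtain ⟨K, hK⟩ := hg.bound
  exact integrable_of_bound hg.continuous_imag (K := K) fun ω => by
    simpa using hK (Complex.I * ω) (by simp)

/-- A function which is holomorphic and `O(|s|⁻²)` on the closed right half plane has vanishing
integral along the imaginary axis. -/
theorem integral_imag_eq_zero (hg : RHPDecay 2 g) : ∫ ω : ℝ, g (Complex.I * ω) = 0 := by
  obtain ⟨K, hK0, hK⟩ := hg.bound_nonneg
  have hlim := MeasureTheory.intervalIntegral_tendsto_integral hg.integrable_imag
    Filter.tendsto_neg_atTop_atBot Filter.tendsto_id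
  refine tendsto_nhds_unique hlim ?_
  have h0 : Filter.Tendsto (fun R : ℝ => 4 * K * R⁻¹) Filter.atTop (𝓝 0) := by
    simpa using tendsto_inv_atTop_zero.const_mul (4 * K)
  refine squeeze_zero_norm' ?_ h0
  filter_upwards [Filter.eventually_gt_atTop 0] with R hR
  have hb : ∀ s : ℂ, 0 ≤ s.re → R ≤ ‖s‖ → ‖g s‖ ≤ K * (R⁻¹) ^ 2 := by
    intro s hs hRs
    refine (hK s hs).trans ?_
    rw [div_eq_mul_inv, inv_pow]
    gcongr
    linarith
  -- The rectangle [0, R] × [-R, R] has one side on the imaginary axis. On the other three sides g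
  -- is O(R⁻²) and the length is O(R).
  have hrect := Complex.integral_boundary_rect_eq_zero_of_differentiableOn g
    (⟨0, -R⟩ : ℂ) (⟨R, R⟩ : ℂ) (fun s hs => by
      refine (hg.analyticAt s ?_).differentiableAt.differentiableWithinAt
      have := hs.1
      simp only [Set.mem_preimage, Set.uIcc_of_le hR.le] at this
      exact this.1)
  have e1 : ‖∫ x in (0 : ℝ)..R, g (x + (-R : ℝ) * Complex.I)‖ ≤ K * (R⁻¹) ^ 2 * |R - 0| := by
    refine intervalIntegral.norm_integral_le_of_norm_le_const fun x hx => ?_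
    rw [Set.uIoc_of_le hR.le] at hx
    refine hb _ (by simpa using hx.1.le) ?_
    have := Complex.abs_im_le_norm (x + (-R : ℝ) * Complex.I)
    simp only [Complex.add_im, Complex.ofReal_im, Complex.mul_im, Complex.ofReal_re, Complex.I_im,
      Complex.I_re, mul_one, mul_zero, add_zero, zero_add, abs_neg, abs_of_pos hR] at this
    exact this
  have e2 : ‖∫ x in (0 : ℝ)..R, g (x + (R : ℝ) * Complex.I)‖ ≤ K * (R⁻¹) ^ 2 * |R - 0| := by
    refine intervalIntegral.norm_integral_le_of_norm_le_const fun x hx => ?_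
    rw [Set.uIoc_of_le hR.le] at hx
    refine hb _ (by simpa using hx.1.le) ?_
    have := Complex.abs_im_le_norm (x + (R : ℝ) * Complex.I)
    simp only [Complex.add_im, Complex.ofReal_im, Complex.mul_im, Complex.ofReal_re, Complex.I_im,
      Complex.I_re, mul_one, mul_zero, add_zero, zero_add, abs_of_pos hR] at this
    exact this
  have e3 : ‖∫ y in (-R)..R, g (R + (y : ℝ) * Complex.I)‖ ≤ K * (R⁻¹) ^ 2 * |R - (-R)| := by
    refine intervalIntegral.norm_integral_le_of_norm_le_const fun x hx => ?_
    refine hb _ (by simpa using hR.le) ?_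
    have := Complex.abs_re_le_norm (R + (x : ℝ) * Complex.I)
    simp only [Complex.add_re, Complex.ofReal_im, Complex.mul_re, Complex.ofReal_re, Complex.I_im,
      Complex.I_re, mul_zero, add_zero, sub_zero, zero_mul, abs_of_pos hR] at this
    exact this
  have e4 : (∫ y in (-R)..(id R), g (Complex.I * y)) =
      ∫ y in (-R)..R, g (((⟨0, -R⟩ : ℂ).re : ℂ) + y * Complex.I) := by
    simp [mul_comm]
  have key : ‖∫ y in (-R)..(id R), g (Complex.I * y)‖ ≤
      K * (R⁻¹) ^ 2 * |R - 0| + K * (R⁻¹) ^ 2 * |R - 0| + K * (R⁻¹) ^ 2 * |R - (-R)| := by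
    rw [e4]
    have : ∀ a b c d : ℂ, a - b + Complex.I • c - Complex.I • d = 0 → ‖d‖ ≤ ‖a‖ + ‖b‖ + ‖c‖ := by
      intro a b c d h
      have hd : Complex.I * d = a - b + Complex.I * c := by
        simp only [smul_eq_mul] at h
        linear_combination -h
      calc ‖d‖ = ‖Complex.I * d‖ := by simp
        _ ≤ ‖a - b‖ + ‖Complex.I * c‖ := hd ▸ norm_add_le _ _
        _ ≤ ‖a‖ + ‖b‖ + ‖c‖ := by
          have := norm_sub_le a b
          simp only [norm_mul, Complex.norm_I, one_mul]
          linarith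
    exact (this _ _ _ _ hrect).trans (add_le_add (add_le_add e1 e2) e3)
  refine key.trans (le_of_eq ?_)
  rw [sub_zero, sub_neg_eq_add, abs_of_pos hR, abs_of_pos (by linarith)]
  field_simp
  ring

/-- A positive multiple of the squared `L²` norm of `1 / (iω + lam)` on the real line. -/
theorem exists_cauchy_const {lam : ℂ} (hl : lam.re < 0) : ∃ κ : ℂ, κ ≠ 0 ∧
    ∀ g : ℂ → ℂ, RHPDecay 1 g →
      ∫ ω : ℝ, g (Complex.I * ω) * (-(Complex.I * ω) - lam)⁻¹ = κ * g (-lam) := by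
  -- A reference function normalised by h(-lam) = 1. On the axis its product with the Cauchy kernel
  -- is a positive multiple of |iω + lam|⁻², so the constant κ is visibly nonzero.
  set h : ℂ → ℂ := fun s => (-2 * lam.re : ℝ) * (s - (starRingEnd ℂ) lam)⁻¹ with hh
  have hl' : ((starRingEnd ℂ) lam).re < 0 := by simpa using hl
  have hdec : RHPDecay 1 h := (inv_sub hl').const_mul _
  have hh1 : h (-lam) = 1 := by
    have e : -lam - (starRingEnd ℂ) lam = ((-2 * lam.re : ℝ) : ℂ) := by
      apply Complex.ext <;> simp; ring
    have : ((-2 * lam.re : ℝ) : ℂ) ≠ 0 := by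
      rw [Complex.ofReal_ne_zero]
      linarith
    simp only [hh, e, mul_inv_cancel₀ this]
  have hprod : ∀ ω : ℝ, h (Complex.I * ω) * (-(Complex.I * ω) - lam)⁻¹ =
      ((-2 * lam.re * (‖Complex.I * ω + lam‖ ^ 2)⁻¹ : ℝ) : ℂ) := by
    intro ω
    have e1 : (Complex.I * ω - (starRingEnd ℂ) lam) * (-(Complex.I * ω) - lam) =
        ((‖Complex.I * ω + lam‖ ^ 2 : ℝ) : ℂ) := by
      rw [← Complex.normSq_eq_norm_sq, ← Complex.mul_conj]
      simp
      ring
    rw [hh]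
    simp only
    rw [mul_assoc, ← mul_inv, e1]
    push_cast
    ring
  have hne : ∀ ω : ℝ, Complex.I * ω + lam ≠ 0 := fun ω => add_ne_zero hl (by simp)
  have hcont : Continuous fun ω : ℝ => (-2 * lam.re * (‖Complex.I * ω + lam‖ ^ 2)⁻¹ : ℝ) := by
    refine continuous_const.mul (Continuous.inv₀ (by fun_prop) fun ω => ?_)
    have := norm_pos_iff.2 (hne ω)
    positivity
  have hint : ∀ g : ℂ → ℂ, RHPDecay 1 g → MeasureTheory.Integrable
      fun ω : ℝ => g (Complex.I * ω) * (-(Complex.I * ω) - lam)⁻¹ := by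
    intro g hg
    obtain ⟨K, hK0, hK⟩ := hg.bound_nonneg
    obtain ⟨M, hM⟩ := (inv_sub hl).bound
    refine integrable_of_bound (K := K * M) (hg.continuous_imag.mul (inv_sub hl).continuous_imag_neg)
      fun ω => ?_
    rw [norm_mul, pow_two, ← div_mul_div_comm]
    have h1 := hK (Complex.I * ω) (by simp)
    have h2 := hM (-(Complex.I * ω)) (by simp)
    simp only [pow_one, norm_mul, Complex.norm_I, one_mul, Complex.norm_real, norm_neg] at h1 h2
    exact mul_le_mul h1 h2 (norm_nonneg _) (by positivity)
  refine ⟨∫ ω : ℝ, h (Complex.I * ω) * (-(Complex.I * ω) - lam)⁻¹, ?_, fun g hg => ?_⟩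
  · have hi : MeasureTheory.Integrable
        fun ω : ℝ => (-2 * lam.re * (‖Complex.I * ω + lam‖ ^ 2)⁻¹ : ℝ) := by
      have := (hint h hdec).re
      simpa only [hprod, RCLike.re_eq_complex_re, Complex.ofReal_re] using this
    simp only [hprod]
    rw [integral_complex_ofReal, Complex.ofReal_ne_zero]
    refine (MeasureTheory.integral_pos_of_integrable_nonneg_nonzero (x := 0) hcont hi ?_ ?_).ne'
    · intro ω
      have : 0 < -2 * lam.re := by linarith
      simp only [Pi.zero_apply]
      positivity
    · have h1 : -2 * lam.re ≠ 0 := by linarith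
      have h2 := norm_pos_iff.2 (hne 0)
      exact mul_ne_zero h1 (inv_ne_zero (by positivity))
  -- Subtracting g(-lam) h creates a zero at -lam. The divided difference is then O(|s|⁻²), so its
  -- integral vanishes, and the integral for g is g(-lam) times that for h.
  · set f : ℂ → ℂ := fun s => g s - g (-lam) * h s with hf
    have hfd : RHPDecay 1 f := hg.sub (hdec.const_mul _)
    have hf0 : f (-lam) = 0 := by simp [hf, hh1]
    have hz := (hfd.dslope hf0).integral_imag_eq_zero
    have e : ∀ ω : ℝ, _root_.dslope f (-lam) (Complex.I * ω) =
        g (-lam) * (h (Complex.I * ω) * (-(Complex.I * ω) - lam)⁻¹) -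
          g (Complex.I * ω) * (-(Complex.I * ω) - lam)⁻¹ := by
      intro ω
      have hn : Complex.I * ω ≠ -lam := fun hc => hne ω (by rw [hc]; ring)
      rw [dslope_of_ne _ hn, slope_def_field, hf0, sub_zero, hf]
      have e2 : -(Complex.I * ω) - lam = -(Complex.I * ω - -lam) := by ring
      rw [e2, inv_neg, div_eq_mul_inv]
      ring
    simp only [e] at hz
    rw [MeasureTheory.integral_sub ((hint h hdec).const_mul _) (hint g hg),
      MeasureTheory.integral_const_mul] at hz
    linear_combination -hz

end RHPDecay

/-! ### Matrix functions with decay. -/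

/-- All entries of `G` are holomorphic and `O((1 + |s|)⁻ᵏ)` on the closed right half plane. -/
def MatRHPDecay {α β : Type*} (k : ℕ) (G : ℂ → Matrix α β ℂ) : Prop :=
  ∀ i j, RHPDecay k fun s => G s i j

namespace MatRHPDecay

variable {α β δ : Type*} {k l : ℕ}

theorem const (M : Matrix α β ℂ) : MatRHPDecay 0 fun _ => M :=
  fun _ _ => RHPDecay.const _

theorem add {G H : ℂ → Matrix α β ℂ} (hG : MatRHPDecay k G) (hH : MatRHPDecay k H) :
    MatRHPDecay k fun s => G s + H s :=
  fun i j => (hG i j).add (hH i j)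

theorem sub {G H : ℂ → Matrix α β ℂ} (hG : MatRHPDecay k G) (hH : MatRHPDecay k H) :
    MatRHPDecay k fun s => G s - H s :=
  fun i j => (hG i j).sub (hH i j)

theorem mul [Fintype β] {G : ℂ → Matrix α β ℂ} {H : ℂ → Matrix β δ ℂ} (hG : MatRHPDecay k G)
    (hH : MatRHPDecay l H) : MatRHPDecay (k + l) fun s => G s * H s := fun i j => by
  simp only [Matrix.mul_apply]
  exact RHPDecay.sum _ fun x _ => (hG i x).mul (hH x j)

theorem const_mul [Fintype β] (M : Matrix α β ℂ) {H : ℂ → Matrix β δ ℂ}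
    (hH : MatRHPDecay k H) : MatRHPDecay k fun s => M * H s := by
  simpa using (const M).mul hH

theorem mul_const [Fintype β] {G : ℂ → Matrix α β ℂ} (hG : MatRHPDecay k G)
    (M : Matrix β δ ℂ) : MatRHPDecay k fun s => G s * M := by
  simpa using hG.mul (const M)

theorem mono (hkl : k ≤ l) {G : ℂ → Matrix α β ℂ} (hG : MatRHPDecay l G) : MatRHPDecay k G :=
  fun i j => (hG i j).mono hkl

theorem bilin [Fintype α] [Fintype β] {G : ℂ → Matrix α β ℂ} (hG : MatRHPDecay k G)
    (u : α → ℂ) (v : β → ℂ) : RHPDecay k fun s => u ⬝ᵥ (G s *ᵥ v) := by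
  simp only [dotProduct, Matrix.mulVec]
  exact RHPDecay.sum _ fun i _ => (RHPDecay.sum _ fun j _ => (hG i j).mul_const _).const_mul _

end MatRHPDecay

/-! ### Resolvents of matrices and their decay. -/

section Resolvent

variable {ι : Type*} [Fintype ι] [DecidableEq ι]

/-- The resolvent `(s - A)⁻¹`. -/
noncomputable def resolv (A : Matrix ι ι ℂ) (s : ℂ) : Matrix ι ι ℂ := (s • 1 - A)⁻¹

/-- All eigenvalues of `A` have negative real part. -/
def Hurwitz (A : Matrix ι ι ℂ) : Prop := ∀ s : ℂ, 0 ≤ s.re → (s • 1 - A).det ≠ 0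

theorem mul_resolv {A : Matrix ι ι ℂ} {s : ℂ} (h : (s • 1 - A).det ≠ 0) :
    (s • 1 - A) * resolv A s = 1 :=
  Matrix.mul_nonsing_inv _ (isUnit_iff_ne_zero.2 h)

theorem resolv_mul {A : Matrix ι ι ℂ} {s : ℂ} (h : (s • 1 - A).det ≠ 0) :
    resolv A s * (s • 1 - A) = 1 :=
  Matrix.nonsing_inv_mul _ (isUnit_iff_ne_zero.2 h)

theorem resolv_mul_self {A : Matrix ι ι ℂ} {s : ℂ} (h : (s • 1 - A).det ≠ 0) :
    resolv A s * A = s • resolv A s - 1 := by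
  have := resolv_mul h
  rw [mul_sub, mul_smul_comm, mul_one] at this
  rw [← this]
  abel

theorem self_mul_resolv {A : Matrix ι ι ℂ} {s : ℂ} (h : (s • 1 - A).det ≠ 0) :
    A * resolv A s = s • resolv A s - 1 := by
  have := mul_resolv h
  rw [sub_mul, smul_mul_assoc, one_mul] at this
  rw [← this]
  abel

theorem resolv_sub_resolv {A : Matrix ι ι ℂ} {s t : ℂ} (hs : (s • 1 - A).det ≠ 0)
    (ht : (t • 1 - A).det ≠ 0) :
    resolv A s - resolv A t = (t - s) • (resolv A s * resolv A t) := by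
  calc resolv A s - resolv A t
      = resolv A s * ((t • 1 - A) * resolv A t) - resolv A s * (s • 1 - A) * resolv A t := by
        rw [mul_resolv ht, resolv_mul hs, mul_one, one_mul]
    _ = resolv A s * ((t • 1 - A) - (s • 1 - A)) * resolv A t := by
        simp only [mul_sub, sub_mul, mul_assoc]
    _ = (t - s) • (resolv A s * resolv A t) := by
        rw [sub_sub_sub_cancel_right, ← sub_smul, mul_smul_comm, mul_one, smul_mul_assoc]

theorem differentiable_det {M : ℂ → Matrix ι ι ℂ} (hM : ∀ i j, Differentiable ℂ fun s => M s i j) :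
    Differentiable ℂ fun s => (M s).det := by
  simp only [Matrix.det_apply]
  exact Differentiable.fun_sum fun σ _ =>
    (Differentiable.fun_finsetProd fun i _ => hM _ _).const_smul _

/-- Cramer's rule: adjugate and determinant are polynomial in the entries. -/
theorem analyticAt_resolv {A : Matrix ι ι ℂ} {s : ℂ} (h : (s • 1 - A).det ≠ 0) (i j : ι) :
    AnalyticAt ℂ (fun z => resolv A z i j) s := by
  have hent : ∀ i j, Differentiable ℂ fun z : ℂ => (z • (1 : Matrix ι ι ℂ) - A) i j := by
    intro i j
    simp only [Matrix.sub_apply, Matrix.smul_apply, smul_eq_mul]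
    fun_prop
  have hdet := differentiable_det hent
  have hadj : Differentiable ℂ fun z : ℂ => (z • (1 : Matrix ι ι ℂ) - A).adjugate i j := by
    simp only [Matrix.adjugate_apply]
    refine differentiable_det fun a b => ?_
    simp only [Matrix.updateRow_apply]
    split_ifs
    · exact differentiable_const _
    · exact hent a b
  have : (fun z => resolv A z i j) = fun z : ℂ => ((z • (1 : Matrix ι ι ℂ) - A).det)⁻¹ *
      (z • (1 : Matrix ι ι ℂ) - A).adjugate i j := by
    funext z
    simp [resolv, Matrix.inv_def]
  rw [this]
  exact ((hdet.analyticAt s).inv h).mul (hadj.analyticAt s)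

section Norms

attribute [local instance] Matrix.linftyOpNormedRing Matrix.linftyOpNormedAlgebra
  Matrix.linftyOpNormedAddCommGroup Matrix.linftyOpNormedSpace

theorem norm_entry_le {α β : Type*} [Fintype α] [Fintype β] (M : Matrix α β ℂ) (i : α) (j : β) :
    ‖M i j‖ ≤ ‖M‖ := by
  rw [Matrix.linfty_opNorm_def]
  have h1 : ‖M i j‖₊ ≤ ∑ j, ‖M i j‖₊ :=
    Finset.single_le_sum (f := fun j => ‖M i j‖₊) (fun _ _ => zero_le) (Finset.mem_univ j)
  have h2 : (∑ j, ‖M i j‖₊) ≤ Finset.univ.sup fun i => ∑ j, ‖M i j‖₊ :=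
    Finset.le_sup (f := fun i => ∑ j, ‖M i j‖₊) (Finset.mem_univ i)
  exact_mod_cast h1.trans h2

/-- From s R = A R + 1 and ‖A‖ ≤ |s|/2. The factor ‖1‖ is kept because it is 0, not 1, for an empty
index type. -/
theorem norm_resolv_le_of_large {A : Matrix ι ι ℂ} {s : ℂ} (h : (s • 1 - A).det ≠ 0)
    (h1 : 1 ≤ ‖s‖) (h2 : 2 * ‖A‖ ≤ ‖s‖) :
    ‖resolv A s‖ ≤ 4 * ‖(1 : Matrix ι ι ℂ)‖ / (1 + ‖s‖) := by
  have e : s • resolv A s = A * resolv A s + 1 := by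
    rw [self_mul_resolv h]
    abel
  have h3 : ‖s‖ * ‖resolv A s‖ ≤ ‖A‖ * ‖resolv A s‖ + ‖(1 : Matrix ι ι ℂ)‖ := by
    rw [← norm_smul, e]
    exact (norm_add_le _ _).trans (add_le_add_left (norm_mul_le _ _) _)
  have h4 : ‖s‖ * ‖resolv A s‖ ≤ 2 * ‖(1 : Matrix ι ι ℂ)‖ := by
    nlinarith [norm_nonneg (resolv A s)]
  rw [le_div_iff₀ (by linarith)]
  nlinarith [norm_nonneg (resolv A s)]

theorem Hurwitz.decay {A : Matrix ι ι ℂ} (hA : Hurwitz A) : MatRHPDecay 1 (resolv A) :=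
  fun i j => RHPDecay.of_large (fun s hs => analyticAt_resolv (hA s hs) i j)
    ⟨4 * ‖(1 : Matrix ι ι ℂ)‖, max 1 (2 * ‖A‖), fun s hs h => (norm_entry_le _ i j).trans (by
      rw [pow_one]
      exact norm_resolv_le_of_large (hA s hs) ((le_max_left _ _).trans h)
        ((le_max_right _ _).trans h))⟩

end Norms

theorem Hurwitz.decay_bilin {A : Matrix ι ι ℂ} (hA : Hurwitz A) {α β : Type*}
    (C : Matrix α ι ℂ) (B : Matrix ι β ℂ) : MatRHPDecay 1 fun s => C * resolv A s * B :=
  (hA.decay.const_mul C).mul_const B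

end Resolvent

/-! ### Series connection of two systems. -/

section Cascade

variable {ι κ : Type*} [DecidableEq ι] [DecidableEq κ]

theorem smul_one_sub_fromBlocks (A : Matrix ι ι ℂ) (M : Matrix ι κ ℂ) (A' : Matrix κ κ ℂ) (s : ℂ) :
    s • (1 : Matrix (ι ⊕ κ) (ι ⊕ κ) ℂ) - Matrix.fromBlocks A M 0 A' =
      Matrix.fromBlocks (s • 1 - A) (-M) 0 (s • 1 - A') := by
  rw [← Matrix.fromBlocks_one, Matrix.fromBlocks_smul, sub_eq_add_neg, Matrix.fromBlocks_neg,
    Matrix.fromBlocks_add]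
  simp [sub_eq_add_neg]

variable [Fintype ι] [Fintype κ]

theorem Hurwitz.cascade {A : Matrix ι ι ℂ} {A' : Matrix κ κ ℂ} (hA : Hurwitz A) (hA' : Hurwitz A')
    (M : Matrix ι κ ℂ) : Hurwitz (Matrix.fromBlocks A M 0 A') := fun s hs => by
  rw [smul_one_sub_fromBlocks, Matrix.det_fromBlocks_zero₂₁]
  exact mul_ne_zero (hA s hs) (hA' s hs)

theorem resolv_fromBlocks {A : Matrix ι ι ℂ} {A' : Matrix κ κ ℂ} {s : ℂ}
    (h : (s • 1 - A).det ≠ 0) (h' : (s • 1 - A').det ≠ 0) (M : Matrix ι κ ℂ) :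
    resolv (Matrix.fromBlocks A M 0 A') s =
      Matrix.fromBlocks (resolv A s) (resolv A s * M * resolv A' s) 0 (resolv A' s) := by
  rw [resolv, smul_one_sub_fromBlocks]
  refine Matrix.inv_eq_right_inv ?_
  rw [Matrix.fromBlocks_multiply, mul_resolv h, mul_resolv h', ← Matrix.fromBlocks_one,
    ← Matrix.mul_assoc, ← Matrix.mul_assoc, mul_resolv h]
  simp

/-- The product of a strictly proper transfer function and a proper one, and a direct term. -/
theorem cascade_transfer {α β δ : Type*} [Fintype β] {A : Matrix ι ι ℂ} {A' : Matrix κ κ ℂ} {s : ℂ}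
    (h : (s • 1 - A).det ≠ 0) (h' : (s • 1 - A').det ≠ 0) (B : Matrix ι β ℂ) (C : Matrix α ι ℂ)
    (D : Matrix α β ℂ) (B' : Matrix κ δ ℂ) (C' : Matrix β κ ℂ) (D' : Matrix β δ ℂ)
    (hD : D * D' = 0) :
    (C * resolv A s * B + D) * (C' * resolv A' s * B' + D') =
      Matrix.fromCols C (D * C') * resolv (Matrix.fromBlocks A (B * C') 0 A') s *
        Matrix.fromRows (B * D') B' := by
  rw [resolv_fromBlocks h h', Matrix.fromCols_mul_fromBlocks, Matrix.fromCols_mul_fromRows]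
  simp only [Matrix.add_mul, Matrix.mul_add, hD, Matrix.mul_assoc, Matrix.mul_zero,
    add_zero]
  abel

end Cascade

/-! ### Residues of partial fraction expansions. -/

section PoleResidue

/-- The residues of a partial fraction expansion add up to zero at every point where the function
is continuous. -/
theorem sum_residue_eq_zero {N : ℕ} {φ : ℂ → ℂ} {z₀ : ℂ} (hφ : ContinuousAt φ z₀)
    (pole a : Fin N → ℂ) (d : ℂ)
    (h : ∀ᶠ s in 𝓝[≠] z₀, φ s = (∑ k, (s - pole k)⁻¹ * a k) + d) :
    (∑ k, if pole k = z₀ then a k else 0) = 0 := by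
  have hid : Filter.Tendsto (fun s : ℂ => s - z₀) (𝓝[≠] z₀) (𝓝 0) := by
    have : ContinuousAt (fun s : ℂ => s - z₀) z₀ := by fun_prop
    simpa using this.tendsto.mono_left nhdsWithin_le_nhds
  -- The limit of (s - z₀) φ(s) is computed twice: it is 0 by continuity of φ, and the sum of the
  -- residues at z₀ by the expansion.
  have h1 : Filter.Tendsto (fun s => (s - z₀) * φ s) (𝓝[≠] z₀) (𝓝 0) := by
    simpa using hid.mul (hφ.tendsto.mono_left nhdsWithin_le_nhds)
  have h2 : Filter.Tendsto (fun s => (∑ k, (s - z₀) * (s - pole k)⁻¹ * a k) + (s - z₀) * d)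
      (𝓝[≠] z₀) (𝓝 ((∑ k, if pole k = z₀ then a k else 0) + 0 * d)) := by
    refine (tendsto_finsetSum _ fun k _ => ?_).add (hid.mul_const d)
    split_ifs with hk
    · refine tendsto_const_nhds.congr' ?_
      filter_upwards [self_mem_nhdsWithin] with s hs
      rw [hk, mul_inv_cancel₀ (sub_ne_zero.2 hs), one_mul]
    · have hc : ContinuousAt (fun s => (s - pole k)⁻¹) z₀ :=
        ContinuousAt.inv₀ (by fun_prop) (sub_ne_zero.2 (Ne.symm hk))
      simpa using (hid.mul (hc.tendsto.mono_left nhdsWithin_le_nhds)).mul_const (a k)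
  have h3 := tendsto_nhds_unique (h1.congr' ?_) h2
  · simpa using h3.symm
  · filter_upwards [h] with s hs
    rw [hs, mul_add, Finset.mul_sum]
    simp only [mul_assoc]

end PoleResidue

/-! ### Energy on the imaginary axis and first-order optimality. -/

section Energy

variable {p m q : ℕ}

/-- The squared `L²` norm of the restriction of `G` to the imaginary axis. -/
noncomputable def axisEnergy (G : ℂ → Matrix (Fin p) (Fin m) ℂ) : ENNReal :=
  ∫⁻ ω : ℝ, ENNReal.ofReal (frobSq (G (Complex.I * (ω : ℂ))))

theorem ofReal_two_pi_inv_ne_zero : ENNReal.ofReal (1 / (2 * Real.pi)) ≠ 0 := by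
  rw [Ne, ENNReal.ofReal_eq_zero, not_le]
  positivity

theorem h2Norm_le_iff {G G' : ℂ → Matrix (Fin p) (Fin m) ℂ} :
    h2Norm G ≤ h2Norm G' ↔ axisEnergy G ≤ axisEnergy G' := by
  rw [h2Norm, h2Norm, ENNReal.rpow_le_rpow_iff (by norm_num),
    ENNReal.mul_le_mul_iff_right ofReal_two_pi_inv_ne_zero ENNReal.ofReal_ne_top]
  rfl

theorem h2Norm_lt_top_iff {G : ℂ → Matrix (Fin p) (Fin m) ℂ} :
    h2Norm G < ⊤ ↔ axisEnergy G < ⊤ := by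
  rw [h2Norm, ENNReal.rpow_lt_top_iff_of_pos (by norm_num), lt_top_iff_ne_top, lt_top_iff_ne_top,
    Ne, ENNReal.mul_eq_top]
  simp [axisEnergy, Real.pi_pos]

theorem frobSq_le {M : Matrix (Fin p) (Fin m) ℂ} {c : ℝ} (h : ∀ i j, ‖M i j‖ ≤ c) :
    frobSq M ≤ p * m * c ^ 2 := by
  have : frobSq M ≤ ∑ _i : Fin p, ∑ _j : Fin m, c ^ 2 :=
    Finset.sum_le_sum fun i _ => Finset.sum_le_sum fun j _ =>
      pow_le_pow_left₀ (norm_nonneg _) (h i j) 2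
  simpa [mul_assoc] using this

theorem frobSq_nonneg (M : Matrix (Fin p) (Fin m) ℂ) : 0 ≤ frobSq M :=
  Finset.sum_nonneg fun _ _ => Finset.sum_nonneg fun _ _ => by positivity

theorem sq_norm_entry_le_frobSq (M : Matrix (Fin p) (Fin m) ℂ) (i : Fin p) (j : Fin m) :
    ‖M i j‖ ^ 2 ≤ frobSq M :=
  (Finset.single_le_sum (f := fun j => ‖M i j‖ ^ 2) (fun _ _ => by positivity)
    (Finset.mem_univ j)).trans (Finset.single_le_sum (f := fun i => ∑ j, ‖M i j‖ ^ 2)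
      (fun _ _ => Finset.sum_nonneg fun _ _ => by positivity) (Finset.mem_univ i))

theorem sq_div_le (K ω : ℝ) : (K / (1 + |ω|)) ^ 2 ≤ K ^ 2 * (1 + ω ^ 2)⁻¹ := by
  rw [div_pow, div_eq_mul_inv]
  gcongr
  nlinarith [abs_nonneg ω, sq_abs ω]

theorem MatRHPDecay.bound_uniform {k : ℕ} {α β : Type*} [Fintype α] [Fintype β]
    {G : ℂ → Matrix α β ℂ} (hG : MatRHPDecay k G) :
    ∃ K : ℝ, 0 ≤ K ∧ ∀ s : ℂ, 0 ≤ s.re → ∀ i j, ‖G s i j‖ ≤ K / (1 + ‖s‖) ^ k := by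
  choose K hK0 hK using fun i j => (hG i j).bound_nonneg
  refine ⟨∑ i, ∑ j, K i j, Finset.sum_nonneg fun _ _ => Finset.sum_nonneg fun _ _ => hK0 _ _,
    fun s hs i j => (hK i j s hs).trans ?_⟩
  gcongr
  exact (Finset.single_le_sum (f := fun j => K i j) (fun _ _ => hK0 _ _)
    (Finset.mem_univ j)).trans (Finset.single_le_sum (f := fun i => ∑ j, K i j)
      (fun _ _ => Finset.sum_nonneg fun _ _ => hK0 _ _) (Finset.mem_univ i))

theorem MatRHPDecay.bound_axis {α β : Type*} [Fintype α] [Fintype β]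
    {G : ℂ → Matrix α β ℂ} (hG : MatRHPDecay 1 G) :
    ∃ K : ℝ, 0 ≤ K ∧ ∀ ω : ℝ, ∀ i j, ‖G (Complex.I * ω) i j‖ ≤ K / (1 + |ω|) := by
  obtain ⟨K, hK0, hK⟩ := hG.bound_uniform
  exact ⟨K, hK0, fun ω i j => by simpa using hK (Complex.I * ω) (by simp) i j⟩

theorem axisEnergy_lt_top {G : ℂ → Matrix (Fin p) (Fin m) ℂ} (hG : MatRHPDecay 1 G) :
    axisEnergy G < ⊤ := by
  obtain ⟨K, hK0, hK⟩ := hG.bound_axis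
  have hint : MeasureTheory.Integrable fun ω : ℝ => (p * m * K ^ 2 : ℝ) * (1 + ω ^ 2)⁻¹ :=
    integrable_inv_one_add_sq.const_mul _
  refine lt_of_le_of_lt (MeasureTheory.lintegral_mono fun ω => ENNReal.ofReal_le_ofReal ?_)
    hint.lintegral_lt_top
  refine (frobSq_le (hK ω)).trans ?_
  rw [mul_assoc _ (K ^ 2)]
  exact mul_le_mul_of_nonneg_left (sq_div_le K ω) (by positivity)

/-- A transfer function with finite `H₂` norm has no feed-through. -/
theorem eq_zero_of_axisEnergy_lt_top {G : ℂ → Matrix (Fin p) (Fin m) ℂ}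
    {M : Matrix (Fin p) (Fin m) ℂ} (hG : MatRHPDecay 1 G)
    (h : axisEnergy (fun s => G s + M) < ⊤) : M = 0 := by
  by_contra hM
  obtain ⟨i, j, hij⟩ : ∃ i j, M i j ≠ 0 := by
    by_contra hc
    push Not at hc
    exact hM (Matrix.ext hc)
  have hd : 0 < ‖M i j‖ := norm_pos_iff.2 hij
  obtain ⟨K, hK0, hK⟩ := hG.bound_axis
  -- Beyond ρ the decaying part is at most half of |M i j|, so the integrand stays above a positive
  -- constant on a half-line.
  set ρ : ℝ := 2 * K / ‖M i j‖ with hρ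
  have hlow : ∀ ω ∈ Set.Ici ρ, ENNReal.ofReal ((‖M i j‖ / 2) ^ 2) ≤
      ENNReal.ofReal (frobSq (G (Complex.I * (ω : ℂ)) + M)) := by
    intro ω hω
    have hω0 : 0 ≤ ω := le_trans (by positivity) hω
    refine ENNReal.ofReal_le_ofReal (le_trans ?_ (sq_norm_entry_le_frobSq _ i j))
    refine pow_le_pow_left₀ (by positivity) ?_ 2
    have h1 : K / (1 + |ω|) ≤ ‖M i j‖ / 2 := by
      rw [div_le_div_iff₀ (by positivity) (by norm_num), abs_of_nonneg hω0]
      have : ρ ≤ ω := hω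
      rw [hρ, div_le_iff₀ hd] at this
      nlinarith
    have h2 := norm_sub_norm_le (M i j) (-(G (Complex.I * ω) i j))
    rw [norm_neg, sub_neg_eq_add, add_comm (M i j)] at h2
    have h3 := hK ω i j
    rw [Matrix.add_apply]
    linarith
  have : (⊤ : ENNReal) ≤ axisEnergy (fun s => G s + M) := by
    calc (⊤ : ENNReal) = ∫⁻ _ω in Set.Ici ρ, ENNReal.ofReal ((‖M i j‖ / 2) ^ 2) := by
          rw [MeasureTheory.setLIntegral_const, Real.volume_Ici, ENNReal.mul_top]
          rw [Ne, ENNReal.ofReal_eq_zero, not_le]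
          positivity
      _ ≤ ∫⁻ ω in Set.Ici ρ, ENNReal.ofReal (frobSq (G (Complex.I * (ω : ℂ)) + M)) :=
          MeasureTheory.setLIntegral_mono' measurableSet_Ici hlow
      _ ≤ _ := MeasureTheory.setLIntegral_le_lintegral _ _
  exact absurd h (not_lt.2 this)

/-- The constant 6 is 4 + 2: the square of ε(z + εw) contributes at most 4 ε² k², and the cross term
of x with ε² w at most 2 ε² k². -/
theorem sq_norm_sub_le {x z w : ℂ} {ε k : ℝ} (hε : 0 ≤ ε) (hε1 : ε ≤ 1) (hx : ‖x‖ ≤ k)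
    (hz : ‖z‖ ≤ k) (hw : ‖w‖ ≤ k) :
    ‖x - ((ε : ℂ) * z + (ε : ℂ) ^ 2 * w)‖ ^ 2 ≤
      ‖x‖ ^ 2 - 2 * ε * (x * (starRingEnd ℂ) z).re + ε ^ 2 * (6 * k ^ 2) := by
  have hk : 0 ≤ k := (norm_nonneg x).trans hx
  have e : (ε : ℂ) * z + (ε : ℂ) ^ 2 * w = ε * (z + ε * w) := by ring
  have h1 : ‖z + ε * w‖ ≤ 2 * k := by
    refine (norm_add_le _ _).trans ?_
    rw [norm_mul, Complex.norm_real, Real.norm_of_nonneg hε]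
    nlinarith [norm_nonneg w]
  have h2 : -(k * k) ≤ (x * (starRingEnd ℂ) w).re := by
    have := (abs_le.1 (Complex.abs_re_le_norm (x * (starRingEnd ℂ) w))).1
    rw [norm_mul, RCLike.norm_conj] at this
    nlinarith [norm_nonneg x, norm_nonneg w]
  rw [e, ← Complex.normSq_eq_norm_sq, Complex.normSq_sub, Complex.normSq_eq_norm_sq,
    Complex.normSq_eq_norm_sq, norm_mul, Complex.norm_real, Real.norm_of_nonneg hε]
  have e2 : (x * (starRingEnd ℂ) (ε * (z + ε * w))).re =
      ε * (x * (starRingEnd ℂ) z).re + ε ^ 2 * (x * (starRingEnd ℂ) w).re := by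
    simp only [map_mul, map_add, Complex.conj_ofReal]
    rw [show x * (ε * ((starRingEnd ℂ) z + ε * (starRingEnd ℂ) w)) =
      ((ε : ℝ) : ℂ) * (x * (starRingEnd ℂ) z) + ((ε ^ 2 : ℝ) : ℂ) * (x * (starRingEnd ℂ) w) by
        push_cast; ring]
    simp only [Complex.add_re, Complex.re_ofReal_mul]
  rw [e2]
  have h3 : (ε * ‖z + ε * w‖) ^ 2 ≤ ε ^ 2 * (4 * k ^ 2) := by
    rw [mul_pow]
    refine mul_le_mul_of_nonneg_left ?_ (by positivity)
    nlinarith [norm_nonneg (z + ε * w)]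
  nlinarith [mul_le_mul_of_nonneg_left h2 (sq_nonneg ε)]

/-- First-order optimality for the squared `L²` norm along a curve `X - ε Q + O(ε²)`. -/
theorem re_integral_nonpos_of_forall_le {X Q : ℝ → Matrix (Fin p) (Fin q) ℂ}
    {R : ℝ → ℝ → Matrix (Fin p) (Fin q) ℂ} {K ε₀ : ℝ} (hε₀ : 0 < ε₀)
    (hXc : ∀ i j, Continuous fun ω => X ω i j) (hQc : ∀ i j, Continuous fun ω => Q ω i j)
    (hX : ∀ ω i j, ‖X ω i j‖ ≤ K / (1 + |ω|)) (hQ : ∀ ω i j, ‖Q ω i j‖ ≤ K / (1 + |ω|))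
    (hR : ∀ ε, 0 < ε → ε < ε₀ → ∀ ω i j, ‖R ε ω i j‖ ≤ K / (1 + |ω|))
    (hle : ∀ ε, 0 < ε → ε < ε₀ → ∫⁻ ω, ENNReal.ofReal (frobSq (X ω)) ≤
      ∫⁻ ω, ENNReal.ofReal (frobSq (X ω - ((ε : ℂ) • Q ω + (ε : ℂ) ^ 2 • R ε ω)))) :
    (∫ ω, ∑ i, ∑ j, X ω i j * (starRingEnd ℂ) (Q ω i j)).re ≤ 0 := by
  set φ : ℝ → ℂ := fun ω => ∑ i, ∑ j, X ω i j * (starRingEnd ℂ) (Q ω i j) with hφ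
  have hφc : Continuous φ := continuous_finsetSum _ fun i _ => continuous_finsetSum _ fun j _ =>
    (hXc i j).mul (Complex.continuous_conj.comp (hQc i j))
  have hφi : MeasureTheory.Integrable φ := by
    refine RHPDecay.integrable_of_bound hφc (K := p * q * K ^ 2) fun ω => ?_
    have h1 : ‖φ ω‖ ≤ ∑ _i : Fin p, ∑ _j : Fin q, K ^ 2 / (1 + |ω|) ^ 2 := by
      refine (norm_sum_le _ _).trans (Finset.sum_le_sum fun i _ => (norm_sum_le _ _).trans
        (Finset.sum_le_sum fun j _ => ?_))
      rw [norm_mul, RCLike.norm_conj, pow_two, pow_two, ← div_mul_div_comm]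
      exact mul_le_mul (hX ω i j) (hQ ω i j) (norm_nonneg _) ((norm_nonneg _).trans (hX ω i j))
    refine h1.trans (le_of_eq ?_)
    simp
    ring
  have hFc : Continuous fun ω => frobSq (X ω) := continuous_finsetSum _ fun i _ =>
    continuous_finsetSum _ fun j _ => (hXc i j).norm.pow 2
  have hFi : MeasureTheory.Integrable fun ω => frobSq (X ω) := by
    refine (integrable_inv_one_add_sq.const_mul (p * q * K ^ 2 : ℝ)).mono' hFc.aestronglyMeasurable
      (Filter.Eventually.of_forall fun ω => ?_)
    rw [Real.norm_of_nonneg (frobSq_nonneg _)]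
    refine (frobSq_le (hX ω)).trans ?_
    rw [mul_assoc _ (K ^ 2)]
    exact mul_le_mul_of_nonneg_left (sq_div_le K ω) (by positivity)
  -- Total mass of the quadratic remainder; the factor π is the integral of 1/(1 + ω²).
  set L : ℝ := (p * q * (6 * K ^ 2)) * Real.pi with hL
  have hL0 : 0 ≤ L := by positivity
  have main : ∀ ε, 0 < ε → ε < ε₀ → ε ≤ 1 → 2 * (∫ ω, φ ω).re ≤ ε * L := by
    intro ε h0 h1 h2
    set ψ : ℝ → ℝ := fun ω => frobSq (X ω) - 2 * ε * (φ ω).re +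
      ε ^ 2 * ((p * q * (6 * K ^ 2)) * (1 + ω ^ 2)⁻¹) with hψ
    have hψi : MeasureTheory.Integrable ψ := (hFi.sub (hφi.re.const_mul _)).add
      ((integrable_inv_one_add_sq.const_mul _).const_mul _)
    have hpt : ∀ ω, frobSq (X ω - ((ε : ℂ) • Q ω + (ε : ℂ) ^ 2 • R ε ω)) ≤ ψ ω := by
      intro ω
      have h3 : frobSq (X ω - ((ε : ℂ) • Q ω + (ε : ℂ) ^ 2 • R ε ω)) ≤ ∑ i, ∑ j,
          (‖X ω i j‖ ^ 2 - 2 * ε * (X ω i j * (starRingEnd ℂ) (Q ω i j)).re +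
            ε ^ 2 * (6 * (K / (1 + |ω|)) ^ 2)) :=
        Finset.sum_le_sum fun i _ => Finset.sum_le_sum fun j _ =>
          sq_norm_sub_le h0.le h2 (hX ω i j) (hQ ω i j) (hR ε h0 h1 ω i j)
      refine h3.trans ?_
      simp only [Finset.sum_add_distrib, Finset.sum_sub_distrib, ← Finset.mul_sum, hψ, hφ,
        Complex.re_sum, Finset.sum_const, Finset.card_univ, Fintype.card_fin, nsmul_eq_mul]
      have h4 := mul_le_mul_of_nonneg_left (sq_div_le K ω)
        (show 0 ≤ (p : ℝ) * q * 6 * ε ^ 2 by positivity)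
      simp only [frobSq]
      linarith
    have h5 : ∫ ω, frobSq (X ω) ≤ ∫ ω, ψ ω := by
      have h6 := (hle ε h0 h1).trans (MeasureTheory.lintegral_mono fun ω =>
        ENNReal.ofReal_le_ofReal (hpt ω))
      have hψ0 : ∀ ω, 0 ≤ ψ ω := fun ω => (frobSq_nonneg _).trans (hpt ω)
      rw [← MeasureTheory.ofReal_integral_eq_lintegral_ofReal hFi
        (Filter.Eventually.of_forall fun ω => frobSq_nonneg _),
        ← MeasureTheory.ofReal_integral_eq_lintegral_ofReal hψi
        (Filter.Eventually.of_forall hψ0)] at h6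
      exact (ENNReal.ofReal_le_ofReal_iff (MeasureTheory.integral_nonneg hψ0)).1 h6
    have h7 : ∫ ω, ψ ω = (∫ ω, frobSq (X ω)) - 2 * ε * (∫ ω, φ ω).re + ε ^ 2 * L := by
      have hre : ∫ ω, (φ ω).re = (∫ ω, φ ω).re := integral_re hφi
      have hi1 : MeasureTheory.Integrable fun ω => 2 * ε * (φ ω).re := hφi.re.const_mul _
      have hi2 : MeasureTheory.Integrable
          fun ω : ℝ => ε ^ 2 * ((p * q * (6 * K ^ 2) : ℝ) * (1 + ω ^ 2)⁻¹) :=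
        (integrable_inv_one_add_sq.const_mul _).const_mul _
      have hi3 : MeasureTheory.Integrable fun ω => frobSq (X ω) - 2 * ε * (φ ω).re := hFi.sub hi1
      simp only [hψ]
      rw [MeasureTheory.integral_add hi3 hi2, MeasureTheory.integral_sub hFi hi1,
        MeasureTheory.integral_const_mul, MeasureTheory.integral_const_mul,
        MeasureTheory.integral_const_mul, integral_univ_inv_one_add_sq, hL, ← hre]
    rw [h7] at h5
    have : ε * (2 * (∫ ω, φ ω).re) ≤ ε * (ε * L) := by nlinarith
    exact le_of_mul_le_mul_left this h0
  by_contra hc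
  push Not at hc
  set c := (∫ ω, φ ω).re
  -- The last entry gives ε(L + 1) ≤ c, which contradicts 2c ≤ εL when c > 0.
  set ε := min (min (ε₀ / 2) 1) (c / (L + 1)) with hεdef
  have hε : 0 < ε := by positivity
  have h1 := main ε hε (lt_of_le_of_lt ((min_le_left _ _).trans (min_le_left _ _))
    (by linarith)) ((min_le_left _ _).trans (min_le_right _ _))
  have h2 : ε * (L + 1) ≤ c := by
    rw [← le_div_iff₀ (by positivity)]
    exact min_le_right _ _
  nlinarith

end Energy

/-! ### Perturbation of state-space data. -/

section Perturbation

variable {ι : Type*} [Fintype ι] [DecidableEq ι]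

/-- The first variation of `C (s - A)⁻¹ B + D` in the direction `(A₁, B₁, C₁, D₁)`. -/
noncomputable def transferVariation {α β : Type*} (A : Matrix ι ι ℂ) (B : Matrix ι β ℂ)
    (C : Matrix α ι ℂ) (A₁ : Matrix ι ι ℂ) (B₁ : Matrix ι β ℂ) (C₁ : Matrix α ι ℂ)
    (D₁ : Matrix α β ℂ) (s : ℂ) : Matrix α β ℂ :=
  C₁ * resolv A s * B + C * resolv A s * B₁ + C * resolv A s * A₁ * resolv A s * B + D₁

theorem resolv_add_eq {A A₁ : Matrix ι ι ℂ} {s : ℂ} (h : (s • 1 - A).det ≠ 0)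
    (h' : (s • 1 - (A + A₁)).det ≠ 0) :
    resolv (A + A₁) s = resolv A s + resolv A s * A₁ * resolv (A + A₁) s := by
  have e : (s • 1 - A) * resolv (A + A₁) s = 1 + A₁ * resolv (A + A₁) s := by
    rw [show s • (1 : Matrix ι ι ℂ) - A = (s • 1 - (A + A₁)) + A₁ by abel, add_mul, mul_resolv h']
  calc resolv (A + A₁) s = resolv A s * ((s • 1 - A) * resolv (A + A₁) s) := by
        rw [← mul_assoc, resolv_mul h, one_mul]
    _ = _ := by rw [e, mul_add, mul_one, mul_assoc]

theorem resolv_add_eq' {A A₁ : Matrix ι ι ℂ} {s : ℂ} (h : (s • 1 - A).det ≠ 0)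
    (h' : (s • 1 - (A + A₁)).det ≠ 0) :
    resolv (A + A₁) s = resolv A s + resolv (A + A₁) s * A₁ * resolv A s := by
  have e : resolv (A + A₁) s * (s • 1 - A) = 1 + resolv (A + A₁) s * A₁ := by
    rw [show s • (1 : Matrix ι ι ℂ) - A = (s • 1 - (A + A₁)) + A₁ by abel, mul_add, resolv_mul h']
  calc resolv (A + A₁) s = resolv (A + A₁) s * (s • 1 - A) * resolv A s := by
        rw [mul_assoc, mul_resolv h, mul_one]
    _ = _ := by rw [e, add_mul, one_mul]

/-- Expanding the perturbed resolvent once from the left and once from the right gives an exact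
second-order remainder. It contains a single perturbed resolvent, between factors that do not depend
on ε, so one uniform bound on that resolvent controls it. -/
theorem transfer_perturb_eq {α β : Type*} {A A₁ : Matrix ι ι ℂ} {s : ℂ}
    (h : (s • 1 - A).det ≠ 0) {ε : ℂ} (h' : (s • 1 - (A + ε • A₁)).det ≠ 0)
    (B B₁ : Matrix ι β ℂ) (C C₁ : Matrix α ι ℂ) (D D₁ : Matrix α β ℂ) :
    (C + ε • C₁) * resolv (A + ε • A₁) s * (B + ε • B₁) + (D + ε • D₁) =
      (C * resolv A s * B + D) + (ε • transferVariation A B C A₁ B₁ C₁ D₁ s +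
        ε ^ 2 • ((C * resolv A s * A₁ + C₁) * resolv (A + ε • A₁) s *
          (A₁ * resolv A s * B + B₁))) := by
  have e1 := resolv_add_eq h h'
  have e2 := resolv_add_eq' h h'
  set Z := resolv (A + ε • A₁) s
  set Y := resolv A s
  have f1 : C₁ * Z * B = C₁ * Y * B + ε • (C₁ * Z * A₁ * Y * B) := by
    conv_lhs => rw [e2]
    simp only [Matrix.mul_add, Matrix.add_mul, Matrix.mul_smul, Matrix.smul_mul, Matrix.mul_assoc]
  have f2 : C * Z * B₁ = C * Y * B₁ + ε • (C * Y * A₁ * Z * B₁) := by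
    conv_lhs => rw [e1]
    simp only [Matrix.mul_add, Matrix.add_mul, Matrix.mul_smul, Matrix.smul_mul, Matrix.mul_assoc]
  have f3 : C * Z * B = C * Y * B + ε • (C * Y * A₁ * Y * B) +
      ε ^ 2 • (C * Y * A₁ * Z * A₁ * Y * B) := by
    conv_lhs => rw [e1, e2]
    simp only [Matrix.mul_add, Matrix.add_mul, Matrix.mul_smul, Matrix.smul_mul, Matrix.mul_assoc,
      smul_smul, pow_two, add_assoc]
  simp only [transferVariation, Matrix.add_mul, Matrix.mul_add, Matrix.mul_smul, Matrix.smul_mul,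
    smul_add, smul_smul, ← Matrix.mul_assoc, f1, f2, f3, pow_two]
  abel

section Norms

attribute [local instance] Matrix.linftyOpNormedRing Matrix.linftyOpNormedAlgebra
  Matrix.linftyOpNormedAddCommGroup Matrix.linftyOpNormedSpace

theorem norm_le_card_mul {α β : Type*} [Fintype α] [Fintype β] {M : Matrix α β ℂ} {c : ℝ}
    (hc : 0 ≤ c) (h : ∀ i j, ‖M i j‖ ≤ c) : ‖M‖ ≤ Fintype.card β * c := by
  lift c to NNReal using hc
  rw [Matrix.linfty_opNorm_def]
  have : (Finset.univ.sup fun i => ∑ j, ‖M i j‖₊) ≤ (Fintype.card β : NNReal) * c := by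
    refine Finset.sup_le fun i _ => ?_
    refine (Finset.sum_le_card_nsmul Finset.univ _ c fun j _ => h i j).trans (le_of_eq ?_)
    rw [nsmul_eq_mul, Finset.card_univ]
  exact_mod_cast this

theorem MatRHPDecay.norm_bound {α β : Type*} [Fintype α] [Fintype β] {k : ℕ}
    {G : ℂ → Matrix α β ℂ} (hG : MatRHPDecay k G) :
    ∃ K : ℝ, 0 ≤ K ∧ ∀ s : ℂ, 0 ≤ s.re → ‖G s‖ ≤ K / (1 + ‖s‖) ^ k := by
  obtain ⟨K, hK0, hK⟩ := hG.bound_uniform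
  refine ⟨Fintype.card β * K, by positivity, fun s hs => ?_⟩
  rw [mul_div_assoc]
  exact norm_le_card_mul (by positivity) (hK s hs)

/-- Small gain: s - A - εA₁ = (s - A)(1 - R εA₁), where R is the resolvent of A. Since R is bounded
on the whole half plane, ‖R εA₁‖ ≤ 1/2 for small ε, uniformly in s. The second factor is then
invertible, and the perturbed resolvent is at most twice as large as R. -/
theorem exists_perturbed_bound {α β : Type*} [Fintype α] [Fintype β] {A : Matrix ι ι ℂ}
    (hA : Hurwitz A) (A₁ : Matrix ι ι ℂ) {F : ℂ → Matrix α ι ℂ} {G : ℂ → Matrix ι β ℂ}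
    (hF : MatRHPDecay 0 F) (hG : MatRHPDecay 0 G) :
    ∃ ε₀ : ℝ, 0 < ε₀ ∧ ∃ K : ℝ, 0 ≤ K ∧ ∀ ε : ℝ, 0 < ε → ε < ε₀ →
      Hurwitz (A + (ε : ℂ) • A₁) ∧ ∀ s : ℂ, 0 ≤ s.re → ∀ i j,
        ‖(F s * resolv (A + (ε : ℂ) • A₁) s * G s) i j‖ ≤ K / (1 + ‖s‖) := by
  obtain ⟨K, hK0, hK⟩ := hA.decay.norm_bound
  obtain ⟨KF, hKF0, hKF⟩ := hF.norm_bound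
  obtain ⟨KG, hKG0, hKG⟩ := hG.norm_bound
  -- The summands 1 only keep the denominator positive when K or A₁ is zero.
  refine ⟨1 / (2 * ((K + 1) * (‖A₁‖ + 1))), by positivity, KF * (2 * K) * KG, by positivity,
    fun ε h0 h1 => ?_⟩
  rw [lt_div_iff₀ (by positivity)] at h1
  have hYK : ∀ s : ℂ, 0 ≤ s.re → ‖resolv A s‖ ≤ K := fun s hs => (hK s hs).trans
    (div_le_self hK0 (one_le_pow₀ (by linarith [norm_nonneg s])))
  have hsmall : ∀ s : ℂ, 0 ≤ s.re → ‖resolv A s * ((ε : ℂ) • A₁)‖ ≤ 1 / 2 := by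
    intro s hs
    refine (norm_mul_le _ _).trans ?_
    rw [norm_smul, Complex.norm_real, Real.norm_of_nonneg h0.le]
    have : ‖resolv A s‖ * (ε * ‖A₁‖) ≤ (K + 1) * (ε * (‖A₁‖ + 1)) := by
      gcongr
      · linarith [hYK s hs]
      · linarith
    linarith
  have hH : Hurwitz (A + (ε : ℂ) • A₁) := by
    intro s hs
    have e : s • 1 - (A + (ε : ℂ) • A₁) = (s • 1 - A) * (1 - resolv A s * ((ε : ℂ) • A₁)) := by
      rw [mul_sub, mul_one, ← mul_assoc, mul_resolv (hA s hs), one_mul]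
      abel
    rw [e, Matrix.det_mul]
    refine mul_ne_zero (hA s hs) ?_
    have hu : IsUnit (1 - resolv A s * ((ε : ℂ) • A₁)) :=
      isUnit_one_sub_of_norm_lt_one (lt_of_le_of_lt (hsmall s hs) (by norm_num))
    exact ((Matrix.isUnit_iff_isUnit_det _).1 hu).ne_zero
  refine ⟨hH, fun s hs i j => ?_⟩
  have hZ : ‖resolv (A + (ε : ℂ) • A₁) s‖ ≤ 2 * K / (1 + ‖s‖) := by
    have e := resolv_add_eq (hA s hs) (hH s hs)
    set Z := resolv (A + (ε : ℂ) • A₁) s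
    have h3 : ‖Z‖ ≤ ‖resolv A s‖ + 1 / 2 * ‖Z‖ := by
      conv_lhs => rw [e]
      exact (norm_add_le _ _).trans (add_le_add_right ((norm_mul_le _ _).trans
        (mul_le_mul_of_nonneg_right (hsmall s hs) (norm_nonneg _))) _)
    have h4 := hK s hs
    rw [pow_one] at h4
    rw [mul_div_assoc]
    linarith
  have hF' : ‖F s‖ ≤ KF := by simpa using hKF s hs
  have hG' : ‖G s‖ ≤ KG := by simpa using hKG s hs
  calc ‖(F s * resolv (A + (ε : ℂ) • A₁) s * G s) i j‖
      ≤ ‖F s * resolv (A + (ε : ℂ) • A₁) s * G s‖ := norm_entry_le _ i j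
    _ ≤ ‖F s‖ * ‖resolv (A + (ε : ℂ) • A₁) s‖ * ‖G s‖ :=
        (Matrix.linfty_opNorm_mul _ _).trans
          (mul_le_mul_of_nonneg_right (Matrix.linfty_opNorm_mul _ _) (norm_nonneg _))
    _ ≤ KF * (2 * K / (1 + ‖s‖)) * KG := by gcongr
    _ = KF * (2 * K) * KG / (1 + ‖s‖) := by ring

end Norms

end Perturbation

/-! ### Real matrices and conjugation symmetry. -/

section Real

variable {α β δ : Type*}

/-- A real matrix, as a complex one. -/
abbrev toC (M : Matrix α β ℝ) : Matrix α β ℂ := M.map Complex.ofReal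

theorem toC_mul [Fintype β] (M : Matrix α β ℝ) (N : Matrix β δ ℝ) :
    toC (M * N) = toC M * toC N :=
  Matrix.map_mul (f := Complex.ofRealHom)

theorem toC_add (M N : Matrix α β ℝ) : toC (M + N) = toC M + toC N :=
  Matrix.map_add _ Complex.ofReal_add M N

theorem toC_sub (M N : Matrix α β ℝ) : toC (M - N) = toC M - toC N :=
  Matrix.map_sub _ Complex.ofReal_sub M N

theorem toC_neg (M : Matrix α β ℝ) : toC (-M) = -toC M := by
  ext i j
  simp

theorem toC_smul (ε : ℝ) (M : Matrix α β ℝ) : toC (ε • M) = (ε : ℂ) • toC M := by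
  ext i j
  simp

theorem toC_zero : toC (0 : Matrix α β ℝ) = 0 := by
  ext i j
  simp

theorem toC_one [DecidableEq α] : toC (1 : Matrix α α ℝ) = 1 :=
  Matrix.map_one _ Complex.ofReal_zero Complex.ofReal_one

theorem toC_transpose (M : Matrix α β ℝ) : toC Mᵀ = (toC M)ᵀ := rfl

/-- `G` commutes with complex conjugation on the closed right half plane. -/
def RealSymm (G : ℂ → Matrix α β ℂ) : Prop :=
  ∀ s : ℂ, 0 ≤ s.re → G ((starRingEnd ℂ) s) = (G s).map (starRingEnd ℂ)

namespace RealSymm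

theorem const (M : Matrix α β ℝ) : RealSymm fun _ => toC M := fun s _ => by
  ext i j
  simp

theorem add {G H : ℂ → Matrix α β ℂ} (hG : RealSymm G) (hH : RealSymm H) :
    RealSymm fun s => G s + H s := fun s hs => by
  simp only [hG s hs, hH s hs]
  rw [Matrix.map_add _ (map_add _)]

theorem sub {G H : ℂ → Matrix α β ℂ} (hG : RealSymm G) (hH : RealSymm H) :
    RealSymm fun s => G s - H s := fun s hs => by
  simp only [hG s hs, hH s hs]
  rw [Matrix.map_sub _ (map_sub _)]

theorem mul [Fintype β] {G : ℂ → Matrix α β ℂ} {H : ℂ → Matrix β δ ℂ} (hG : RealSymm G)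
    (hH : RealSymm H) : RealSymm fun s => G s * H s := fun s hs => by
  simp only [hG s hs, hH s hs]
  rw [Matrix.map_mul]

theorem resolv [Fintype α] [DecidableEq α] {A : Matrix α α ℝ} (hA : Hurwitz (toC A)) :
    RealSymm (resolv (toC A)) := fun s hs => by
  refine Matrix.inv_eq_right_inv ?_
  have h := congrArg (fun M : Matrix α α ℂ => M.map (starRingEnd ℂ)) (mul_resolv (hA s hs))
  simp only [Matrix.map_mul] at h
  rw [Matrix.map_one _ (map_zero _) (map_one _)] at h
  convert h using 2
  ext i j
  by_cases hij : i = j <;> simp [hij]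

end RealSymm

end Real

/-! ### Normalised systems and membership in the weighted space. -/

namespace LTISystem

variable {n m p q r nw : ℕ}

theorem pencil_eq {S : LTISystem n m p} (hE : S.E = 1) (s : ℂ) :
    S.pencil s = s • 1 - toC S.A := by
  rw [pencil, hE, Matrix.map_one _ Complex.ofReal_zero Complex.ofReal_one]

theorem transfer_eq {S : LTISystem n m p} (hE : S.E = 1) (s : ℂ) :
    S.transfer s = toC S.C * resolv (toC S.A) s * toC S.B + toC S.D := by
  rw [transfer, pencil_eq hE, resolv]

theorem isStable_iff {S : LTISystem n m p} (hE : S.E = 1) : S.IsStable ↔ Hurwitz (toC S.A) := by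
  simp only [IsStable, Hurwitz, hE, pencil_eq hE, Matrix.det_one, isUnit_one, true_and]
  exact forall_congr' fun s => ⟨fun h h1 h2 => absurd (h h2) (not_lt.2 h1),
    fun h h1 => not_le.1 fun h2 => h h2 h1⟩

/-- Every stable system has a realization with `E = 1`. -/
theorem exists_normalized (S : LTISystem n m p) (hS : S.IsStable) :
    ∃ S' : LTISystem n m p, S'.E = 1 ∧ S'.D = S.D ∧ S'.transfer = S.transfer ∧ S'.IsStable := by
  set S' : LTISystem n m p := ⟨1, S.E⁻¹ * S.A, S.E⁻¹ * S.B, S.C, S.D⟩ with hS'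
  have hE : S'.E = 1 := rfl
  have hdet : S.E.det ≠ 0 := hS.1.ne_zero
  have hEE : toC S.E * toC S.E⁻¹ = 1 := by
    rw [← toC_mul, Matrix.mul_nonsing_inv _ hS.1, toC_one]
  have hp : ∀ s, S.pencil s = toC S.E * (s • 1 - toC S'.A) := by
    intro s
    rw [show S'.A = S.E⁻¹ * S.A from rfl, toC_mul, mul_sub, ← mul_assoc, hEE, one_mul,
      mul_smul_comm, mul_one]
    rfl
  have hinv : (toC S.E)⁻¹ = toC S.E⁻¹ := Matrix.inv_eq_right_inv hEE
  refine ⟨S', hE, rfl, ?_, ?_⟩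
  · funext s
    rw [transfer_eq hE, transfer, hp, Matrix.mul_inv_rev, hinv, show S'.B = S.E⁻¹ * S.B from rfl,
      toC_mul S.E⁻¹ S.B]
    simp only [Matrix.mul_assoc]
    rfl
  · rw [isStable_iff hE]
    intro s hs h0
    have : (S.pencil s).det = 0 := by rw [hp, Matrix.det_mul, h0, mul_zero]
    exact absurd (hS.2 s this) (not_lt.2 hs)

theorem transfer_decay {S : LTISystem n m p} (hE : S.E = 1) (hS : S.IsStable) :
    MatRHPDecay 0 S.transfer := by
  have := (((isStable_iff hE).1 hS).decay_bilin (toC S.C) (toC S.B)).mono (Nat.zero_le 1)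
  simpa only [← transfer_eq hE] using this.add (MatRHPDecay.const (toC S.D))

theorem transfer_realSymm {S : LTISystem n m p} (hE : S.E = 1) (hS : S.IsStable) :
    RealSymm S.transfer := by
  have := (((RealSymm.const S.C).mul (RealSymm.resolv ((isStable_iff hE).1 hS))).mul
    (RealSymm.const S.B)).add (RealSymm.const S.D)
  simpa only [← transfer_eq hE] using this

theorem const_mul_transfer_decay {W : LTISystem nw q m} (hWE : W.E = 1) (hW : W.IsStable)
    {D : Matrix (Fin p) (Fin m) ℝ} :
    MatRHPDecay 1 fun s => toC D * W.transfer s - toC (D * W.D) := by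
  have := ((isStable_iff hWE).1 hW).decay_bilin (toC D * toC W.C) (toC W.B)
  have e : (fun s => toC D * W.transfer s - toC (D * W.D)) =
      fun s => toC D * toC W.C * resolv (toC W.A) s * toC W.B := by
    funext s
    rw [transfer_eq hWE, toC_mul, Matrix.mul_add]
    simp only [Matrix.mul_assoc]
    abel
  rw [e]
  exact this

theorem transfer_mul_sub_decay {W : LTISystem nw q m} (hWE : W.E = 1) (hW : W.IsStable)
    {S : LTISystem n m p} (hE : S.E = 1) (hS : S.IsStable) :
    MatRHPDecay 1 fun s => S.transfer s * W.transfer s - toC (S.D * W.D) := by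
  have h1 := (((isStable_iff hE).1 hS).decay_bilin (toC S.C) (toC S.B)).mul (transfer_decay hWE hW)
  have h2 := h1.add (const_mul_transfer_decay hWE hW (D := S.D))
  have e : (fun s => S.transfer s * W.transfer s - toC (S.D * W.D)) = fun s =>
      toC S.C * resolv (toC S.A) s * toC S.B * W.transfer s +
        (toC S.D * W.transfer s - toC (S.D * W.D)) := by
    funext s
    rw [transfer_eq hE, Matrix.add_mul]
    abel
  rw [e]
  exact h2

theorem transfer_mul_decay {W : LTISystem nw q m} (hWE : W.E = 1) (hW : W.IsStable)
    {S : LTISystem n m p} (hE : S.E = 1) (hS : S.IsStable) (hD : S.D * W.D = 0) :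
    MatRHPDecay 1 fun s => S.transfer s * W.transfer s := by
  simpa [hD] using transfer_mul_sub_decay hWE hW hE hS

/-- The product of the two transfer functions differs from the constant S.D W.D by O(1/|s|) on the
axis. The constant has infinite energy unless it is zero. -/
theorem memWeightedH2_iff {W : LTISystem nw q m} (hWE : W.E = 1) (hW : W.IsStable)
    {S : LTISystem n m p} (hE : S.E = 1) :
    MemWeightedH2 W.transfer S ↔ S.IsStable ∧ S.D * W.D = 0 := by
  refine and_congr_right fun hS => ?_
  rw [weightedH2Norm, h2Norm_lt_top_iff]
  refine ⟨fun h => ?_, fun h => axisEnergy_lt_top (transfer_mul_decay hWE hW hE hS h)⟩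
  have h0 := eq_zero_of_axisEnergy_lt_top (M := toC (S.D * W.D))
    (transfer_mul_sub_decay hWE hW hE hS) (by simpa using h)
  ext i j
  simpa using congrFun (congrFun h0 i) j

/-- The first variation of the transfer function of `S` in the direction `(A₁, B₁, C₁, D₁)`. -/
noncomputable def variation (S : LTISystem n m p) (A₁ : Matrix (Fin n) (Fin n) ℂ)
    (B₁ : Matrix (Fin n) (Fin m) ℂ) (C₁ : Matrix (Fin p) (Fin n) ℂ)
    (D₁ : Matrix (Fin p) (Fin m) ℂ) : ℂ → Matrix (Fin p) (Fin m) ℂ :=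
  transferVariation (toC S.A) (toC S.B) (toC S.C) A₁ B₁ C₁ D₁

theorem transferVariation_decay {ι α β : Type*} [Fintype ι] [DecidableEq ι] {A : Matrix ι ι ℂ}
    (hA : Hurwitz A) (B : Matrix ι β ℂ) (C : Matrix α ι ℂ) (A₁ : Matrix ι ι ℂ)
    (B₁ : Matrix ι β ℂ) (C₁ : Matrix α ι ℂ) :
    MatRHPDecay 1 (transferVariation A B C A₁ B₁ C₁ 0) := by
  have h := ((hA.decay_bilin C₁ B).add (hA.decay_bilin C B₁)).add
    (((hA.decay_bilin C A₁).mul (hA.decay.mul_const B)).mono (show 1 ≤ 1 + 1 by norm_num))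
  have e : transferVariation A B C A₁ B₁ C₁ 0 = fun s => C₁ * resolv A s * B +
      C * resolv A s * B₁ + C * resolv A s * A₁ * (resolv A s * B) := by
    funext s
    simp only [transferVariation, add_zero, Matrix.mul_assoc]
  rw [e]
  exact h

/-- The condition on D₁ cancels the value at infinity, so that the direction itself has finite
weighted norm. -/
theorem variation_mul_decay {W : LTISystem nw q m} (hWE : W.E = 1) (hW : W.IsStable)
    {S : LTISystem n m p} (hE : S.E = 1) (hS : S.IsStable) (A₁ : Matrix (Fin n) (Fin n) ℂ)
    (B₁ : Matrix (Fin n) (Fin m) ℂ) (C₁ : Matrix (Fin p) (Fin n) ℂ)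
    {D₁ : Matrix (Fin p) (Fin m) ℝ} (hD : D₁ * W.D = 0) :
    MatRHPDecay 1 fun s => S.variation A₁ B₁ C₁ (toC D₁) s * W.transfer s := by
  have h1 := (transferVariation_decay ((isStable_iff hE).1 hS) (toC S.B) (toC S.C) A₁ B₁ C₁).mul
    (transfer_decay hWE hW)
  have h2 := h1.add (const_mul_transfer_decay hWE hW (D := D₁))
  have e : (fun s => S.variation A₁ B₁ C₁ (toC D₁) s * W.transfer s) = fun s =>
      transferVariation (toC S.A) (toC S.B) (toC S.C) A₁ B₁ C₁ 0 s * W.transfer s +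
        (toC D₁ * W.transfer s - toC (D₁ * W.D)) := by
    funext s
    simp only [hD, toC_zero, sub_zero, variation, transferVariation, add_zero, Matrix.add_mul]
  rw [e]
  exact h2

theorem variation_realSymm {S : LTISystem n m p} (hE : S.E = 1) (hS : S.IsStable)
    (A₁ : Matrix (Fin n) (Fin n) ℝ) (B₁ : Matrix (Fin n) (Fin m) ℝ)
    (C₁ : Matrix (Fin p) (Fin n) ℝ) (D₁ : Matrix (Fin p) (Fin m) ℝ) :
    RealSymm (S.variation (toC A₁) (toC B₁) (toC C₁) (toC D₁)) := by
  have hY := RealSymm.resolv ((isStable_iff hE).1 hS)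
  exact (((((RealSymm.const C₁).mul hY).mul (RealSymm.const S.B)).add
    (((RealSymm.const S.C).mul hY).mul (RealSymm.const B₁))).add
    (((((RealSymm.const S.C).mul hY).mul (RealSymm.const A₁)).mul hY).mul
      (RealSymm.const S.B))).add (RealSymm.const D₁)

theorem variation_neg (S : LTISystem n m p) (A₁ : Matrix (Fin n) (Fin n) ℂ)
    (B₁ : Matrix (Fin n) (Fin m) ℂ) (C₁ : Matrix (Fin p) (Fin n) ℂ)
    (D₁ : Matrix (Fin p) (Fin m) ℂ) (s : ℂ) :
    S.variation (-A₁) (-B₁) (-C₁) (-D₁) s = -S.variation A₁ B₁ C₁ D₁ s := by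
  simp only [variation, transferVariation, Matrix.mul_neg, Matrix.neg_mul]
  abel

/-- `S` minimizes the distance to `H` among all systems of its order. -/
def IsMinimizer (W : LTISystem nw q m) (H : LTISystem n m p) (S : LTISystem r m p) : Prop :=
  ∀ T : LTISystem r m p, MemWeightedH2 W.transfer T →
    weightedH2Norm W.transfer (fun s => H.transfer s - S.transfer s) ≤
      weightedH2Norm W.transfer (fun s => H.transfer s - T.transfer s)

/-! ### Stationarity of a best approximation. -/

section Stationarity

variable {W : LTISystem nw q m} {H : LTISystem n m p} {S : LTISystem r m p}

/-- The weighted error `(H - S) W`. -/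
noncomputable def weightedError (W : LTISystem nw q m) (H : LTISystem n m p) (S : LTISystem r m p)
    (s : ℂ) : Matrix (Fin p) (Fin q) ℂ :=
  (H.transfer s - S.transfer s) * W.transfer s

theorem weightedError_decay (hWE : W.E = 1) (hW : W.IsStable) (hHE : H.E = 1) (hH : H.IsStable)
    (hSE : S.E = 1) (hS : S.IsStable) (hHD : H.D * W.D = 0) (hSD : S.D * W.D = 0) :
    MatRHPDecay 1 (weightedError W H S) := by
  have := (transfer_mul_decay hWE hW hHE hH hHD).sub (transfer_mul_decay hWE hW hSE hS hSD)
  simp only [← Matrix.sub_mul] at this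
  exact this

/-- The competitor has state-space data S + ε(A₁, B₁, C₁, D₁). It is stable for small ε, and its
feed-through still annihilates W.D because both S.D and D₁ do. Its weighted error is the old one
minus ε times the weighted variation, up to O(ε²). -/
theorem re_integral_nonpos (hWE : W.E = 1) (hW : W.IsStable) (hHE : H.E = 1) (hH : H.IsStable)
    (hSE : S.E = 1) (hS : S.IsStable) (hHD : H.D * W.D = 0) (hSD : S.D * W.D = 0)
    (hmin : IsMinimizer W H S) (A₁ : Matrix (Fin r) (Fin r) ℝ) (B₁ : Matrix (Fin r) (Fin m) ℝ)
    (C₁ : Matrix (Fin p) (Fin r) ℝ) {D₁ : Matrix (Fin p) (Fin m) ℝ} (hD₁ : D₁ * W.D = 0) :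
    (∫ ω : ℝ, ∑ i, ∑ j, weightedError W H S (Complex.I * ω) i j * (starRingEnd ℂ)
      ((S.variation (toC A₁) (toC B₁) (toC C₁) (toC D₁) (Complex.I * ω) *
        W.transfer (Complex.I * ω)) i j)).re ≤ 0 := by
  have hX := weightedError_decay hWE hW hHE hH hSE hS hHD hSD
  have hQ := variation_mul_decay hWE hW hSE hS (toC A₁) (toC B₁) (toC C₁) hD₁
  have hA := (isStable_iff hSE).1 hS
  obtain ⟨K₁, hK₁0, hK₁⟩ := hX.bound_axis
  obtain ⟨K₂, hK₂0, hK₂⟩ := hQ.bound_axis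
  have hF : MatRHPDecay 0 fun s => toC S.C * resolv (toC S.A) s * toC A₁ + toC C₁ :=
    ((hA.decay_bilin _ _).mono (Nat.zero_le 1)).add (MatRHPDecay.const _)
  have hG : MatRHPDecay 0 fun s =>
      (toC A₁ * resolv (toC S.A) s * toC S.B + toC B₁) * W.transfer s :=
    (((hA.decay_bilin _ _).mono (Nat.zero_le 1)).add (MatRHPDecay.const _)).mul
      (transfer_decay hWE hW)
  obtain ⟨ε₀, hε₀, K₃, hK₃0, hpert⟩ := exists_perturbed_bound hA (toC A₁) hF hG
  have hmono : ∀ {x K : ℝ}, ∀ ω : ℝ, x ≤ K / (1 + |ω|) → K ≤ K₁ + K₂ + K₃ →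
      x ≤ (K₁ + K₂ + K₃) / (1 + |ω|) := fun ω h h' => h.trans (by gcongr)
  refine re_integral_nonpos_of_forall_le (K := K₁ + K₂ + K₃) hε₀
    (X := fun ω => weightedError W H S (Complex.I * ω))
    (Q := fun ω => S.variation (toC A₁) (toC B₁) (toC C₁) (toC D₁) (Complex.I * ω) *
        W.transfer (Complex.I * ω))
    (R := fun ε ω => (toC S.C * resolv (toC S.A) (Complex.I * ω) * toC A₁ + toC C₁) *
      resolv (toC S.A + (ε : ℂ) • toC A₁) (Complex.I * ω) *
      ((toC A₁ * resolv (toC S.A) (Complex.I * ω) * toC S.B + toC B₁) *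
        W.transfer (Complex.I * ω)))
    (fun i j => (hX i j).continuous_imag) (fun i j => (hQ i j).continuous_imag)
    (fun ω i j => hmono ω (hK₁ ω i j) (by linarith))
    (fun ω i j => hmono ω (hK₂ ω i j) (by linarith))
    (fun ε h0 h1 ω i j => hmono ω (by simpa using (hpert ε h0 h1).2 (Complex.I * ω) (by simp) i j)
      (by linarith)) fun ε h0 h1 => ?_
  obtain ⟨hstab, -⟩ := hpert ε h0 h1
  set T : LTISystem r m p := ⟨1, S.A + ε • A₁, S.B + ε • B₁, S.C + ε • C₁, S.D + ε • D₁⟩ with hT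
  have hTE : T.E = 1 := rfl
  have hTA : toC T.A = toC S.A + (ε : ℂ) • toC A₁ := by
    rw [show T.A = S.A + ε • A₁ from rfl, toC_add, toC_smul]
  have hTs : T.IsStable := by
    rw [isStable_iff hTE, hTA]
    exact hstab
  have hTm : MemWeightedH2 W.transfer T := by
    rw [memWeightedH2_iff hWE hW hTE]
    refine ⟨hTs, ?_⟩
    rw [show T.D = S.D + ε • D₁ from rfl, Matrix.add_mul, Matrix.smul_mul, hSD, hD₁, smul_zero,
      add_zero]
  have hle := h2Norm_le_iff.1 (hmin T hTm)
  have hTt : ∀ ω : ℝ, T.transfer (Complex.I * ω) = S.transfer (Complex.I * ω) +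
      ((ε : ℂ) • S.variation (toC A₁) (toC B₁) (toC C₁) (toC D₁) (Complex.I * ω) +
      (ε : ℂ) ^ 2 • ((toC S.C * resolv (toC S.A) (Complex.I * ω) * toC A₁ + toC C₁) *
      resolv (toC S.A + (ε : ℂ) • toC A₁) (Complex.I * ω) *
      (toC A₁ * resolv (toC S.A) (Complex.I * ω) * toC S.B + toC B₁))) := by
    intro ω
    rw [transfer_eq hTE, hTA, transfer_eq hSE, variation,
      ← transfer_perturb_eq (hA _ (by simp)) (hstab _ (by simp)) (toC S.B) (toC B₁) (toC S.C)
        (toC C₁) (toC S.D) (toC D₁)]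
    rw [show T.B = S.B + ε • B₁ from rfl, show T.C = S.C + ε • C₁ from rfl,
      show T.D = S.D + ε • D₁ from rfl]
    simp only [toC_add, toC_smul]
  refine hle.trans (le_of_eq ?_)
  refine MeasureTheory.lintegral_congr fun ω => ?_
  simp only [hTt ω, weightedError, Matrix.sub_mul, Matrix.add_mul, Matrix.smul_mul,
    Matrix.mul_assoc, sub_sub]

/-- The substitution ω ↦ -ω shows that the integral equals its own conjugate. -/
theorem im_integral_eq_zero {φ : ℝ → ℂ} (h : ∀ ω, φ (-ω) = (starRingEnd ℂ) (φ ω)) :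
    (∫ ω, φ ω).im = 0 := by
  rw [← Complex.conj_eq_iff_im, ← integral_conj]
  simp only [← h]
  exact MeasureTheory.integral_neg_eq_self φ MeasureTheory.volume

/-- Stationarity of a minimizer of the weighted distance. -/
theorem integral_weightedError_eq_zero (hWE : W.E = 1) (hW : W.IsStable) (hHE : H.E = 1)
    (hH : H.IsStable) (hSE : S.E = 1) (hS : S.IsStable) (hHD : H.D * W.D = 0)
    (hSD : S.D * W.D = 0) (hmin : IsMinimizer W H S) (A₁ : Matrix (Fin r) (Fin r) ℝ)
    (B₁ : Matrix (Fin r) (Fin m) ℝ) (C₁ : Matrix (Fin p) (Fin r) ℝ)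
    {D₁ : Matrix (Fin p) (Fin m) ℝ} (hD₁ : D₁ * W.D = 0) :
    ∫ ω : ℝ, ∑ i, ∑ j, weightedError W H S (Complex.I * ω) i j *
      (S.variation (toC A₁) (toC B₁) (toC C₁) (toC D₁) (-(Complex.I * ω)) *
        W.transfer (-(Complex.I * ω))) i j = 0 := by
  -- On the imaginary axis conjugation is s ↦ -s. For real systems this replaces the conjugate in
  -- the inner product by a rational expression in -s.
  have hconj : ∀ ω : ℝ, (starRingEnd ℂ) (Complex.I * ω) = -(Complex.I * ω) := by
    intro ω
    simp
  have hVs := (variation_realSymm hSE hS A₁ B₁ C₁ D₁).mul (transfer_realSymm hWE hW)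
  have hXs : RealSymm (weightedError W H S) :=
    ((transfer_realSymm hHE hH).sub (transfer_realSymm hSE hS)).mul (transfer_realSymm hWE hW)
  have hV : ∀ (ω : ℝ) i j, (S.variation (toC A₁) (toC B₁) (toC C₁) (toC D₁) (-(Complex.I * ω)) *
      W.transfer (-(Complex.I * ω))) i j = (starRingEnd ℂ)
        ((S.variation (toC A₁) (toC B₁) (toC C₁) (toC D₁) (Complex.I * ω) *
        W.transfer (Complex.I * ω)) i j) := by
    intro ω i j
    have := congrFun (congrFun (hVs (Complex.I * ω) (by simp)) i) j
    rw [hconj] at this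
    exact this
  have hX : ∀ (ω : ℝ) i j, weightedError W H S (-(Complex.I * ω)) i j =
      (starRingEnd ℂ) (weightedError W H S (Complex.I * ω) i j) := by
    intro ω i j
    have := congrFun (congrFun (hXs (Complex.I * ω) (by simp)) i) j
    rw [hconj] at this
    exact this
  simp only [hV]
  have h1 := re_integral_nonpos hWE hW hHE hH hSE hS hHD hSD hmin A₁ B₁ C₁ hD₁
  -- The opposite direction is admissible too, which turns the inequality into an equality.
  have h2 := re_integral_nonpos hWE hW hHE hH hSE hS hHD hSD hmin (-A₁) (-B₁) (-C₁)
    (D₁ := -D₁) (by rw [Matrix.neg_mul, hD₁, neg_zero])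
  simp only [toC_neg, variation_neg, Matrix.neg_mul, Matrix.neg_apply, map_neg, mul_neg,
    Finset.sum_neg_distrib, MeasureTheory.integral_neg, Complex.neg_re] at h2
  refine Complex.ext (le_antisymm h1 (by simpa using h2)) ?_
  refine im_integral_eq_zero fun ω => ?_
  simp only [Complex.ofReal_neg, mul_neg, hX, hV, map_sum, map_mul]

end Stationarity

end LTISystem

/-! ### Integrals over the reflected axis, and asymptotics at infinity. -/

namespace RHPDecay

theorem integrable_mul_neg {g h : ℂ → ℂ} (hg : RHPDecay 1 g) (hh : RHPDecay 1 h) :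
    MeasureTheory.Integrable fun ω : ℝ => g (Complex.I * ω) * h (-(Complex.I * ω)) := by
  obtain ⟨K, hK0, hK⟩ := hg.bound_nonneg
  obtain ⟨M, hM⟩ := hh.bound
  refine integrable_of_bound (K := K * M) (hg.continuous_imag.mul hh.continuous_imag_neg)
    fun ω => ?_
  rw [norm_mul, pow_two, ← div_mul_div_comm]
  have h1 := hK (Complex.I * ω) (by simp)
  have h2 := hM (-(Complex.I * ω)) (by simp)
  simp only [pow_one, norm_mul, Complex.norm_I, one_mul, Complex.norm_real, norm_neg] at h1 h2
  exact mul_le_mul h1 h2 (norm_nonneg _) (by positivity)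

theorem integrable_imag_neg {g : ℂ → ℂ} (hg : RHPDecay 2 g) :
    MeasureTheory.Integrable fun ω : ℝ => g (-(Complex.I * ω)) := by
  have := hg.integrable_imag.comp_neg
  simpa using this

theorem integral_imag_neg_eq_zero {g : ℂ → ℂ} (hg : RHPDecay 2 g) :
    ∫ ω : ℝ, g (-(Complex.I * ω)) = 0 := by
  have := MeasureTheory.integral_neg_eq_self (fun ω : ℝ => g (Complex.I * ω))
    MeasureTheory.volume
  rw [hg.integral_imag_eq_zero] at this
  simpa using this

theorem tendsto_mul_atTop {g : ℂ → ℂ} (hg : RHPDecay 2 g) :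
    Filter.Tendsto (fun t : ℝ => (t : ℂ) * g t) Filter.atTop (𝓝 0) := by
  obtain ⟨K, hK0, hK⟩ := hg.bound_nonneg
  have h0 : Filter.Tendsto (fun t : ℝ => K * t⁻¹) Filter.atTop (𝓝 0) := by
    simpa using tendsto_inv_atTop_zero.const_mul K
  refine squeeze_zero_norm' ?_ h0
  filter_upwards [Filter.eventually_gt_atTop 0] with t ht
  have h1 := hK t (by simpa using ht.le)
  rw [Complex.norm_real, Real.norm_of_nonneg ht.le] at h1
  rw [norm_mul, Complex.norm_real, Real.norm_of_nonneg ht.le]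
  calc t * ‖g t‖ ≤ t * (K / (1 + t) ^ 2) := by gcongr
    _ ≤ t * (K / t ^ 2) := by
      gcongr
      linarith
    _ = K * t⁻¹ := by
      field_simp

end RHPDecay

/-- `g = O((1 + |s|)⁻ᵏ)` at infinity in the closed right half plane. -/
def LargeDecay (k : ℕ) (g : ℂ → ℂ) : Prop :=
  ∃ K ρ : ℝ, 0 ≤ K ∧ ∀ s : ℂ, 0 ≤ s.re → ρ ≤ ‖s‖ → ‖g s‖ ≤ K / (1 + ‖s‖) ^ k

namespace LargeDecay

variable {k l : ℕ} {g h : ℂ → ℂ}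

theorem of_rhpDecay (hg : RHPDecay k g) : LargeDecay k g := by
  obtain ⟨K, hK0, hK⟩ := hg.bound_nonneg
  exact ⟨K, 0, hK0, fun s hs _ => hK s hs⟩

theorem inv_sub (c : ℂ) : LargeDecay 1 fun s => (s - c)⁻¹ :=
  ⟨4, max 1 (2 * ‖c‖), by norm_num, fun _ _ h => RHPDecay.norm_inv_sub_le
    ((le_max_left _ _).trans h) ((le_max_right _ _).trans h)⟩

theorem add (hg : LargeDecay k g) (hh : LargeDecay k h) : LargeDecay k fun s => g s + h s := by
  obtain ⟨K, ρ, hK0, hK⟩ := hg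
  obtain ⟨M, ρ', hM0, hM⟩ := hh
  refine ⟨K + M, max ρ ρ', by positivity, fun s hs h => ?_⟩
  rw [add_div]
  exact (norm_add_le _ _).trans (add_le_add (hK s hs ((le_max_left _ _).trans h))
    (hM s hs ((le_max_right _ _).trans h)))

theorem mul (hg : LargeDecay k g) (hh : LargeDecay l h) :
    LargeDecay (k + l) fun s => g s * h s := by
  obtain ⟨K, ρ, hK0, hK⟩ := hg
  obtain ⟨M, ρ', hM0, hM⟩ := hh
  refine ⟨K * M, max ρ ρ', by positivity, fun s hs h => ?_⟩
  rw [norm_mul, pow_add, ← div_mul_div_comm]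
  exact mul_le_mul (hK s hs ((le_max_left _ _).trans h)) (hM s hs ((le_max_right _ _).trans h))
    (norm_nonneg _) (by positivity)

theorem const_mul (a : ℂ) (hg : LargeDecay k g) : LargeDecay k fun s => a * g s := by
  have := (of_rhpDecay (RHPDecay.const a)).mul hg
  rwa [zero_add] at this

theorem sum {ι : Type*} (t : Finset ι) {g : ι → ℂ → ℂ} (hg : ∀ i ∈ t, LargeDecay k (g i)) :
    LargeDecay k fun s => ∑ i ∈ t, g i s := by
  classical
  induction t using Finset.induction_on with
  | empty => simpa using of_rhpDecay RHPDecay.zero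
  | insert a t ha ih =>
    simp only [Finset.sum_insert ha]
    exact (hg a (Finset.mem_insert_self _ _)).add
      (ih fun i hi => hg i (Finset.mem_insert_of_mem hi))

theorem congr (hg : LargeDecay k g) (ρ : ℝ) (he : ∀ s : ℂ, ρ ≤ ‖s‖ → 0 ≤ s.re → g s = h s) :
    LargeDecay k h := by
  obtain ⟨K, ρ', hK0, hK⟩ := hg
  exact ⟨K, max ρ' ρ, hK0, fun s hs h' => by
    rw [← he s ((le_max_right _ _).trans h') hs]
    exact hK s hs ((le_max_left _ _).trans h')⟩

theorem rhpDecay (hg : LargeDecay k g) (ha : ∀ s : ℂ, 0 ≤ s.re → AnalyticAt ℂ g s) :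
    RHPDecay k g := by
  obtain ⟨K, ρ, _, hK⟩ := hg
  exact RHPDecay.of_large ha ⟨K, ρ, hK⟩

end LargeDecay

/-- If the antistable terms `(s + γ_k)⁻¹ r_k` complete a function on the imaginary axis with zero
mean to `δ`, then `δ` is `o(|s|⁻¹)` at infinity. -/
theorem tendsto_mul_of_integral_eq_zero {N : ℕ} {γ : Fin N → ℂ} (hγ : ∀ k, (γ k).re < 0)
    {x : Fin N → ℂ → ℂ} (hx : ∀ k, RHPDecay 1 (x k)) (c r : Fin N → ℂ) {δ : ℂ → ℂ}
    (hδ : RHPDecay 1 δ)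
    (h : ∀ s : ℂ, 0 ≤ s.re → (∀ k, s + γ k ≠ 0) →
      δ s = ∑ k, c k * ((-s - γ k)⁻¹ * x k s) + ∑ k, (s + γ k)⁻¹ * r k)
    (hint : ∫ ω : ℝ, ∑ k, c k * ((-(Complex.I * ω) - γ k)⁻¹ * x k (Complex.I * ω)) = 0) :
    Filter.Tendsto (fun t : ℝ => (t : ℂ) * δ t) Filter.atTop (𝓝 0) := by
  set a : ℂ := ∑ k, r k with ha
  have hone : (-1 : ℂ).re < 0 := by simp
  -- Since the first sum in the formula for δ is O(|s|⁻²), δ behaves like a/s. Subtracting a/(s + 1)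
  -- leaves O(|s|⁻²), and the goal becomes a = 0.
  set ψ : ℂ → ℂ := fun s => δ s - a * (s - -1)⁻¹ with hψ
  have hψa : ∀ s : ℂ, 0 ≤ s.re → AnalyticAt ℂ ψ s := fun s hs =>
    (hδ.sub ((RHPDecay.inv_sub hone).const_mul a)).analyticAt s hs
  have hψd : RHPDecay 2 ψ := by
    refine LargeDecay.rhpDecay ?_ hψa
    have h1 : LargeDecay (1 + 1) fun s =>
        (∑ k, -c k * ((s - -γ k)⁻¹ * x k s)) +
          ∑ k, (r k * (1 - γ k)) * ((s - -γ k)⁻¹ * (s - -1)⁻¹) :=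
      (LargeDecay.sum _ fun k _ => ((LargeDecay.inv_sub _).mul
        (LargeDecay.of_rhpDecay (hx k))).const_mul _).add
      (LargeDecay.sum _ fun k _ => ((LargeDecay.inv_sub _).mul (LargeDecay.inv_sub _)).const_mul _)
    -- Outside this radius s avoids all the points -γ_k, at which the formula for δ is not assumed.
    refine h1.congr (1 + ∑ k, ‖γ k‖) fun s hs hs0 => ?_
    have hne : ∀ k, s + γ k ≠ 0 := by
      intro k hk
      have h2 : ‖s‖ = ‖γ k‖ := by rw [eq_neg_of_add_eq_zero_left hk, norm_neg]
      have h3 : ‖γ k‖ ≤ ∑ k, ‖γ k‖ :=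
        Finset.single_le_sum (f := fun k => ‖γ k‖) (fun _ _ => norm_nonneg _) (Finset.mem_univ k)
      linarith
    have hne1 : s - -1 ≠ 0 := RHPDecay.sub_ne_zero hone hs0
    simp only [hψ, h s hs0 hne]
    rw [ha, Finset.sum_mul, add_sub_assoc, ← Finset.sum_sub_distrib]
    congr 1
    · refine Finset.sum_congr rfl fun k _ => ?_
      rw [show -s - γ k = -(s - -γ k) by ring, inv_neg]
      ring
    · refine Finset.sum_congr rfl fun k _ => ?_
      have := hne k
      rw [sub_neg_eq_add]
      rw [sub_neg_eq_add] at hne1 ⊢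
      field_simp
      ring
  set ξ : ℂ → ℂ := fun s => ∑ k, (r k * (-γ k - 1)) * ((s - -1)⁻¹ * (s - γ k)⁻¹) with hξ
  have hξd : RHPDecay 2 ξ := RHPDecay.sum _ fun k _ =>
    ((RHPDecay.inv_sub hone).mul (RHPDecay.inv_sub (hγ k))).const_mul _
  -- The antistable terms are corrected by a/(1 - s) so that they become O(|s|⁻²) as a function of
  -- -s, namely ξ. The two corrections 1/(1 + s) and 1/(1 - s) add up to 2/(1 + ω²). Integration
  -- kills ψ and ξ and leaves 2πa = 0.
  have hpt : ∀ ω : ℝ, ∑ k, c k * ((-(Complex.I * ω) - γ k)⁻¹ * x k (Complex.I * ω)) =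
      ψ (Complex.I * ω) - ξ (-(Complex.I * ω)) + (2 * a) * (((1 + ω ^ 2)⁻¹ : ℝ) : ℂ) := by
    intro ω
    have hne : ∀ k, Complex.I * ω + γ k ≠ 0 := fun k => RHPDecay.add_ne_zero (hγ k) (by simp)
    have h1 := h (Complex.I * ω) (by simp) hne
    have n1 : (Complex.I * ω) - -1 ≠ 0 := RHPDecay.sub_ne_zero hone (by simp)
    have n2 : -(Complex.I * ω) - -1 ≠ 0 := RHPDecay.sub_ne_zero hone (by simp)
    have h2 : ξ (-(Complex.I * ω)) = a * (-(Complex.I * ω) - -1)⁻¹ +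
        ∑ k, (Complex.I * ω + γ k)⁻¹ * r k := by
      rw [hξ, ha, Finset.sum_mul, ← Finset.sum_add_distrib]
      refine Finset.sum_congr rfl fun k _ => ?_
      have := hne k
      rw [show -(Complex.I * (ω : ℂ)) - γ k = -(Complex.I * ω + γ k) by ring, inv_neg]
      rw [sub_neg_eq_add] at n2 ⊢
      field_simp
      ring
    have h3 : (((1 + ω ^ 2)⁻¹ : ℝ) : ℂ) * 2 =
        (Complex.I * ω - -1)⁻¹ + (-(Complex.I * ω) - -1)⁻¹ := by
      have e : ((1 + ω ^ 2 : ℝ) : ℂ) = (Complex.I * ω - -1) * (-(Complex.I * ω) - -1) := by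
        push_cast
        linear_combination ((ω : ℂ) ^ 2) * Complex.I_sq
      rw [Complex.ofReal_inv, e]
      field_simp
      ring
    simp only [hψ, h2, h1]
    linear_combination (-a) * h3
  simp only [hpt] at hint
  have hi1 : MeasureTheory.Integrable fun ω : ℝ => ψ (Complex.I * ω) - ξ (-(Complex.I * ω)) :=
    hψd.integrable_imag.sub hξd.integrable_imag_neg
  have hi2 : MeasureTheory.Integrable fun ω : ℝ => (2 * a) * (((1 + ω ^ 2)⁻¹ : ℝ) : ℂ) :=
    integrable_inv_one_add_sq.ofReal.const_mul _
  rw [MeasureTheory.integral_add hi1 hi2, MeasureTheory.integral_sub hψd.integrable_imag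
    hξd.integrable_imag_neg, hψd.integral_imag_eq_zero, hξd.integral_imag_neg_eq_zero,
    MeasureTheory.integral_const_mul, integral_complex_ofReal, integral_univ_inv_one_add_sq] at hint
  have ha0 : a = 0 := by
    have hpi : (Real.pi : ℂ) ≠ 0 := by exact_mod_cast Real.pi_ne_zero
    simpa [hpi] using hint
  have : ψ = δ := by
    funext s
    simp [hψ, ha0]
  rw [← this]
  exact hψd.tendsto_mul_atTop

/-! ### Evaluation at reflected poles through the pairing on the axis. -/

section Pairing

variable {p m : ℕ}

/-- The bilinear pairing `∫ tr (Δ(iω) M(-iω)ᵀ) dω`. -/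
noncomputable def axisPairing (Δ M : ℂ → Matrix (Fin p) (Fin m) ℂ) : ℂ :=
  ∫ ω : ℝ, ∑ i, ∑ l, Δ (Complex.I * ω) i l * M (-(Complex.I * ω)) i l

theorem axisPairing_integrable {Δ M : ℂ → Matrix (Fin p) (Fin m) ℂ} (hΔ : MatRHPDecay 1 Δ)
    (hM : MatRHPDecay 1 M) : MeasureTheory.Integrable fun ω : ℝ =>
      ∑ i, ∑ l, Δ (Complex.I * ω) i l * M (-(Complex.I * ω)) i l :=
  MeasureTheory.integrable_finsetSum _ fun i _ => MeasureTheory.integrable_finsetSum _ fun l _ =>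
    (hΔ i l).integrable_mul_neg (hM i l)

theorem axisPairing_add {Δ M N : ℂ → Matrix (Fin p) (Fin m) ℂ} (hΔ : MatRHPDecay 1 Δ)
    (hM : MatRHPDecay 1 M) (hN : MatRHPDecay 1 N) :
    axisPairing Δ (fun s => M s + N s) = axisPairing Δ M + axisPairing Δ N := by
  rw [axisPairing, axisPairing, axisPairing, ← MeasureTheory.integral_add
    (axisPairing_integrable hΔ hM) (axisPairing_integrable hΔ hN)]
  simp only [Matrix.add_apply, mul_add, Finset.sum_add_distrib]

theorem axisPairing_smul (Δ M : ℂ → Matrix (Fin p) (Fin m) ℂ) (a : ℂ) :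
    axisPairing Δ (fun s => a • M s) = a * axisPairing Δ M := by
  rw [axisPairing, axisPairing, ← MeasureTheory.integral_const_mul]
  simp only [Matrix.smul_apply, smul_eq_mul, Finset.mul_sum]
  congr 1
  funext ω
  refine Finset.sum_congr rfl fun i _ => Finset.sum_congr rfl fun l _ => by ring

theorem axisPairing_congr (Δ : ℂ → Matrix (Fin p) (Fin m) ℂ) {M N : ℂ → Matrix (Fin p) (Fin m) ℂ}
    (h : ∀ s : ℂ, 0 ≤ s.re → M s = N s) : axisPairing Δ M = axisPairing Δ N := by
  rw [axisPairing, axisPairing]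
  congr 1
  funext ω
  rw [h _ (by simp)]

theorem sum_mul_smul_vecMulVec (Δ : Matrix (Fin p) (Fin m) ℂ) (a : ℂ) (u : Fin p → ℂ)
    (v : Fin m → ℂ) :
    ∑ i, ∑ l, Δ i l * (a • Matrix.vecMulVec u v) i l = u ⬝ᵥ (Δ *ᵥ v) * a := by
  simp only [dotProduct, Matrix.mulVec, Finset.mul_sum, Finset.sum_mul, Matrix.smul_apply,
    Matrix.vecMulVec_apply, smul_eq_mul]
  refine Finset.sum_congr rfl fun i _ => Finset.sum_congr rfl fun l _ => by ring

/-- Pairing with a simple pole at lam is evaluation at -lam, up to a nonzero constant. -/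
theorem bilin_eq_zero_of_axisPairing {Δ : ℂ → Matrix (Fin p) (Fin m) ℂ} (hΔ : MatRHPDecay 1 Δ)
    {lam : ℂ} (hl : lam.re < 0) {u : Fin p → ℂ} {v : Fin m → ℂ}
    (h : axisPairing Δ (fun s => (s - lam)⁻¹ • Matrix.vecMulVec u v) = 0) :
    u ⬝ᵥ (Δ (-lam) *ᵥ v) = 0 := by
  obtain ⟨κ, hκ, hc⟩ := RHPDecay.exists_cauchy_const hl
  simp only [axisPairing, sum_mul_smul_vecMulVec] at h
  rw [hc (fun s => u ⬝ᵥ (Δ s *ᵥ v)) (hΔ.bilin u v)] at h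
  exact (mul_eq_zero.1 h).resolve_left hκ

/-- Since the value at -lam vanishes, one factor of the double pole can be absorbed into the divided
difference. What remains is a simple pole, and the divided difference evaluated at -lam is the
derivative. -/
theorem deriv_bilin_eq_zero_of_axisPairing {Δ : ℂ → Matrix (Fin p) (Fin m) ℂ}
    (hΔ : MatRHPDecay 1 Δ) {lam : ℂ} (hl : lam.re < 0) {u : Fin p → ℂ} {v : Fin m → ℂ}
    (h0 : u ⬝ᵥ (Δ (-lam) *ᵥ v) = 0)
    (h : axisPairing Δ (fun s => ((s - lam)⁻¹ ^ 2) • Matrix.vecMulVec u v) = 0) :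
    deriv (fun s => u ⬝ᵥ (Δ s *ᵥ v)) (-lam) = 0 := by
  obtain ⟨κ, hκ, hc⟩ := RHPDecay.exists_cauchy_const hl
  have hd := ((hΔ.bilin u v).dslope h0).mono (show 1 ≤ 1 + 1 by norm_num)
  have h1 := hc _ hd
  simp only [axisPairing, sum_mul_smul_vecMulVec] at h
  have h2 : ∀ ω : ℝ, u ⬝ᵥ (Δ (Complex.I * ω) *ᵥ v) * (-(Complex.I * ω) - lam)⁻¹ ^ 2 =
      -(dslope (fun s => u ⬝ᵥ (Δ s *ᵥ v)) (-lam) (Complex.I * ω) *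
        (-(Complex.I * ω) - lam)⁻¹) := by
    intro ω
    have hne : Complex.I * ω + lam ≠ 0 := RHPDecay.add_ne_zero hl (by simp)
    have hn : Complex.I * ω ≠ -lam := fun hc => hne (by rw [hc]; ring)
    rw [dslope_of_ne _ hn, slope_def_field, h0, sub_zero,
      show -(Complex.I * ω) - lam = -(Complex.I * ω - -lam) by ring, inv_neg, div_eq_mul_inv]
    ring
  simp only [h2, MeasureTheory.integral_neg, h1, dslope_same, neg_eq_zero] at h
  exact (mul_eq_zero.1 h).resolve_left hκ

end Pairing

theorem MatRHPDecay.mulVec {α β : Type*} [Fintype β] {k : ℕ} {G : ℂ → Matrix α β ℂ}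
    (hG : MatRHPDecay k G) (v : β → ℂ) (i : α) : RHPDecay k fun s => (G s *ᵥ v) i := by
  simp only [Matrix.mulVec, dotProduct]
  exact RHPDecay.sum _ fun j _ => (hG i j).mul_const _

/-! ### Pole-residue forms and realization of the transformed map. -/

namespace LTISystem

variable {n m p q r nw : ℕ}

/-- The rational function `∑ₖ left k (right k)ᵀ / (s - pole k) + D`. -/
noncomputable def poleSum {N : ℕ} (pole : Fin N → ℂ) (left : Fin N → Fin p → ℂ)
    (right : Fin N → Fin m → ℂ) (D : Matrix (Fin p) (Fin m) ℝ) (s : ℂ) :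
    Matrix (Fin p) (Fin m) ℂ :=
  (∑ k, (s - pole k)⁻¹ • Matrix.vecMulVec (left k) (right k)) + toC D

theorem poleSum_apply {N : ℕ} (pole : Fin N → ℂ) (left : Fin N → Fin p → ℂ)
    (right : Fin N → Fin m → ℂ) (D : Matrix (Fin p) (Fin m) ℝ) (s : ℂ) (i : Fin p) (j : Fin m) :
    poleSum pole left right D s i j =
      (∑ k, (s - pole k)⁻¹ * (left k i * right k j)) + (D i j : ℂ) := by
  simp [poleSum, Matrix.sum_apply, Matrix.vecMulVec_apply]

theorem eventually_nhdsNE_of_cofinite {P : ℂ → Prop} (h : ∀ᶠ s in Filter.cofinite, P s) (z : ℂ) :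
    ∀ᶠ s in 𝓝[≠] z, P s :=
  h.filter_mono (nhdsNE_le_cofinite z)

/-- Residues at points of continuity cancel. -/
theorem sum_residue_eq_zero {N : ℕ} {G : ℂ → Matrix (Fin p) (Fin m) ℂ} {pole : Fin N → ℂ}
    {left : Fin N → Fin p → ℂ} {right : Fin N → Fin m → ℂ} {D : Matrix (Fin p) (Fin m) ℝ}
    (h : HasPoleResidueForm G pole left right D) {z : ℂ}
    (hc : ∀ i j, ContinuousAt (fun s => G s i j) z) :
    (∑ k, if pole k = z then Matrix.vecMulVec (left k) (right k) else 0) = 0 := by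
  ext i j
  have h1 := _root_.sum_residue_eq_zero (hc i j) pole (fun k => left k i * right k j) (D i j)
    ((eventually_nhdsNE_of_cofinite h z).mono fun s hs => by
      rw [show G s = poleSum pole left right D s from hs, poleSum_apply])
  rw [Matrix.sum_apply, Matrix.zero_apply, ← h1]
  refine Finset.sum_congr rfl fun k _ => ?_
  split_ifs <;> simp [Matrix.vecMulVec_apply]

theorem poleSum_analyticAt {N : ℕ} {pole : Fin N → ℂ} {z : ℂ} (hz : ∀ k, z - pole k ≠ 0)
    (left : Fin N → Fin p → ℂ)
    (right : Fin N → Fin m → ℂ) (D : Matrix (Fin p) (Fin m) ℝ) (i : Fin p) (j : Fin m) :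
    AnalyticAt ℂ (fun s => poleSum pole left right D s i j) z := by
  simp only [poleSum_apply]
  refine (Finset.analyticAt_fun_sum _ fun k _ => ?_).add analyticAt_const
  exact (AnalyticAt.inv (f := fun s => s - pole k) (by fun_prop) (hz k)).mul analyticAt_const

/-- Both sides are continuous on the closed right half plane and agree off a finite set. -/
theorem eq_poleSum_of_re_nonneg {N : ℕ} {G : ℂ → Matrix (Fin p) (Fin m) ℂ} {pole : Fin N → ℂ}
    {left : Fin N → Fin p → ℂ} {right : Fin N → Fin m → ℂ} {D : Matrix (Fin p) (Fin m) ℝ}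
    (h : HasPoleResidueForm G pole left right D) (hp : ∀ k, (pole k).re < 0) {l : ℕ}
    (hG : MatRHPDecay l G) {s : ℂ} (hs : 0 ≤ s.re) : G s = poleSum pole left right D s := by
  ext i j
  have h1 := ((hG i j).analyticAt s hs).continuousAt.tendsto.mono_left
    (nhdsWithin_le_nhds (s := {s}ᶜ))
  have h2 := (poleSum_analyticAt (fun k => RHPDecay.sub_ne_zero (hp k) hs) left right D
    i j).continuousAt.tendsto.mono_left (nhdsWithin_le_nhds (s := {s}ᶜ))
  refine tendsto_nhds_unique h1 (h2.congr' ?_)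
  filter_upwards [eventually_nhdsNE_of_cofinite h s] with z hz
  rw [show G z = poleSum pole left right D z from hz]

/-- The pole-residue form of a stable system may be assumed to have only stable poles. -/
theorem exists_stable_poles {W : LTISystem nw q m} (hWE : W.E = 1) (hW : W.IsStable)
    {γ : Fin nw → ℂ} {e : Fin nw → Fin m → ℂ} {f : Fin nw → Fin q → ℂ}
    (h : HasPoleResidueForm W.transfer γ e f W.D) :
    ∃ (γ' : Fin nw → ℂ) (e' : Fin nw → Fin m → ℂ), (∀ k, (γ' k).re < 0) ∧
      HasPoleResidueForm W.transfer γ' e' f W.D ∧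
      ∀ {p : ℕ} (G : ℂ → Matrix (Fin p) (Fin m) ℂ),
        weightMapExpr G W.transfer γ e f = weightMapExpr G W.transfer γ' e' f := by
  -- The form is only assumed off a finite set, so it may contain terms with unstable poles whose
  -- residues cancel. Such a term gets the harmless pole -1 and a zero factor, so that the number of
  -- terms remains nw.
  set γ' : Fin nw → ℂ := fun k => if (γ k).re < 0 then γ k else -1 with hγ'
  set e' : Fin nw → Fin m → ℂ := fun k => if (γ k).re < 0 then e k else 0 with he'
  have hres : ∀ z : ℂ, 0 ≤ z.re →
      (∑ k, if γ k = z then Matrix.vecMulVec (e k) (f k) else 0) = 0 := fun z hz =>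
    sum_residue_eq_zero h fun i j => ((transfer_decay hWE hW i j).analyticAt z hz).continuousAt
  -- Any sum that is additive in the residue, with a rule depending only on the pole, is unchanged:
  -- grouped by pole, the unstable groups sum to zero. This applies to W itself and to the
  -- correction terms of 𝔉.
  have hgen : ∀ {E : Type} [AddCommGroup E] (Φ : ℂ → Matrix (Fin m) (Fin q) ℂ →+ E),
      ∑ k, Φ (γ k) (Matrix.vecMulVec (e k) (f k)) =
        ∑ k, Φ (γ' k) (Matrix.vecMulVec (e' k) (f k)) := by
    intro E _ Φ
    have h1 : ∀ k, Φ (γ' k) (Matrix.vecMulVec (e' k) (f k)) =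
        if (γ k).re < 0 then Φ (γ k) (Matrix.vecMulVec (e k) (f k)) else 0 := by
      intro k
      by_cases hk : (γ k).re < 0 <;> simp [hγ', he', hk]
    simp only [h1]
    rw [← Finset.sum_filter_add_sum_filter_not Finset.univ (fun k => (γ k).re < 0),
      Finset.sum_filter, add_eq_left]
    rw [← Finset.sum_fiberwise_of_maps_to (t := Finset.univ.image γ) (g := γ)
      (fun k _ => Finset.mem_image_of_mem _ (Finset.mem_univ k))]
    refine Finset.sum_eq_zero fun z _ => ?_
    by_cases hz : z.re < 0
    · refine Finset.sum_eq_zero fun k hk => ?_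
      simp only [Finset.mem_filter] at hk
      exact absurd (hk.2 ▸ hz) hk.1.2
    · have h2 := congrArg (Φ z) (hres z (not_lt.1 hz))
      rw [map_sum, map_zero] at h2
      rw [← h2, Finset.filter_filter, Finset.sum_filter]
      refine Finset.sum_congr rfl fun k _ => ?_
      by_cases hk : γ k = z
      · simp [hk, hz]
      · simp [hk]
  refine ⟨γ', e', fun k => ?_, ?_, fun {p} G => ?_⟩
  · by_cases hk : (γ k).re < 0 <;> simp [hγ', hk]
  · refine h.mono fun s hs => ?_
    rw [hs]
    congr 1
    exact hgen fun z => DistribSMul.toAddMonoidHom (Matrix (Fin m) (Fin q) ℂ) ((s - z)⁻¹)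
  · funext s
    rw [weightMapExpr, weightMapExpr]
    congr 1
    have h3 := hgen fun z => AddMonoidHom.mk'
      (fun N : Matrix (Fin m) (Fin q) ℂ => (s + z)⁻¹ • (G (-z) * W.transfer (-z) * Nᵀ))
      (fun M N => by rw [Matrix.transpose_add, Matrix.mul_add, smul_add])
    simpa only [AddMonoidHom.mk'_apply, Matrix.transpose_vecMulVec] using h3

section Realization

variable {W : LTISystem nw q m} {H : LTISystem n m p} {γ : Fin nw → ℂ} {e : Fin nw → Fin m → ℂ}
  {f : Fin nw → Fin q → ℂ}

/-- The transformed map is the strictly proper transfer function of a stable system. -/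
theorem exists_weightMap_realization (hWE : W.E = 1) (hW : W.IsStable) (hHE : H.E = 1)
    (hH : H.IsStable) (hHD : H.D * W.D = 0) (hγ : ∀ k, (γ k).re < 0) (e : Fin nw → Fin m → ℂ)
    (f : Fin nw → Fin q → ℂ) :
    ∃ (A : Matrix (Fin n ⊕ Fin nw) (Fin n ⊕ Fin nw) ℂ) (B : Matrix (Fin n ⊕ Fin nw) (Fin m) ℂ)
      (C : Matrix (Fin p) (Fin n ⊕ Fin nw) ℂ), Hurwitz A ∧
      ∀ s : ℂ, 0 ≤ s.re → (∀ k, s + γ k ≠ 0) →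
        C * resolv A s * B = H.transfer s * W.transfer s * (poleSum γ e f W.D (-s))ᵀ +
          ∑ k, (s + γ k)⁻¹ • (H.transfer (-γ k) * W.transfer (-γ k) *
            Matrix.vecMulVec (f k) (e k)) := by
  have hA := (isStable_iff hHE).1 hH
  have hA' := (isStable_iff hWE).1 hW
  set A := Matrix.fromBlocks (toC H.A) (toC H.B * toC W.C) 0 (toC W.A)
  set C := Matrix.fromCols (toC H.C) (toC H.D * toC W.C)
  set B := Matrix.fromRows (toC H.B * toC W.D) (toC W.B)
  have hAc : Hurwitz A := hA.cascade hA' _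
  have hc : ∀ s : ℂ, 0 ≤ s.re → H.transfer s * W.transfer s = C * resolv A s * B :=
    fun s hs => by
    rw [transfer_eq hHE, transfer_eq hWE]
    exact cascade_transfer (hA s hs) (hA' s hs) (toC H.B) (toC H.C) (toC H.D) (toC W.B) (toC W.C)
      (toC W.D) (by rw [← toC_mul, hHD, toC_zero])
  -- For the cascade resolvent R, the resolvent identity gives (R(-γ_k) - R(s))/(s + γ_k) = R(s)
  -- R(-γ_k). The pole at -γ_k therefore cancels, and the extra factor R(-γ_k) is absorbed into the
  -- input matrix.
  refine ⟨A, B * (toC W.D)ᵀ +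
    ∑ k, resolv A (-γ k) * B * Matrix.vecMulVec (f k) (e k), C, hAc, fun s hs hne => ?_⟩
  have hre : ∀ k, 0 ≤ (-γ k).re := fun k => by simpa using (hγ k).le
  simp only [hc s hs, hc _ (hre _)]
  rw [poleSum, Matrix.transpose_add, Matrix.transpose_sum, Matrix.mul_add, Matrix.mul_add,
    Matrix.mul_sum, Matrix.mul_sum, add_right_comm, ← Finset.sum_add_distrib,
    add_comm (C * resolv A s * (B * (toC W.D)ᵀ)), ← Matrix.mul_assoc _ B]
  congr 1
  · refine Finset.sum_congr rfl fun k _ => ?_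
    have h1 := resolv_sub_resolv (hAc s hs) (hAc _ (hre k))
    have h2 : resolv A (-γ k) = resolv A s + (s + γ k) • (resolv A s * resolv A (-γ k)) := by
      rw [show s + γ k = -(-γ k - s) by ring, neg_smul, ← h1]
      abel
    rw [Matrix.transpose_smul, Matrix.transpose_vecMulVec, Matrix.mul_smul,
      show -s - γ k = -(s + γ k) by ring, inv_neg, neg_smul]
    conv_rhs => rw [h2]
    simp only [Matrix.mul_add, Matrix.add_mul, Matrix.mul_smul, Matrix.smul_mul, smul_add,
      smul_smul, inv_mul_cancel₀ (hne k), one_smul, Matrix.mul_assoc]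
    abel

/-- The defining expression agrees with the realization off a finite set, and the realization is
continuous, so the limit that defines the map is its value. -/
theorem weightMap_eq_of_realization (hWpr : HasPoleResidueForm W.transfer γ e f W.D) {ι : Type*}
    [Fintype ι] [DecidableEq ι] {A : Matrix ι ι ℂ} {B : Matrix ι (Fin m) ℂ}
    {C : Matrix (Fin p) ι ℂ} (hA : Hurwitz A)
    (h : ∀ s : ℂ, 0 ≤ s.re → (∀ k, s + γ k ≠ 0) →
        C * resolv A s * B = H.transfer s * W.transfer s * (poleSum γ e f W.D (-s))ᵀ +
          ∑ k, (s + γ k)⁻¹ • (H.transfer (-γ k) * W.transfer (-γ k) *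
            Matrix.vecMulVec (f k) (e k))) {s : ℂ} (hs : 0 < s.re) :
    weightMap H.transfer W.transfer γ e f s = C * resolv A s * B := by
  refine Filter.Tendsto.limUnder_eq ?_
  have h1 : Filter.Tendsto (fun z => C * resolv A z * B) (𝓝[≠] s) (𝓝 (C * resolv A s * B)) := by
    refine Filter.Tendsto.mono_left ?_ nhdsWithin_le_nhds
    refine tendsto_pi_nhds.2 fun i => tendsto_pi_nhds.2 fun j => ?_
    exact ((hA.decay_bilin C B i j).analyticAt s hs.le).continuousAt
  refine h1.congr' ?_
  have h2 : ∀ᶠ z in Filter.cofinite, W.transfer (-z) = poleSum γ e f W.D (-z) :=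
    (neg_injective.tendsto_cofinite).eventually hWpr
  have h3 : ∀ᶠ z in Filter.cofinite, ∀ k, z + γ k ≠ 0 := by
    rw [Filter.eventually_all]
    intro k
    refine (Set.finite_singleton (-γ k)).subset fun z hz => ?_
    simpa using eq_neg_of_add_eq_zero_left (not_not.1 hz)
  have h4 : ∀ᶠ z in 𝓝[≠] s, 0 < z.re :=
    nhdsWithin_le_nhds ((isOpen_lt continuous_const Complex.continuous_re).mem_nhds hs)
  filter_upwards [eventually_nhdsNE_of_cofinite h2 s, eventually_nhdsNE_of_cofinite h3 s, h4]
    with z hz2 hz3 hz4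
  rw [h z hz4.le hz3, weightMapExpr, hz2]

end Realization

/-- The difference of the transformed maps, as a function holomorphic on the closed right half
plane. -/
theorem exists_weightMap_difference {W : LTISystem nw q m} {H : LTISystem n m p}
    {S : LTISystem r m p} {γ : Fin nw → ℂ} {e : Fin nw → Fin m → ℂ} {f : Fin nw → Fin q → ℂ}
    (hWE : W.E = 1) (hW : W.IsStable)
    (hHE : H.E = 1) (hH : H.IsStable) (hSE : S.E = 1) (hS : S.IsStable) (hHD : H.D * W.D = 0)
    (hSD : S.D * W.D = 0) (hγ : ∀ k, (γ k).re < 0)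
    (hWpr : HasPoleResidueForm W.transfer γ e f W.D) :
    ∃ Δ : ℂ → Matrix (Fin p) (Fin m) ℂ, MatRHPDecay 1 Δ ∧
      (∀ s : ℂ, 0 < s.re → Δ s = weightMap H.transfer W.transfer γ e f s -
        weightMap S.transfer W.transfer γ e f s) ∧
      ∀ s : ℂ, 0 ≤ s.re → (∀ k, s + γ k ≠ 0) →
        Δ s = weightedError W H S s * (poleSum γ e f W.D (-s))ᵀ +
          ∑ k, (s + γ k)⁻¹ • (weightedError W H S (-γ k) * Matrix.vecMulVec (f k) (e k)) := by
  obtain ⟨A, B, C, hA, h⟩ := exists_weightMap_realization hWE hW hHE hH hHD hγ e f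
  obtain ⟨A', B', C', hA', h'⟩ := exists_weightMap_realization hWE hW hSE hS hSD hγ e f
  refine ⟨fun s => C * resolv A s * B - C' * resolv A' s * B',
    (hA.decay_bilin C B).sub (hA'.decay_bilin C' B'), fun s hs => ?_, fun s hs hne => ?_⟩
  · rw [weightMap_eq_of_realization hWpr hA h hs, weightMap_eq_of_realization hWpr hA' h' hs]
  · simp only [h s hs hne, h' s hs hne, weightedError, Matrix.sub_mul, smul_sub,
      Finset.sum_sub_distrib]
    abel

theorem matAnalyticAt_weightMap {W : LTISystem nw q m} {H : LTISystem n m p}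
    {γ : Fin nw → ℂ} {e : Fin nw → Fin m → ℂ} {f : Fin nw → Fin q → ℂ}
    (hWE : W.E = 1) (hW : W.IsStable) (hHE : H.E = 1) (hH : H.IsStable) (hHD : H.D * W.D = 0)
    (hγ : ∀ k, (γ k).re < 0) (hWpr : HasPoleResidueForm W.transfer γ e f W.D) {s : ℂ}
    (hs : 0 < s.re) : MatAnalyticAt (weightMap H.transfer W.transfer γ e f) s := by
  obtain ⟨A, B, C, hA, h⟩ := exists_weightMap_realization hWE hW hHE hH hHD hγ e f
  intro i j
  refine ((hA.decay_bilin C B i j).analyticAt s hs.le).congr ?_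
  filter_upwards [(isOpen_lt continuous_const Complex.continuous_re).mem_nhds hs] with z hz
  rw [weightMap_eq_of_realization hWpr hA h hz]

/-! ### Stationarity expressed through the transformed map. -/

section Pairing

variable {W : LTISystem nw q m} {H : LTISystem n m p} {S : LTISystem r m p} {γ : Fin nw → ℂ}
  {e : Fin nw → Fin m → ℂ} {f : Fin nw → Fin q → ℂ}

/-- The antistable part of `X W(-s)ᵀ` is orthogonal to all stable strictly proper functions. -/
theorem axisPairing_eq_integral (hWE : W.E = 1) (hW : W.IsStable) (hγ : ∀ k, (γ k).re < 0)
    (hWpr : HasPoleResidueForm W.transfer γ e f W.D) {X : ℂ → Matrix (Fin p) (Fin q) ℂ}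
    {Δ M : ℂ → Matrix (Fin p) (Fin m) ℂ} (hΔ : MatRHPDecay 1 Δ) (hM : MatRHPDecay 1 M)
    (h : ∀ s : ℂ, 0 ≤ s.re → (∀ k, s + γ k ≠ 0) →
        Δ s = X s * (poleSum γ e f W.D (-s))ᵀ +
          ∑ k, (s + γ k)⁻¹ • (X (-γ k) * Matrix.vecMulVec (f k) (e k))) :
    ∫ ω : ℝ, ∑ i, ∑ j, X (Complex.I * ω) i j *
      (M (-(Complex.I * ω)) * W.transfer (-(Complex.I * ω))) i j = axisPairing Δ M := by
  -- The correction terms seen from the reflected side: 1/(iω + γ_k) = -1/(-iω - γ_k), which in the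
  -- variable -iω is holomorphic on the closed right half plane. Together with M this decays
  -- quadratically and integrates to zero.
  set g : ℂ → ℂ := fun s => ∑ i, ∑ l, ∑ k, (X (-γ k) * Matrix.vecMulVec (f k) (e k)) i l *
    ((s - γ k)⁻¹ * M s i l) with hg
  have hgd : RHPDecay 2 g := RHPDecay.sum _ fun i _ => RHPDecay.sum _ fun l _ =>
    RHPDecay.sum _ fun k _ => ((RHPDecay.inv_sub (hγ k)).mul (hM i l)).const_mul _
  have hpt : ∀ ω : ℝ, ∑ i, ∑ j, X (Complex.I * ω) i j *
      (M (-(Complex.I * ω)) * W.transfer (-(Complex.I * ω))) i j =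
      (∑ i, ∑ l, Δ (Complex.I * ω) i l * M (-(Complex.I * ω)) i l) + g (-(Complex.I * ω)) := by
    intro ω
    have h1 := h (Complex.I * ω) (by simp) fun k => RHPDecay.add_ne_zero (hγ k) (by simp)
    rw [← eq_poleSum_of_re_nonneg hWpr hγ (transfer_decay hWE hW) (by simp)] at h1
    have h2 : ∑ i, ∑ j, X (Complex.I * ω) i j *
        (M (-(Complex.I * ω)) * W.transfer (-(Complex.I * ω))) i j = ∑ i, ∑ l,
        (X (Complex.I * ω) * (W.transfer (-(Complex.I * ω)))ᵀ) i l * M (-(Complex.I * ω)) i l := by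
      refine Finset.sum_congr rfl fun i _ => ?_
      simp only [Matrix.mul_apply, Finset.mul_sum, Finset.sum_mul, Matrix.transpose_apply]
      rw [Finset.sum_comm]
      refine Finset.sum_congr rfl fun l _ => Finset.sum_congr rfl fun j _ => by ring
    rw [h2, hg]
    simp only
    rw [← Finset.sum_add_distrib]
    refine Finset.sum_congr rfl fun i _ => ?_
    rw [← Finset.sum_add_distrib]
    refine Finset.sum_congr rfl fun l _ => ?_
    rw [h1, Matrix.add_apply, add_mul, Matrix.sum_apply, Finset.sum_mul, add_assoc,
      ← Finset.sum_add_distrib, left_eq_add]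
    refine Finset.sum_eq_zero fun k _ => ?_
    rw [show -(Complex.I * (ω : ℂ)) - γ k = -(Complex.I * ω + γ k) by ring, inv_neg,
      Matrix.smul_apply, smul_eq_mul]
    ring
  simp only [hpt]
  rw [MeasureTheory.integral_add (axisPairing_integrable hΔ hM) hgd.integrable_imag_neg,
    hgd.integral_imag_neg_eq_zero, add_zero, axisPairing]

theorem exists_re_add_I_smul_im {α β : Type*} (M : Matrix α β ℂ) :
    ∃ M₁ M₂ : Matrix α β ℝ, M = toC M₁ + Complex.I • toC M₂ := by
  refine ⟨M.map Complex.re, M.map Complex.im, ?_⟩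
  ext i j
  simp [mul_comm Complex.I, Complex.re_add_im]

/-- Stationarity of a minimizer, in terms of the difference of the transformed maps. -/
theorem axisPairing_variation_eq_zero (hWE : W.E = 1) (hW : W.IsStable) (hHE : H.E = 1)
    (hH : H.IsStable) (hSE : S.E = 1) (hS : S.IsStable) (hHD : H.D * W.D = 0)
    (hSD : S.D * W.D = 0) (hmin : IsMinimizer W H S) (hγ : ∀ k, (γ k).re < 0)
    (hWpr : HasPoleResidueForm W.transfer γ e f W.D)
    {Δ : ℂ → Matrix (Fin p) (Fin m) ℂ} (hΔ : MatRHPDecay 1 Δ)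
    (h : ∀ s : ℂ, 0 ≤ s.re → (∀ k, s + γ k ≠ 0) →
        Δ s = weightedError W H S s * (poleSum γ e f W.D (-s))ᵀ +
          ∑ k, (s + γ k)⁻¹ • (weightedError W H S (-γ k) * Matrix.vecMulVec (f k) (e k)))
    (A₁ : Matrix (Fin r) (Fin r) ℂ) (B₁ : Matrix (Fin r) (Fin m) ℂ)
    (C₁ : Matrix (Fin p) (Fin r) ℂ) :
    axisPairing Δ (S.variation A₁ B₁ C₁ 0) = 0 := by
  have hd : ∀ A₁ B₁ C₁, MatRHPDecay 1 (S.variation A₁ B₁ C₁ 0) := fun A₁ B₁ C₁ =>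
    transferVariation_decay ((isStable_iff hSE).1 hS) _ _ A₁ B₁ C₁
  have hreal : ∀ (A₁ : Matrix (Fin r) (Fin r) ℝ) (B₁ : Matrix (Fin r) (Fin m) ℝ)
      (C₁ : Matrix (Fin p) (Fin r) ℝ),
      axisPairing Δ (S.variation (toC A₁) (toC B₁) (toC C₁) 0) = 0 := by
    intro A₁ B₁ C₁
    have h1 := integral_weightedError_eq_zero hWE hW hHE hH hSE hS hHD hSD hmin A₁ B₁ C₁
      (D₁ := 0) (Matrix.zero_mul _)
    rw [toC_zero] at h1
    rw [← h1, ← axisPairing_eq_integral hWE hW hγ hWpr hΔ (hd _ _ _) h]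
  -- Competitors must be real, but the variation is linear in its direction and the pairing is
  -- bilinear without conjugation. The real directions therefore give the complex ones needed for
  -- complex eigenvectors.
  obtain ⟨A₂, A₃, rfl⟩ := exists_re_add_I_smul_im A₁
  obtain ⟨B₂, B₃, rfl⟩ := exists_re_add_I_smul_im B₁
  obtain ⟨C₂, C₃, rfl⟩ := exists_re_add_I_smul_im C₁
  have e : S.variation (toC A₂ + Complex.I • toC A₃) (toC B₂ + Complex.I • toC B₃)
      (toC C₂ + Complex.I • toC C₃) 0 = fun s => S.variation (toC A₂) (toC B₂) (toC C₂) 0 s +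
        Complex.I • S.variation (toC A₃) (toC B₃) (toC C₃) 0 s := by
    funext s
    simp only [variation, transferVariation, Matrix.add_mul, Matrix.mul_add, Matrix.smul_mul,
      Matrix.mul_smul, smul_add, add_zero]
    abel
  have hsm : MatRHPDecay 1 fun s => Complex.I • S.variation (toC A₃) (toC B₃) (toC C₃) 0 s :=
    fun i j => (hd _ _ _ i j).const_mul Complex.I
  rw [e, axisPairing_add hΔ (hd _ _ _) hsm, axisPairing_smul, hreal, hreal, mul_zero, add_zero]

/-- Stationarity of a minimizer with respect to the feed-through matrix. -/
theorem tendsto_mul_mulVec_of_isMinimizer (hWE : W.E = 1) (hW : W.IsStable) (hHE : H.E = 1)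
    (hH : H.IsStable) (hSE : S.E = 1) (hS : S.IsStable) (hHD : H.D * W.D = 0)
    (hSD : S.D * W.D = 0) (hmin : IsMinimizer W H S) (hγ : ∀ k, (γ k).re < 0)
    (hWpr : HasPoleResidueForm W.transfer γ e f W.D)
    {Δ : ℂ → Matrix (Fin p) (Fin m) ℂ} (hΔ : MatRHPDecay 1 Δ)
    (h : ∀ s : ℂ, 0 ≤ s.re → (∀ k, s + γ k ≠ 0) →
        Δ s = weightedError W H S s * (poleSum γ e f W.D (-s))ᵀ +
          ∑ k, (s + γ k)⁻¹ • (weightedError W H S (-γ k) * Matrix.vecMulVec (f k) (e k)))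
    {v : Fin m → ℝ} (hv : v ᵥ* W.D = 0) (i : Fin p) :
    Filter.Tendsto (fun t : ℝ => (t : ℂ) * (Δ t *ᵥ fun l => (v l : ℂ)) i) Filter.atTop
      (𝓝 0) := by
  set vC : Fin m → ℂ := fun l => (v l : ℂ) with hvC
  set X := weightedError W H S with hXdef
  have hX : MatRHPDecay 1 X := weightedError_decay hWE hW hHE hH hSE hS hHD hSD
  have hvW : vC ᵥ* toC W.D = 0 := by
    funext j
    have := congrArg (Complex.ofReal) (congrFun hv j)
    simpa [Matrix.vecMul, dotProduct, hvC] using this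
  set x : Fin nw → ℂ → ℂ := fun k s => (X s *ᵥ f k) i with hx
  have hxd : ∀ k, RHPDecay 1 (x k) := fun k => hX.mulVec (f k) i
  set c : Fin nw → ℂ := fun k => e k ⬝ᵥ vC with hc
  -- The feed-through of W disappears because v is in its left kernel, leaving a strictly proper
  -- vector function.
  have hpole : ∀ s, (poleSum γ e f W.D s)ᵀ *ᵥ vC = ∑ k, ((s - γ k)⁻¹ * c k) • f k := by
    intro s
    rw [Matrix.mulVec_transpose, poleSum, Matrix.vecMul_add, hvW, add_zero, Matrix.vecMul_sum]
    refine Finset.sum_congr rfl fun k _ => ?_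
    rw [Matrix.vecMul_smul, Matrix.vecMul_vecMulVec, smul_smul, dotProduct_comm]
  have hXp : ∀ s t, (X s *ᵥ ((poleSum γ e f W.D t)ᵀ *ᵥ vC)) i =
      ∑ k, c k * ((t - γ k)⁻¹ * x k s) := by
    intro s t
    rw [hpole, Matrix.mulVec_sum, Finset.sum_apply]
    refine Finset.sum_congr rfl fun k _ => ?_
    rw [Matrix.mulVec_smul, Pi.smul_apply, smul_eq_mul]
    ring
  refine tendsto_mul_of_integral_eq_zero hγ hxd c (fun k => x k (-γ k) * c k)
    (δ := fun s => (Δ s *ᵥ vC) i) (hΔ.mulVec vC i)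
    (fun s hs hne => ?_) ?_
  · rw [h s hs hne, Matrix.add_mulVec, Pi.add_apply, ← Matrix.mulVec_mulVec, hXp,
      Matrix.sum_mulVec, Finset.sum_apply]
    congr 1
    refine Finset.sum_congr rfl fun k _ => ?_
    rw [Matrix.smul_mulVec, ← Matrix.mulVec_mulVec, Matrix.vecMulVec_mulVec, Pi.smul_apply,
      smul_eq_mul]
    simp [hx, hc, Matrix.mulVec_smul, mul_comm]
  -- Only the i-th row of the feed-through is varied, along v; this is admissible since vᵀ W.D = 0.
  · have h1 := integral_weightedError_eq_zero hWE hW hHE hH hSE hS hHD hSD hmin 0 0 0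
      (D₁ := Matrix.vecMulVec (Pi.single i 1) v) (by
        rw [Matrix.vecMulVec_mul, hv]
        ext a b
        simp [Matrix.vecMulVec_apply])
    rw [← h1]
    congr 1
    funext ω
    rw [← hXp, ← eq_poleSum_of_re_nonneg hWpr hγ (transfer_decay hWE hW) (by simp)]
    have h2 : S.variation (toC 0) (toC 0) (toC 0) (toC (Matrix.vecMulVec (Pi.single i 1) v))
        (-(Complex.I * ω)) = Matrix.vecMulVec (Pi.single i 1) vC := by
      simp only [variation, transferVariation, toC_zero, Matrix.zero_mul, Matrix.mul_zero,
        zero_add]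
      ext a b
      by_cases hab : a = i
      · subst hab
        simp [Matrix.vecMulVec_apply, hvC]
      · simp [Matrix.vecMulVec_apply, hab]
    rw [h2, Matrix.vecMulVec_mul, Finset.sum_eq_single i (fun a _ ha => by
      simp [Matrix.vecMulVec_apply, ha]) (by simp)]
    simp only [Matrix.mulVec_transpose, Matrix.vecMulVec_apply, Pi.single_eq_same, one_mul]
    rfl

end Pairing

end LTISystem

/-! ### Laplace transform of the matrix exponential. -/

section Laplace

attribute [local instance] Matrix.linftyOpNormedRing Matrix.linftyOpNormedAlgebra
  Matrix.linftyOpNormedAddCommGroup Matrix.linftyOpNormedSpace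

variable {ι : Type*} [Fintype ι] [DecidableEq ι]

/-- The factor ‖1‖ + 1 dominates the constant term of the series and is at least 1 for the others.
-/
theorem norm_matrix_exp_le (A : Matrix ι ι ℂ) :
    ‖NormedSpace.exp A‖ ≤ (‖(1 : Matrix ι ι ℂ)‖ + 1) * Real.exp ‖A‖ := by
  rw [NormedSpace.exp_eq_tsum ℂ]
  have hs : HasSum (fun n : ℕ => (‖(1 : Matrix ι ι ℂ)‖ + 1) * (‖A‖ ^ n / n.factorial))
      ((‖(1 : Matrix ι ι ℂ)‖ + 1) * Real.exp ‖A‖) := by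
    refine HasSum.mul_left _ ?_
    rw [Real.exp_eq_exp_ℝ]
    exact NormedSpace.expSeries_div_hasSum_exp ‖A‖
  refine tsum_of_norm_bounded hs fun n => ?_
  have hpow : ‖A ^ n‖ ≤ (‖(1 : Matrix ι ι ℂ)‖ + 1) * ‖A‖ ^ n := by
    rcases Nat.eq_zero_or_pos n with rfl | hn
    · simp
    · refine (norm_pow_le' A hn).trans (le_mul_of_one_le_left (by positivity) ?_)
      linarith [norm_nonneg (1 : Matrix ι ι ℂ)]
  rw [norm_smul, norm_inv, Complex.norm_natCast, inv_mul_eq_div, ← mul_div_assoc]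
  gcongr

theorem hasDerivAt_matrix_exp_entry (A : Matrix ι ι ℂ) (t : ℝ) (i j : ι) :
    HasDerivAt (fun t : ℝ => NormedSpace.exp (t • A) i j) ((NormedSpace.exp (t • A) * A) i j) t := by
  have h := hasDerivAt_exp_smul_const (𝕂 := ℝ) A t
  have h2 : HasDerivAt (fun t : ℝ => Matrix.entryLinearMap ℝ ℂ i j (NormedSpace.exp (t • A)))
      (Matrix.entryLinearMap ℝ ℂ i j (NormedSpace.exp (t • A) * A)) t :=
    (LinearMap.toContinuousLinearMap (Matrix.entryLinearMap ℝ ℂ i j)).hasFDerivAt.comp_hasDerivAt t h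
  exact h2

theorem hasDerivAt_cexp_mul_matrix_exp (A : Matrix ι ι ℂ) (s : ℂ) (t : ℝ) (i j : ι) :
    HasDerivAt (fun t : ℝ => Complex.exp (-(s * t)) * NormedSpace.exp (t • A) i j)
      (∑ k, Complex.exp (-(s * t)) * NormedSpace.exp (t • A) i k * (A - s • 1) k j) t := by
  have h2 : HasDerivAt (fun t : ℝ => Complex.exp (-(s * t))) (Complex.exp (-(s * t)) * (-s)) t := by
    have : HasDerivAt (fun t : ℝ => -(s * (t : ℂ))) (-s) t := by
      have h := ((Complex.ofRealCLM.hasDerivAt (x := t)).const_mul s).fun_neg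
      rw [Complex.ofRealCLM_apply, Complex.ofReal_one, mul_one] at h
      exact h
    exact this.cexp
  refine (h2.mul (hasDerivAt_matrix_exp_entry A t i j)).congr_deriv ?_
  simp only [Matrix.sub_apply, Matrix.smul_apply, Matrix.one_apply, smul_eq_mul, mul_sub,
    Finset.sum_sub_distrib, mul_ite, mul_one, mul_zero, Finset.sum_ite_eq', Finset.mem_univ,
    if_true, Matrix.mul_apply, Finset.mul_sum, mul_assoc]
  ring

theorem norm_cexp_mul_matrix_exp_le (A : Matrix ι ι ℂ) (s : ℂ) {t : ℝ} (ht : 0 ≤ t) (i j : ι) :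
    ‖Complex.exp (-(s * t)) * NormedSpace.exp (t • A) i j‖ ≤
      (‖(1 : Matrix ι ι ℂ)‖ + 1) * Real.exp (-(s.re - ‖A‖) * t) := by
  have h1 := norm_matrix_exp_le (t • A)
  rw [norm_smul, Real.norm_of_nonneg ht] at h1
  rw [norm_mul, Complex.norm_exp]
  have h2 : (-(s * (t : ℂ))).re = -(s.re * t) := by simp
  rw [h2]
  calc Real.exp (-(s.re * t)) * ‖NormedSpace.exp (t • A) i j‖
      ≤ Real.exp (-(s.re * t)) * ((‖(1 : Matrix ι ι ℂ)‖ + 1) * Real.exp (t * ‖A‖)) := by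
        gcongr
        exact (norm_entry_le _ i j).trans h1
    _ = (‖(1 : Matrix ι ι ℂ)‖ + 1) * (Real.exp (-(s.re * t)) * Real.exp (t * ‖A‖)) := by ring
    _ = _ := by
      rw [← Real.exp_add]
      ring_nf

theorem integrableOn_cexp_mul_matrix_exp (A : Matrix ι ι ℂ) {s : ℂ} (hs : ‖A‖ < s.re) (i j : ι) :
    MeasureTheory.IntegrableOn (fun t : ℝ => Complex.exp (-(s * t)) * NormedSpace.exp (t • A) i j)
      (Set.Ioi 0) := by
  have hint := (exp_neg_integrableOn_Ioi 0 (sub_pos.2 hs)).const_mul (‖(1 : Matrix ι ι ℂ)‖ + 1)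
  have hc : Continuous fun t : ℝ => Complex.exp (-(s * t)) * NormedSpace.exp (t • A) i j :=
    continuous_iff_continuousAt.2 fun t => (hasDerivAt_cexp_mul_matrix_exp A s t i j).continuousAt
  refine hint.mono' hc.aestronglyMeasurable ?_
  filter_upwards [MeasureTheory.ae_restrict_mem measurableSet_Ioi] with t ht
  exact norm_cexp_mul_matrix_exp_le A s (le_of_lt ht) i j

/-- The Laplace transform of the matrix exponential is the resolvent. -/
theorem integral_cexp_mul_matrix_exp (A : Matrix ι ι ℂ) {s : ℂ} (hs : ‖A‖ < s.re) (i j : ι) :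
    ∫ t in Set.Ioi (0 : ℝ), Complex.exp (-(s * t)) * NormedSpace.exp (t • A) i j =
      resolv A s i j := by
  have hi := integrableOn_cexp_mul_matrix_exp A hs
  have hlim : ∀ i j, Filter.Tendsto
      (fun t : ℝ => Complex.exp (-(s * t)) * NormedSpace.exp (t • A) i j)
      Filter.atTop (𝓝 0) := by
    intro i j
    have h0 : Filter.Tendsto (fun t : ℝ => (‖(1 : Matrix ι ι ℂ)‖ + 1) *
        Real.exp (-(s.re - ‖A‖) * t)) Filter.atTop (𝓝 0) := by
      have h1 : Filter.Tendsto (fun t : ℝ => -(s.re - ‖A‖) * t) Filter.atTop Filter.atBot :=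
        Filter.tendsto_id.const_mul_atTop_of_neg (by linarith)
      simpa using (Real.tendsto_exp_atBot.comp h1).const_mul (‖(1 : Matrix ι ι ℂ)‖ + 1)
    refine squeeze_zero_norm' ?_ h0
    filter_upwards [Filter.eventually_ge_atTop 0] with t ht
    exact norm_cexp_mul_matrix_exp_le A s ht i j
  set Y : Matrix ι ι ℂ := Matrix.of fun i j =>
    ∫ t in Set.Ioi (0 : ℝ), Complex.exp (-(s * t)) * NormedSpace.exp (t • A) i j with hY
  -- The derivative of exp(-st) exp(tA) is the same function times A - s. Integrating it over (0,
  -- ∞), only the boundary value 1 at t = 0 survives.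
  have hmul : Y * (A - s • 1) = -1 := by
    ext i j
    have h1 := MeasureTheory.integral_Ioi_of_hasDerivAt_of_tendsto
      (hasDerivAt_cexp_mul_matrix_exp A s 0 i j).continuousAt.continuousWithinAt
      (fun t _ => hasDerivAt_cexp_mul_matrix_exp A s t i j)
      (MeasureTheory.integrable_finsetSum _ fun k _ => (hi i k).mul_const _) (hlim i j)
    rw [MeasureTheory.integral_finsetSum _ fun k _ => (hi i k).mul_const _] at h1
    simp only [MeasureTheory.integral_mul_const] at h1
    rw [Matrix.mul_apply]
    refine h1.trans ?_
    simp
  have hinv : Y * (s • 1 - A) = 1 := by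
    rw [← neg_sub, mul_neg, hmul, neg_neg]
  rw [resolv, Matrix.inv_eq_left_inv hinv, hY, Matrix.of_apply]

/-- The response is the classical C exp(tA) B. Any half plane of convergence will do, so the crude
bound Re s > ‖A‖ is enough. -/
theorem exists_isImpulseResponse_of_realization {p m : ℕ} (A : Matrix ι ι ℂ)
    (B : Matrix ι (Fin m) ℂ) (C : Matrix (Fin p) ι ℂ) {G : ℂ → Matrix (Fin p) (Fin m) ℂ} {σ : ℝ}
    (hG : ∀ s : ℂ, σ < s.re → G s = C * resolv A s * B) : ∃ F, IsImpulseResponse F G := by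
  have hc : ∀ i j, Continuous fun t : ℝ => NormedSpace.exp (t • A) i j := fun i j =>
    continuous_iff_continuousAt.2 fun t => (hasDerivAt_matrix_exp_entry A t i j).continuousAt
  have hexp : ∀ (M : Matrix ι ι ℂ) i j,
      (C * M * B) i j = ∑ l, ∑ k, M k l * (C i k * B l j) := by
    intro M i j
    simp only [Matrix.mul_apply, Finset.sum_mul]
    refine Finset.sum_congr rfl fun l _ => Finset.sum_congr rfl fun k _ => by ring
  refine ⟨fun t => C * NormedSpace.exp (t • A) * B, fun i j => ?_, max σ ‖A‖, fun s hs i j => ?_⟩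
  · simp only [hexp]
    exact (continuous_finsetSum _ fun l _ => continuous_finsetSum _ fun k _ =>
      (hc k l).mul continuous_const).continuousOn
  · have hs1 : ‖A‖ < s.re := (le_max_right _ _).trans_lt hs
    have hs2 : σ < s.re := (le_max_left _ _).trans_lt hs
    have hi : ∀ k l, MeasureTheory.IntegrableOn (fun t : ℝ =>
        Complex.exp (-(s * t)) * NormedSpace.exp (t • A) k l * (C i k * B l j)) (Set.Ioi 0) :=
      fun k l => (integrableOn_cexp_mul_matrix_exp A hs1 k l).mul_const _
    simp only [hG s hs2, hexp, Finset.mul_sum, ← mul_assoc (Complex.exp _)]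
    refine ⟨MeasureTheory.integrable_finsetSum _ fun l _ =>
      MeasureTheory.integrable_finsetSum _ fun k _ => hi k l, ?_⟩
    rw [MeasureTheory.integral_finsetSum _ fun l _ =>
      MeasureTheory.integrable_finsetSum _ fun k _ => hi k l]
    refine Finset.sum_congr rfl fun l _ => ?_
    rw [MeasureTheory.integral_finsetSum _ fun k _ => hi k l]
    refine Finset.sum_congr rfl fun k _ => ?_
    rw [MeasureTheory.integral_mul_const, integral_cexp_mul_matrix_exp A hs1]

end Laplace

/-! ### The initial value theorem. -/

section InitialValue

/-- `τ e^{-τ t}` is an approximate identity at `0` on the half-line. -/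
theorem tendsto_integral_exp_mul {g : ℝ → ℂ} (hi : MeasureTheory.IntegrableOn g (Set.Ioi 0))
    {a : ℂ} (hg : Filter.Tendsto g (𝓝[>] 0) (𝓝 a)) :
    Filter.Tendsto (fun τ : ℝ => ∫ t in Set.Ioi (0 : ℝ), (τ * Real.exp (-(τ * t))) • g t)
      Filter.atTop (𝓝 a) := by
  refine tendsto_setIntegral_peak_smul_of_integrableOn_of_tendsto (x₀ := (0 : ℝ))
    (t := Set.Ioc 0 1) measurableSet_Ioi measurableSet_Ioc (fun x hx => hx.1)
    (Ioc_mem_nhdsGT one_pos) (by simp) ?_ ?_ ?_ ?_ hi hg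
  · filter_upwards [Filter.eventually_ge_atTop 0] with τ hτ t _
    positivity
  · intro u hu h0
    obtain ⟨δ, hδ, hball⟩ := Metric.isOpen_iff.1 hu 0 h0
    rw [Metric.tendstoUniformlyOn_iff]
    intro ε hε
    -- For t ≥ δ the kernel is at most τ exp(-τδ), which is independent of t and tends to 0.
    have h1 : Filter.Tendsto (fun τ : ℝ => δ⁻¹ * ((δ * τ) ^ 1 * Real.exp (-(δ * τ))))
        Filter.atTop (𝓝 0) := by
      have := ((Real.tendsto_pow_mul_exp_neg_atTop_nhds_zero 1).comp
        (Filter.tendsto_id.const_mul_atTop hδ)).const_mul δ⁻¹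
      simpa [Function.comp_def] using this
    filter_upwards [h1.eventually (gt_mem_nhds hε), Filter.eventually_ge_atTop 0] with τ hτ hτ0 t ht
    have hδt : δ ≤ t := by
      by_contra hc
      push Not at hc
      refine ht.2 (hball ?_)
      have : (0 : ℝ) < t := ht.1
      simpa [abs_of_pos this] using hc
    rw [Pi.zero_apply, dist_comm, Real.dist_0_eq_abs, abs_of_nonneg (by positivity)]
    refine lt_of_le_of_lt ?_ hτ
    rw [pow_one, ← mul_assoc, ← mul_assoc, inv_mul_cancel₀ hδ.ne', one_mul]
    refine mul_le_mul_of_nonneg_left (Real.exp_le_exp.2 ?_) hτ0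
    nlinarith
  · have h1 : ∀ τ : ℝ, ∫ t in Set.Ioc (0 : ℝ) 1, τ * Real.exp (-(τ * t)) = 1 - Real.exp (-τ) := by
      intro τ
      rw [← intervalIntegral.integral_of_le zero_le_one]
      have hd : ∀ t ∈ Set.uIcc (0 : ℝ) 1,
          HasDerivAt (fun t => -Real.exp (-(τ * t))) (τ * Real.exp (-(τ * t))) t := by
        intro t _
        have : HasDerivAt (fun t => -(τ * t)) (-τ) t := by
          simpa using ((hasDerivAt_id t).const_mul τ).fun_neg
        exact this.exp.fun_neg.congr_deriv (by ring)
      rw [intervalIntegral.integral_eq_sub_of_hasDerivAt hd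
        (Continuous.intervalIntegrable (by fun_prop) _ _)]
      simp only [mul_one, mul_zero, neg_zero, Real.exp_zero]
      ring
    simp only [h1]
    simpa using (Real.tendsto_exp_neg_atTop_nhds_zero).const_sub 1
  · exact Filter.Eventually.of_forall fun τ =>
      (Continuous.aestronglyMeasurable (by fun_prop))

/-- The initial value theorem for the Laplace transform. -/
theorem IsImpulseResponse.tendsto_mul {p m : ℕ} {F : ℝ → Matrix (Fin p) (Fin m) ℂ}
    {G : ℂ → Matrix (Fin p) (Fin m) ℂ} (h : IsImpulseResponse F G) (i : Fin p) (j : Fin m) :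
    Filter.Tendsto (fun t : ℝ => (t : ℂ) * G t i j) Filter.atTop (𝓝 (F 0 i j)) := by
  obtain ⟨hF, σ, hσ⟩ := h
  -- A fixed damping factor exp(-σ't) makes the response integrable and leaves its value at 0
  -- unchanged. It shifts the argument of the transform by σ'.
  set σ' : ℝ := σ + 1 with hσ'
  set g : ℝ → ℂ := fun t => Complex.exp (-((σ' : ℂ) * t)) * F t i j with hgdef
  have hgi : MeasureTheory.IntegrableOn g (Set.Ioi 0) := (hσ σ' (by simp [hσ']) i j).1
  have hg0 : Filter.Tendsto g (𝓝[>] 0) (𝓝 (F 0 i j)) := by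
    have h1 : ContinuousWithinAt g (Set.Ici 0) 0 :=
      ContinuousWithinAt.mul (by fun_prop) (hF i j 0 (by simp))
    have h2 := h1.tendsto.mono_left (nhdsWithin_mono _ Set.Ioi_subset_Ici_self)
    simpa [hgdef] using h2
  have hlim := tendsto_integral_exp_mul hgi hg0
  have hval : ∀ τ : ℝ, 0 < τ → ∫ t in Set.Ioi (0 : ℝ), (τ * Real.exp (-(τ * t))) • g t =
      (τ : ℂ) * G ((τ + σ' : ℝ) : ℂ) i j := by
    intro τ hτ
    rw [← (hσ ((τ + σ' : ℝ) : ℂ) (by simp [hσ']; linarith) i j).2,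
      ← MeasureTheory.integral_const_mul]
    refine MeasureTheory.integral_congr_ae (Filter.Eventually.of_forall fun t => ?_)
    simp only [hgdef, Complex.real_smul]
    push_cast
    rw [add_mul, neg_add, Complex.exp_add]
    ring
  have hlim2 : Filter.Tendsto (fun τ : ℝ => (τ : ℂ) * G ((τ + σ' : ℝ) : ℂ) i j) Filter.atTop
      (𝓝 (F 0 i j)) := by
    refine hlim.congr' ?_
    filter_upwards [Filter.eventually_gt_atTop 0] with τ hτ
    exact hval τ hτ
  -- Undoes the shift: with t = τ + σ', the factor t is τ(1 + σ'/τ).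
  have hquot : Filter.Tendsto (fun τ : ℝ => (1 + (σ' * τ⁻¹ : ℝ) : ℂ)) Filter.atTop (𝓝 1) := by
    have h1 : Filter.Tendsto (fun τ : ℝ => σ' * τ⁻¹) Filter.atTop (𝓝 0) := by
      simpa using tendsto_inv_atTop_zero.const_mul σ'
    simpa using ((Complex.continuous_ofReal.tendsto 0).comp h1).const_add (1 : ℂ)
  have hlim3 := hquot.mul hlim2
  rw [one_mul] at hlim3
  have hshift : Filter.Tendsto (fun t : ℝ => t - σ') Filter.atTop Filter.atTop :=
    Filter.tendsto_atTop_add_const_right _ _ Filter.tendsto_id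
  refine (hlim3.comp hshift).congr' ?_
  filter_upwards [Filter.eventually_gt_atTop σ'] with t ht
  have hne : ((t : ℂ) - σ') ≠ 0 := by
    rw [← Complex.ofReal_sub, Complex.ofReal_ne_zero]
    linarith
  simp only [Function.comp_apply, sub_add_cancel]
  push_cast
  field_simp
  ring

end InitialValue

/-! ### Unreachable pairs and their spare directions. -/

section Reachability

variable {ι β : Type*} [Fintype ι] [DecidableEq ι] [Fintype β]

/-- The reachable subspace of the pair `(A, B)`. -/
def reachable (A : Matrix ι ι ℝ) (B : Matrix ι β ℝ) : Submodule ℝ (ι → ℝ) :=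
  Submodule.span ℝ {v | ∃ (k : ℕ) (w : β → ℝ), v = (A ^ k * B) *ᵥ w}

theorem mulVec_mem_reachable (A : Matrix ι ι ℝ) (B : Matrix ι β ℝ) {v : ι → ℝ}
    (hv : v ∈ reachable A B) : A *ᵥ v ∈ reachable A B := by
  induction hv using Submodule.span_induction with
  | mem x hx =>
    obtain ⟨k, w, rfl⟩ := hx
    refine Submodule.subset_span ⟨k + 1, w, ?_⟩
    rw [Matrix.mulVec_mulVec, ← Matrix.mul_assoc, pow_succ']
  | zero => rw [Matrix.mulVec_zero]; exact Submodule.zero_mem _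
  | add x y _ _ hx hy => rw [Matrix.mulVec_add]; exact Submodule.add_mem _ hx hy
  | smul a x _ hx => rw [Matrix.mulVec_smul]; exact Submodule.smul_mem _ _ hx

theorem input_mem_reachable (A : Matrix ι ι ℝ) (B : Matrix ι β ℝ) (w : β → ℝ) :
    B *ᵥ w ∈ reachable A B :=
  Submodule.subset_span ⟨0, w, by rw [pow_zero, Matrix.one_mul]⟩

theorem matrix_ext_mulVec {α : Type*} {M N : Matrix α ι ℝ}
    (h : ∀ v, M *ᵥ v = N *ᵥ v) : M = N := by
  ext i j
  simpa using congrFun (h (Pi.single j 1)) i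

/-- An unreachable pair admits a proper idempotent onto the reachable subspace. -/
theorem exists_idempotent_of_reachable_ne_top {A : Matrix ι ι ℝ} [DecidableEq β]
    {B : Matrix ι β ℝ} (h : reachable A B ≠ ⊤) :
    ∃ P : Matrix ι ι ℝ, P * P = P ∧ P * A * P = A * P ∧ P * B = B ∧ P ≠ 1 := by
  -- A linear left inverse of the inclusion is a projection onto the reachable subspace, which is
  -- A-invariant and contains the range of B.
  obtain ⟨g, hg⟩ := LinearMap.exists_leftInverse_of_injective (reachable A B).subtype
    (LinearMap.ker_eq_bot.2 (reachable A B).injective_subtype)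
  set P : Matrix ι ι ℝ := LinearMap.toMatrix' ((reachable A B).subtype ∘ₗ g) with hP
  have hPv : ∀ v, P *ᵥ v = (g v : ι → ℝ) := fun v => by
    rw [hP, LinearMap.toMatrix'_mulVec]
    rfl
  have hmem : ∀ v, P *ᵥ v ∈ reachable A B := fun v => hPv v ▸ (g v).2
  have hfix : ∀ v ∈ reachable A B, P *ᵥ v = v := fun v hv => by
    rw [hPv]
    exact congrArg Subtype.val (LinearMap.congr_fun hg ⟨v, hv⟩)
  refine ⟨P, matrix_ext_mulVec fun v => ?_, matrix_ext_mulVec fun v => ?_,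
    matrix_ext_mulVec fun v => ?_, ?_⟩
  · rw [← Matrix.mulVec_mulVec, hfix _ (hmem v)]
  · rw [← Matrix.mulVec_mulVec, ← Matrix.mulVec_mulVec, ← Matrix.mulVec_mulVec,
      hfix _ (mulVec_mem_reachable A B (hmem v))]
  · rw [← Matrix.mulVec_mulVec, hfix _ (input_mem_reachable A B v)]
  · rintro h1
    refine h (Submodule.eq_top_iff'.2 fun v => ?_)
    have := hmem v
    rwa [h1, Matrix.one_mulVec] at this

/-- An unreachable system has another realization whose transfer function can be moved in the
direction of any first-order system with a real pole. -/
theorem exists_decoupled {α : Type*} [DecidableEq β] {A : Matrix ι ι ℝ} (hA : Hurwitz (toC A))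
    {B : Matrix ι β ℝ}
    (h : reachable A B ≠ ⊤) (C : Matrix α ι ℝ) {μ : ℝ} (hμ : μ < 0) (u : α → ℝ) (v : β → ℝ) :
    ∃ (A' : Matrix ι ι ℝ) (B₁ : Matrix ι β ℝ) (C' : Matrix α ι ℝ), Hurwitz (toC A') ∧
      ∀ s : ℂ, 0 ≤ s.re →
        toC C' * resolv (toC A') s * toC B = toC C * resolv (toC A) s * toC B ∧
        toC C' * resolv (toC A') s * toC B₁ = (s - μ)⁻¹ • toC (Matrix.vecMulVec u v) := by
  obtain ⟨P, hPP, hPA, hPB, hP1⟩ := exists_idempotent_of_reachable_ne_top h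
  obtain ⟨z, hz⟩ : ∃ z, (1 - P) *ᵥ z ≠ 0 := by
    by_contra hc
    push Not at hc
    refine hP1 (sub_eq_zero.1 (matrix_ext_mulVec (N := 0) fun v => ?_)).symm
    rw [hc v, Matrix.zero_mulVec]
  set x := (1 - P) *ᵥ z with hx
  obtain ⟨ξ₀, hξ₀⟩ : ∃ ξ₀ : ι → ℝ, ξ₀ ⬝ᵥ x = 1 := by
    refine ⟨(x ⬝ᵥ x)⁻¹ • x, ?_⟩
    rw [smul_dotProduct, smul_eq_mul, inv_mul_cancel₀]
    rwa [Ne, dotProduct_self_eq_zero]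
  have hPQ : P * (1 - P) = 0 := by rw [mul_sub, mul_one, hPP, sub_self]
  have hQP : (1 - P) * P = 0 := by rw [sub_mul, one_mul, hPP, sub_self]
  have hQQ : (1 - P) * (1 - P) = 1 - P := by rw [mul_sub, mul_one, hQP, sub_zero]
  have hPx : P *ᵥ x = 0 := by rw [hx, Matrix.mulVec_mulVec, hPQ, Matrix.zero_mulVec]
  have hQx : (1 - P) *ᵥ x = x := by rw [hx, Matrix.mulVec_mulVec, hQQ]
  set ξ := ξ₀ ᵥ* (1 - P) with hξ
  have hξP : ξ ᵥ* P = 0 := by rw [hξ, Matrix.vecMul_vecMul, hQP, Matrix.vecMul_zero]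
  have hξx : ξ ⬝ᵥ x = 1 := by rw [hξ, ← Matrix.dotProduct_mulVec, hQx, hξ₀]
  -- On the reachable subspace nothing changes. On the complement the dynamics are replaced by the
  -- scalar μ, where x is a vector of the complement and ξ a dual functional that vanishes on the
  -- reachable part. The input x vᵀ and the output u ξᵀ then realize u vᵀ/(s - μ).
  set A' := A * P + μ • (1 - P) with hA'
  set C' := C * P + Matrix.vecMulVec u ξ with hC'
  set B₁ := Matrix.vecMulVec x v with hB₁
  have hA'P : A' * P = A * P := by
    rw [hA', add_mul, smul_mul_assoc, hQP, smul_zero, add_zero, mul_assoc, hPP]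
  have hPA' : P * A' = A * P := by
    rw [hA', mul_add, mul_smul_comm, hPQ, smul_zero, add_zero, ← mul_assoc, hPA]
  have hQA' : (1 - P) * A' = μ • (1 - P) := by
    rw [sub_mul, one_mul, hPA', hA']
    abel
  have hA'x : A' * B₁ = μ • B₁ := by
    rw [hB₁, Matrix.mul_vecMulVec, hA', Matrix.add_mulVec, ← Matrix.mulVec_mulVec, hPx,
      Matrix.mulVec_zero, zero_add, Matrix.smul_mulVec, hQx, Matrix.smul_vecMulVec]
  have hC'x : C' * B₁ = Matrix.vecMulVec u v := by
    rw [hC', hB₁, Matrix.add_mul, Matrix.mul_assoc, Matrix.mul_vecMulVec P, hPx,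
      Matrix.vecMulVec_mul_vecMulVec, hξx]
    simp
  have hC'P : C' * P = C * P := by
    rw [hC', Matrix.add_mul, Matrix.mul_assoc, hPP, Matrix.vecMulVec_mul, hξP,
      show Matrix.vecMulVec u (0 : ι → ℝ) = 0 by ext; simp [Matrix.vecMulVec_apply], add_zero]
  have hμs : ∀ s : ℂ, 0 ≤ s.re → s - μ ≠ 0 := fun s hs =>
    RHPDecay.sub_ne_zero (by simpa using hμ) hs
  have hQA'c : (1 - toC P) * toC A' = (μ : ℂ) • (1 - toC P) := by
    rw [← toC_one, ← toC_sub, ← toC_mul, hQA', toC_smul]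
  -- A null vector of s - A' with Re s ≥ 0 has no component in the complement, since s ≠ μ. It
  -- therefore lies in the range of P, where A' = A, and A is Hurwitz.
  have hHur : Hurwitz (toC A') := by
    intro s hs hdet
    obtain ⟨y, hy0, hy⟩ := Matrix.exists_mulVec_eq_zero_iff.2 hdet
    rw [Matrix.sub_mulVec, Matrix.smul_mulVec, Matrix.one_mulVec, sub_eq_zero] at hy
    have h1 : (1 - toC P) *ᵥ y = 0 := by
      have h2 : (1 - toC P) *ᵥ (s • y) = (1 - toC P) *ᵥ (toC A' *ᵥ y) := by rw [hy]
      rw [Matrix.mulVec_smul, Matrix.mulVec_mulVec, hQA'c, Matrix.smul_mulVec, ← sub_eq_zero,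
        ← sub_smul] at h2
      exact (smul_eq_zero.1 h2).resolve_left (hμs s hs)
    have h3 : toC P *ᵥ y = y := by
      rw [Matrix.sub_mulVec, Matrix.one_mulVec, sub_eq_zero] at h1
      exact h1.symm
    refine hA s hs (Matrix.exists_mulVec_eq_zero_iff.1 ⟨y, hy0, ?_⟩)
    rw [Matrix.sub_mulVec, Matrix.smul_mulVec, Matrix.one_mulVec, sub_eq_zero, hy]
    conv_lhs => rw [← h3]
    conv_rhs => rw [← h3]
    rw [Matrix.mulVec_mulVec, Matrix.mulVec_mulVec, ← toC_mul, ← toC_mul, hA'P]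
  refine ⟨A', B₁, C', hHur, fun s hs => ⟨?_, ?_⟩⟩
  -- P commutes with A', hence with its resolvent. Applied to B the resolvent stays in the range of
  -- P, where A' and A coincide.
  · have hcomm : toC P * resolv (toC A') s = resolv (toC A') s * toC P := by
      have h1 : toC P * (s • 1 - toC A') = (s • 1 - toC A') * toC P := by
        rw [mul_sub, sub_mul, ← toC_mul, ← toC_mul, hPA', hA'P, mul_smul_comm, smul_mul_assoc,
          mul_one, one_mul]
      calc toC P * resolv (toC A') s
          = resolv (toC A') s * (s • 1 - toC A') * toC P * resolv (toC A') s := by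
            rw [resolv_mul (hHur s hs), one_mul]
        _ = resolv (toC A') s * (toC P * (s • 1 - toC A')) * resolv (toC A') s := by
            rw [h1, mul_assoc (resolv (toC A') s)]
        _ = resolv (toC A') s * toC P := by
            rw [mul_assoc, mul_assoc, mul_resolv (hHur s hs), mul_one]
    have hY : resolv (toC A') s * toC B = toC P * (resolv (toC A') s * toC B) := by
      rw [← Matrix.mul_assoc, hcomm, Matrix.mul_assoc, ← toC_mul, hPB]
    have hYB : resolv (toC A') s * toC B = resolv (toC A) s * toC B := by
      have h2 : (s • 1 - toC A) * (resolv (toC A') s * toC B) = toC B := by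
        rw [hY, ← Matrix.mul_assoc, show (s • 1 - toC A) * toC P = (s • 1 - toC A') * toC P by
          rw [sub_mul, sub_mul, ← toC_mul, ← toC_mul, hA'P], Matrix.mul_assoc, ← hY,
          ← Matrix.mul_assoc, mul_resolv (hHur s hs), Matrix.one_mul]
      rw [← h2, ← Matrix.mul_assoc (resolv (toC A) s), resolv_mul (hA s hs), Matrix.one_mul, h2]
    rw [Matrix.mul_assoc, hY, ← Matrix.mul_assoc, ← toC_mul, hC'P, toC_mul, Matrix.mul_assoc, ← hY,
      hYB, Matrix.mul_assoc]
  · have h1 : (s • 1 - toC A') * toC B₁ = (s - μ) • toC B₁ := by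
      rw [Matrix.sub_mul, ← toC_mul, hA'x, toC_smul, Matrix.smul_mul, Matrix.one_mul, sub_smul]
    have h2 : resolv (toC A') s * toC B₁ = (s - μ)⁻¹ • toC B₁ := by
      have h3 := congrArg (fun M => (s - μ)⁻¹ • (resolv (toC A') s * M)) h1
      simp only [← Matrix.mul_assoc, resolv_mul (hHur s hs), Matrix.mul_smul, smul_smul,
        inv_mul_cancel₀ (hμs s hs), one_smul, Matrix.one_mul] at h3
      exact h3.symm
    rw [Matrix.mul_assoc, h2, Matrix.mul_smul, ← toC_mul, hC'x]

theorem resolv_transpose (A : Matrix ι ι ℂ) (s : ℂ) : resolv Aᵀ s = (resolv A s)ᵀ := by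
  rw [resolv, resolv, Matrix.transpose_nonsing_inv, Matrix.transpose_sub, Matrix.transpose_smul,
    Matrix.transpose_one]

theorem Hurwitz.transpose {A : Matrix ι ι ℂ} (hA : Hurwitz A) : Hurwitz Aᵀ := fun s hs => by
  have := hA s hs
  rwa [← Matrix.det_transpose, Matrix.transpose_sub, Matrix.transpose_smul,
    Matrix.transpose_one] at this

end Reachability

theorem RHPDecay.eq_zero_of_const {g : ℂ → ℂ} (hg : RHPDecay 1 g) {a : ℂ}
    (h : ∀ s : ℂ, 0 ≤ s.re → g s = a) : a = 0 := by
  obtain ⟨K, hK0, hK⟩ := hg.bound_nonneg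
  by_contra ha
  have hpos := norm_pos_iff.2 ha
  have h1 := hK ((K / ‖a‖ : ℝ) : ℂ) (by
    rw [Complex.ofReal_re]
    positivity)
  rw [h _ (by
    rw [Complex.ofReal_re]
    positivity), pow_one, Complex.norm_real, Real.norm_of_nonneg (by positivity),
    le_div_iff₀ (by positivity), mul_add, mul_div_cancel₀ _ hpos.ne'] at h1
  linarith

/-! ### Markov parameters and vanishing residues. -/

namespace LTISystem

variable {m p r : ℕ}

section Markov

variable {S : LTISystem r m p} {lam : Fin r → ℂ} {c : Fin r → Fin p → ℂ} {b : Fin r → Fin m → ℂ}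

/-- The Markov parameters of a system in terms of its poles and residues. -/
theorem markov_eq_sum (hE : S.E = 1) (hS : S.IsStable) (hlam : ∀ k, (lam k).re < 0)
    (h : HasPoleResidueForm S.transfer lam c b S.D) (i : ℕ) :
    toC S.C * toC S.A ^ i * toC S.B = ∑ k, lam k ^ i • Matrix.vecMulVec (c k) (b k) := by
  have hA := (isStable_iff hE).1 hS
  -- Multiplication by s splits off the Markov parameter on one side and the sum of λ_kⁱ times the
  -- residues on the other. The difference of these two constants is O(1/|s|), hence zero.
  have step : ∀ i : ℕ, (∀ s : ℂ, 0 ≤ s.re →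
      toC S.C * resolv (toC S.A) s * (toC S.A ^ i * toC S.B) =
        ∑ k, ((s - lam k)⁻¹ * lam k ^ i) • Matrix.vecMulVec (c k) (b k)) →
      toC S.C * toC S.A ^ i * toC S.B = ∑ k, lam k ^ i • Matrix.vecMulVec (c k) (b k) := by
    intro i hi
    rw [← sub_eq_zero]
    ext a d
    have hdec : RHPDecay 1 fun s =>
        (-(toC S.C * toC S.A * resolv (toC S.A) s * (toC S.A ^ i * toC S.B)) a d) +
          ∑ k, (lam k * lam k ^ i * (c k a * b k d)) * (s - lam k)⁻¹ :=
      (hA.decay_bilin _ _ a d).neg.add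
        (RHPDecay.sum _ fun k _ => (RHPDecay.inv_sub (hlam k)).const_mul _)
    refine hdec.eq_zero_of_const fun s hs => ?_
    have h1 := congrArg (fun M => s • M) (hi s hs)
    have h2 : toC S.C * toC S.A * resolv (toC S.A) s * (toC S.A ^ i * toC S.B) =
        s • (toC S.C * resolv (toC S.A) s * (toC S.A ^ i * toC S.B)) -
          toC S.C * toC S.A ^ i * toC S.B := by
      rw [Matrix.mul_assoc (toC S.C), self_mul_resolv (hA s hs), Matrix.mul_sub, Matrix.sub_mul,
        Matrix.mul_smul, Matrix.smul_mul, Matrix.mul_one, Matrix.mul_assoc (toC S.C) (toC S.A ^ i)]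
    rw [h2, h1]
    simp only [Matrix.sub_apply, Matrix.smul_apply, Matrix.sum_apply, Matrix.vecMulVec_apply,
      smul_eq_mul, Finset.mul_sum]
    rw [neg_sub, sub_add, ← Finset.sum_sub_distrib]
    congr 1
    refine Finset.sum_congr rfl fun k _ => ?_
    have := RHPDecay.sub_ne_zero (hlam k) hs
    field_simp
  refine step i ?_
  induction i with
  | zero =>
    intro s hs
    have h1 := eq_poleSum_of_re_nonneg h hlam (transfer_decay hE hS) hs
    rw [transfer_eq hE, poleSum, add_left_inj] at h1
    simpa using h1
  | succ i ih =>
    intro s hs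
    have h1 := congrArg (fun M => s • M) (ih s hs)
    have h2 : toC S.C * resolv (toC S.A) s * (toC S.A ^ (i + 1) * toC S.B) =
        s • (toC S.C * resolv (toC S.A) s * (toC S.A ^ i * toC S.B)) -
          toC S.C * toC S.A ^ i * toC S.B := by
      rw [pow_succ', Matrix.mul_assoc (toC S.A), ← Matrix.mul_assoc _ (toC S.A),
        Matrix.mul_assoc (toC S.C) _ (toC S.A), resolv_mul_self (hA s hs), Matrix.mul_sub,
        Matrix.sub_mul, Matrix.mul_smul, Matrix.smul_mul, Matrix.mul_one,
        Matrix.mul_assoc (toC S.C) (toC S.A ^ i)]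
    rw [h2, h1, step i ih, Finset.smul_sum, ← Finset.sum_sub_distrib]
    refine Finset.sum_congr rfl fun k _ => ?_
    rw [smul_smul, ← sub_smul]
    congr 1
    have := RHPDecay.sub_ne_zero (hlam k) hs
    field_simp
    ring

/-- A system whose pole-residue form has a vanishing term is not minimal. -/
theorem reachable_ne_top_or (hE : S.E = 1) (hS : S.IsStable) (hlam : ∀ k, (lam k).re < 0)
    (h : HasPoleResidueForm S.transfer lam c b S.D) {k₀ : Fin r}
    (hk₀ : Matrix.vecMulVec (c k₀) (b k₀) = 0) :
    reachable S.A S.B ≠ ⊤ ∨ reachable S.Aᵀ S.Cᵀ ≠ ⊤ := by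
  by_contra hcon
  push Not at hcon
  obtain ⟨hR, hO⟩ := hcon
  -- O is the observability map, injective when the dual pair is reachable. Ψ is built from the r -
  -- 1 terms other than k₀. On reachable vectors O takes values in the range of Ψ, so reachability
  -- and observability together would give r ≤ r - 1.
  set O : (Fin r → ℂ) →ₗ[ℂ] (ℕ → Fin p → ℂ) :=
    LinearMap.pi fun i => Matrix.mulVecLin (toC S.C * toC S.A ^ i) with hOdef
  have hOx : ∀ x i, O x i = (toC S.C * toC S.A ^ i) *ᵥ x := fun _ _ => rfl
  set Ψ : ({l // l ≠ k₀} → ℂ) →ₗ[ℂ] (ℕ → Fin p → ℂ) :=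
    ∑ l : {l // l ≠ k₀}, (LinearMap.proj l).smulRight fun i => lam l ^ i • c l with hΨdef
  have hΨ : ∀ z i, Ψ z i = ∑ l : {l // l ≠ k₀}, z l • (lam l ^ i • c l) := by
    intro z i
    simp [hΨdef, LinearMap.sum_apply, Finset.sum_apply]
  have hinj : Function.Injective O := by
    rw [← LinearMap.ker_eq_bot, LinearMap.ker_eq_bot']
    intro x hx
    have hall : ∀ w ∈ reachable S.Aᵀ S.Cᵀ, ∑ j, (w j : ℂ) * x j = 0 := by
      intro w hw
      induction hw using Submodule.span_induction with
      | mem w hw =>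
        obtain ⟨k, y, rfl⟩ := hw
        have h1 : (toC S.C * toC S.A ^ k) *ᵥ x = 0 := by rw [← hOx, hx]; rfl
        have h2 : (fun j => (((S.Aᵀ ^ k * S.Cᵀ) *ᵥ y) j : ℂ)) =
            (fun j => (y j : ℂ)) ᵥ* (toC S.C * toC S.A ^ k) := by
          have h3 : toC S.C * toC S.A ^ k = toC (S.C * S.A ^ k) := by
            rw [toC_mul, show toC (S.A ^ k) = toC S.A ^ k from
              map_pow (Complex.ofRealHom.mapMatrix) S.A k]
          rw [← Matrix.transpose_pow, ← Matrix.transpose_mul, Matrix.mulVec_transpose, h3]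
          funext j
          simp [Matrix.vecMul, dotProduct]
        have h4 : ∑ j, (((S.Aᵀ ^ k * S.Cᵀ) *ᵥ y) j : ℂ) * x j =
            (fun j => (((S.Aᵀ ^ k * S.Cᵀ) *ᵥ y) j : ℂ)) ⬝ᵥ x := rfl
        rw [h4, h2, ← Matrix.dotProduct_mulVec, h1, dotProduct_zero]
      | zero => simp
      | add w w' _ _ hw hw' =>
        simp only [Pi.add_apply, Complex.ofReal_add, add_mul, Finset.sum_add_distrib, hw, hw',
          add_zero]
      | smul a w _ hw =>
        simp only [Pi.smul_apply, smul_eq_mul, Complex.ofReal_mul, mul_assoc, ← Finset.mul_sum, hw,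
          mul_zero]
    funext j
    have := hall (Pi.single j 1) (hO ▸ Submodule.mem_top)
    simpa [Pi.single_apply, apply_ite Complex.ofReal] using this
  have hreal : ∀ w ∈ reachable S.A S.B, O (fun j => (w j : ℂ)) ∈ LinearMap.range Ψ := by
    intro w hw
    induction hw using Submodule.span_induction with
    | mem w hw =>
      obtain ⟨k, y, rfl⟩ := hw
      refine ⟨fun l => lam l ^ k * (b l ⬝ᵥ fun j => (y j : ℂ)), ?_⟩
      funext i
      have h2 : (fun j => (((S.A ^ k * S.B) *ᵥ y) j : ℂ)) =
          (toC S.A ^ k * toC S.B) *ᵥ (fun j => (y j : ℂ)) := by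
        rw [← show toC (S.A ^ k) = toC S.A ^ k from
            map_pow (Complex.ofRealHom.mapMatrix) S.A k, ← toC_mul]
        funext j
        simp [Matrix.mulVec, dotProduct]
      rw [hOx, h2, Matrix.mulVec_mulVec, ← Matrix.mul_assoc, Matrix.mul_assoc (toC S.C), ← pow_add,
        markov_eq_sum hE hS hlam h, Matrix.sum_mulVec, hΨ]
      rw [Fintype.sum_eq_add_sum_subtype_ne _ k₀, hk₀, smul_zero, Matrix.zero_mulVec, zero_add]
      refine Finset.sum_congr rfl fun l _ => ?_
      rw [Matrix.smul_mulVec, Matrix.vecMulVec_mulVec, smul_smul]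
      ext a
      simp only [Pi.smul_apply, smul_eq_mul, MulOpposite.smul_eq_mul_unop, MulOpposite.unop_op]
      ring
    | zero =>
      have : (fun j => (((0 : Fin r → ℝ) j : ℝ) : ℂ)) = 0 := by funext j; simp
      rw [this, map_zero]
      exact Submodule.zero_mem _
    | add w w' _ _ hw hw' =>
      have : (fun j => (((w + w') j : ℝ) : ℂ)) = (fun j => (w j : ℂ)) + fun j => (w' j : ℂ) := by
        funext j
        simp
      rw [this, map_add]
      exact Submodule.add_mem _ hw hw'
    | smul a w _ hw =>
      have : (fun j => (((a • w) j : ℝ) : ℂ)) = (a : ℂ) • fun j => (w j : ℂ) := by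
        funext j
        simp
      rw [this, map_smul]
      exact Submodule.smul_mem _ _ hw
  have hle : LinearMap.range O ≤ LinearMap.range Ψ := by
    rintro _ ⟨x, rfl⟩
    rw [LinearMap.pi_apply_eq_sum_univ O x]
    refine Submodule.sum_mem _ fun j _ => Submodule.smul_mem _ _ ?_
    have h1 := hreal (Pi.single j 1) (hR ▸ Submodule.mem_top)
    convert h1 using 2
    funext k
    by_cases hk : j = k
    · subst hk; simp
    · simp [hk, Ne.symm hk]
  have h1 := Submodule.finrank_mono hle
  have h2 : Module.finrank ℂ (LinearMap.range O) = r := by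
    rw [LinearMap.finrank_range_of_inj hinj]
    simp
  have h3 : Module.finrank ℂ (LinearMap.range Ψ) ≤ r - 1 := by
    refine (LinearMap.finrank_range_le Ψ).trans (le_of_eq ?_)
    simp
  have h4 : 0 < r := k₀.pos
  omega

end Markov

/-- If the pole-residue form of a stable system has a vanishing term, then the system has a
realization of the same order whose transfer function can be moved in the direction of any
first-order system with a real pole. -/
theorem exists_realization_variation {S : LTISystem r m p} {lam : Fin r → ℂ}
    {c : Fin r → Fin p → ℂ} {b : Fin r → Fin m → ℂ} (hE : S.E = 1) (hS : S.IsStable)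
    (hlam : ∀ k, (lam k).re < 0) (h : HasPoleResidueForm S.transfer lam c b S.D) {k₀ : Fin r}
    (hk₀ : Matrix.vecMulVec (c k₀) (b k₀) = 0) {μ : ℝ} (hμ : μ < 0) (u : Fin p → ℝ)
    (v : Fin m → ℝ) :
    ∃ S' : LTISystem r m p, S'.E = 1 ∧ S'.IsStable ∧ S'.D = S.D ∧
      (∀ s : ℂ, 0 ≤ s.re → S'.transfer s = S.transfer s) ∧
      ∃ (B₁ : Matrix (Fin r) (Fin m) ℝ) (C₁ : Matrix (Fin p) (Fin r) ℝ), ∀ s : ℂ, 0 ≤ s.re →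
        S'.variation 0 (toC B₁) (toC C₁) 0 s = (s - μ)⁻¹ • toC (Matrix.vecMulVec u v) := by
  have hA := (isStable_iff hE).1 hS
  rcases reachable_ne_top_or hE hS hlam h hk₀ with hR | hO
  · obtain ⟨A', B₁, C', hA', h'⟩ := exists_decoupled hA hR S.C hμ u v
    set S' : LTISystem r m p := ⟨1, A', S.B, C', S.D⟩ with hS'
    have hE' : S'.E = 1 := rfl
    refine ⟨S', hE', (isStable_iff hE').2 hA', rfl, fun s hs => ?_, B₁, 0, fun s hs => ?_⟩
    · rw [transfer_eq hE', transfer_eq hE, ← (h' s hs).1]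
    · rw [← (h' s hs).2]
      simp [variation, transferVariation, hS']
  -- The unobservable case is the unreachable case of the dual system, with u and v, and input and
  -- output, interchanged.
  · have hAt : Hurwitz (toC S.Aᵀ) := hA.transpose
    obtain ⟨A', B₁, C', hA', h'⟩ := exists_decoupled hAt hO S.Bᵀ hμ v u
    set S' : LTISystem r m p := ⟨1, A'ᵀ, C'ᵀ, S.C, S.D⟩ with hS'
    have hE' : S'.E = 1 := rfl
    refine ⟨S', hE', (isStable_iff hE').2 hA'.transpose, rfl, fun s hs => ?_, 0, B₁ᵀ,
      fun s hs => ?_⟩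
    · rw [transfer_eq hE', transfer_eq hE]
      congr 1
      have h1 := congrArg Matrix.transpose (h' s hs).1
      rw [toC_transpose S.A, resolv_transpose] at h1
      simp only [Matrix.transpose_mul, Matrix.transpose_transpose, toC_transpose] at h1
      rw [show toC S'.A = (toC A')ᵀ from rfl, resolv_transpose]
      simp only [← Matrix.mul_assoc] at h1
      exact h1
    · have h1 := congrArg Matrix.transpose (h' s hs).2
      rw [Matrix.transpose_smul, ← toC_transpose, Matrix.transpose_vecMulVec] at h1
      rw [← h1]
      simp only [variation, transferVariation, toC_zero, Matrix.mul_zero, Matrix.zero_mul, add_zero]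
      rw [show toC S'.A = (toC A')ᵀ from rfl, resolv_transpose]
      simp only [Matrix.transpose_mul, toC_transpose, Matrix.mul_assoc]
      rfl

end LTISystem

/-! ### Eigenvector directions and interpolation conditions. -/

namespace LTISystem

variable {m p r : ℕ}

section Eigen

variable {ι : Type*} [Fintype ι] [DecidableEq ι]

theorem resolv_mulVec_of_eigenvector {A : Matrix ι ι ℂ} {s lam : ℂ} (h : (s • 1 - A).det ≠ 0)
    (hs : s - lam ≠ 0) {x : ι → ℂ} (hx : A *ᵥ x = lam • x) :
    resolv A s *ᵥ x = (s - lam)⁻¹ • x := by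
  have h1 : (s • 1 - A) *ᵥ x = (s - lam) • x := by
    rw [Matrix.sub_mulVec, Matrix.smul_mulVec, Matrix.one_mulVec, hx, sub_smul]
  have h2 := congrArg (fun z => (s - lam)⁻¹ • (resolv A s *ᵥ z)) h1
  simp only [Matrix.mulVec_mulVec, resolv_mul h, Matrix.one_mulVec, Matrix.mulVec_smul, smul_smul,
    inv_mul_cancel₀ hs, one_smul] at h2
  exact h2.symm

theorem vecMul_resolv_of_eigenvector {A : Matrix ι ι ℂ} {s lam : ℂ} (h : (s • 1 - A).det ≠ 0)
    (hs : s - lam ≠ 0) {y : ι → ℂ} (hy : y ᵥ* A = lam • y) :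
    y ᵥ* resolv A s = (s - lam)⁻¹ • y := by
  have h1 : y ᵥ* (s • 1 - A) = (s - lam) • y := by
    rw [Matrix.vecMul_sub, Matrix.vecMul_smul, Matrix.vecMul_one, hy, sub_smul]
  have h2 := congrArg (fun z => (s - lam)⁻¹ • (z ᵥ* resolv A s)) h1
  simp only [Matrix.vecMul_vecMul, mul_resolv h, Matrix.vecMul_one, Matrix.smul_vecMul, smul_smul,
    inv_mul_cancel₀ hs, one_smul] at h2
  exact h2.symm

/-- Left and right eigenvectors of a matrix with a full set of distinct eigenvalues. -/
theorem exists_dual_eigenvectors {A : Matrix ι ι ℂ} {lam : ι → ℂ} (hinj : Function.Injective lam)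
    (hdet : ∀ k, (lam k • 1 - A).det = 0) :
    ∃ x y : ι → ι → ℂ, (∀ k, A *ᵥ x k = lam k • x k) ∧ (∀ k, y k ᵥ* A = lam k • y k) ∧
      ∑ k, Matrix.vecMulVec (x k) (y k) = 1 := by
  choose x hx0 hx using fun k => Matrix.exists_mulVec_eq_zero_iff.2 (hdet k)
  have hx' : ∀ k, A *ᵥ x k = lam k • x k := fun k => by
    have := hx k
    rw [Matrix.sub_mulVec, Matrix.smul_mulVec, Matrix.one_mulVec, sub_eq_zero] at this
    exact this.symm
  have hlin : LinearIndependent ℂ x :=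
    Module.End.eigenvectors_linearIndependent' (Matrix.toLin' A) lam hinj x fun k =>
      ⟨Module.End.mem_eigenspace_iff.2 (by rw [Matrix.toLin'_apply, hx' k]), hx0 k⟩
  -- The columns of V are the right eigenvectors; the rows of its inverse are the dual left ones.
  set V : Matrix ι ι ℂ := Matrix.of fun i j => x j i with hV
  have hcol : V.col = x := rfl
  have hunit : IsUnit V := Matrix.linearIndependent_cols_iff_isUnit.1 (by rw [hcol]; exact hlin)
  have hVdet : IsUnit V.det := (Matrix.isUnit_iff_isUnit_det V).1 hunit
  have hAV : A * V = V * Matrix.diagonal lam := by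
    ext i j
    rw [Matrix.mul_diagonal]
    have := congrFun (hx' j) i
    rw [Pi.smul_apply, smul_eq_mul, mul_comm] at this
    exact this
  have hVA : V⁻¹ * A = Matrix.diagonal lam * V⁻¹ := by
    calc V⁻¹ * A = V⁻¹ * (A * V) * V⁻¹ := by
          rw [mul_assoc, mul_assoc, Matrix.mul_nonsing_inv _ hVdet, mul_one]
      _ = _ := by rw [hAV, ← mul_assoc, Matrix.nonsing_inv_mul _ hVdet, one_mul]
  refine ⟨x, fun k => V⁻¹ k, hx', fun k => ?_, ?_⟩
  · funext j
    have := congrFun (congrFun hVA k) j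
    rw [Matrix.diagonal_mul] at this
    exact this
  · rw [← Matrix.mul_nonsing_inv _ hVdet]
    ext i j
    rw [Matrix.sum_apply, Matrix.mul_apply]
    rfl

theorem resolv_eq_sum {A : Matrix ι ι ℂ} {lam : ι → ℂ} {x y : ι → ι → ℂ}
    (hx : ∀ k, A *ᵥ x k = lam k • x k) (hxy : ∑ k, Matrix.vecMulVec (x k) (y k) = 1) {s : ℂ}
    (hs : ∀ k, s - lam k ≠ 0) :
    resolv A s = ∑ k, (s - lam k)⁻¹ • Matrix.vecMulVec (x k) (y k) := by
  refine Matrix.inv_eq_right_inv ?_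
  rw [Matrix.mul_sum, ← hxy]
  refine Finset.sum_congr rfl fun k _ => ?_
  rw [hxy, Matrix.mul_smul, Matrix.mul_vecMulVec, Matrix.sub_mulVec, Matrix.smul_mulVec,
    Matrix.one_mulVec, hx, ← sub_smul, Matrix.smul_vecMulVec, smul_smul, inv_mul_cancel₀ (hs k),
    one_smul]

end Eigen

section Residues

variable {S : LTISystem r m p} {lam : Fin r → ℂ} {c : Fin r → Fin p → ℂ} {b : Fin r → Fin m → ℂ}

/-- Every pole with nonzero residue is an eigenvalue of the state matrix. -/
theorem det_eq_zero_of_residue_ne_zero (hE : S.E = 1) (hinj : Function.Injective lam)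
    (h : HasPoleResidueForm S.transfer lam c b S.D) {k : Fin r}
    (hk : Matrix.vecMulVec (c k) (b k) ≠ 0) : (lam k • 1 - toC S.A).det = 0 := by
  by_contra hdet
  refine hk ?_
  have hc : ∀ i j, ContinuousAt (fun s => S.transfer s i j) (lam k) := by
    intro i j
    simp only [transfer_eq hE, Matrix.add_apply, Matrix.mul_apply]
    refine ContinuousAt.add (tendsto_finsetSum _ fun l _ => ContinuousAt.mul
      (tendsto_finsetSum _ fun l' _ => ContinuousAt.mul continuousAt_const
        (analyticAt_resolv hdet _ _).continuousAt) continuousAt_const) continuousAt_const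
  rw [← sum_residue_eq_zero h hc, Finset.sum_eq_single k (fun l _ hl => if_neg fun hc =>
    hl (hinj hc)) (by simp), if_pos rfl]

/-- A nonzero rank-one matrix determines its two factors up to scalars. -/
theorem exists_smul_of_vecMulVec_eq {α β : Type*} {u u' : α → ℂ} {v v' : β → ℂ}
    (h : Matrix.vecMulVec u v = Matrix.vecMulVec u' v') (hne : Matrix.vecMulVec u v ≠ 0) :
    (∃ a : ℂ, u = a • u') ∧ ∃ a : ℂ, v = a • v' := by
  have hij : ∀ i j, u i * v j = u' i * v' j := fun i j => by
    simpa [Matrix.vecMulVec_apply] using congrFun (congrFun h i) j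
  obtain ⟨i₀, j₀, h0⟩ : ∃ i j, u i * v j ≠ 0 := by
    by_contra hc
    push Not at hc
    exact hne (Matrix.ext fun i j => by simpa [Matrix.vecMulVec_apply] using hc i j)
  obtain ⟨hu, hv⟩ := mul_ne_zero_iff.1 h0
  refine ⟨⟨v' j₀ / v j₀, funext fun i => ?_⟩, ⟨u' i₀ / u i₀, funext fun j => ?_⟩⟩
  · rw [Pi.smul_apply, smul_eq_mul, div_mul_eq_mul_div, eq_div_iff hv, hij, mul_comm]
  · rw [Pi.smul_apply, smul_eq_mul, div_mul_eq_mul_div, eq_div_iff hu, ← hij, mul_comm]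

/-- If no term of the pole-residue form vanishes, the residue factors are images of eigenvectors. -/
theorem exists_eigenvectors_of_residues (hE : S.E = 1) (hinj : Function.Injective lam)
    (h : HasPoleResidueForm S.transfer lam c b S.D)
    (hne : ∀ k, Matrix.vecMulVec (c k) (b k) ≠ 0) (k : Fin r) :
    ∃ x y : Fin r → ℂ, toC S.A *ᵥ x = lam k • x ∧ y ᵥ* toC S.A = lam k • y ∧
      (∃ a : ℂ, c k = a • (toC S.C *ᵥ x)) ∧ ∃ a : ℂ, b k = a • (y ᵥ* toC S.B) := by
  obtain ⟨x, y, hx, hy, hxy⟩ := exists_dual_eigenvectors hinj fun k =>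
    det_eq_zero_of_residue_ne_zero hE hinj h (hne k)
  refine ⟨x k, y k, hx k, hy k, exists_smul_of_vecMulVec_eq ?_ (hne k)⟩
  have hform : ∀ s, (∀ k, s - lam k ≠ 0) → S.transfer s =
      poleSum lam (fun k => toC S.C *ᵥ x k) (fun k => y k ᵥ* toC S.B) S.D s := by
    intro s hs
    rw [transfer_eq hE, resolv_eq_sum hx hxy hs, poleSum, Matrix.mul_sum, Matrix.sum_mul]
    simp only [Matrix.mul_smul, Matrix.smul_mul, Matrix.mul_vecMulVec, Matrix.vecMulVec_mul]
  have hev : ∀ᶠ s in 𝓝[≠] lam k, ∀ l, s - lam l ≠ 0 := by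
    rw [Filter.eventually_all]
    intro l
    have h1 : ∀ᶠ s in Filter.cofinite, s - lam l ≠ 0 :=
      (Set.finite_singleton (lam l)).subset fun z hz => by
        simpa using sub_eq_zero.1 (not_not.1 hz)
    exact eventually_nhdsNE_of_cofinite h1 _
  ext i j
  -- The difference of the given and the spectral expansion is the zero function; its residue at λ_k
  -- must vanish.
  have h0 := _root_.sum_residue_eq_zero (φ := fun _ => 0) (z₀ := lam k) continuousAt_const lam
    (fun l => c l i * b l j - (toC S.C *ᵥ x l) i * (y l ᵥ* toC S.B) j) 0 (by
      filter_upwards [hev, eventually_nhdsNE_of_cofinite h (lam k)] with s hs1 hs2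
      have h3 := congrFun (congrFun ((show S.transfer s = poleSum lam c b S.D s from hs2).symm.trans
        (hform s hs1)) i) j
      rw [poleSum_apply, poleSum_apply, add_left_inj] at h3
      simp only [mul_sub, Finset.sum_sub_distrib, h3, sub_self, add_zero])
  rw [Finset.sum_eq_single k (fun l _ hl => if_neg fun hc => hl (hinj hc)) (by simp),
    if_pos rfl, sub_eq_zero] at h0
  simpa [Matrix.vecMulVec_apply] using h0

/-- Interpolation conditions at the reflected poles of a stationary system all of whose residues
are nonzero. -/
theorem interpolation_of_axisPairing_eq_zero (hE : S.E = 1) (hS : S.IsStable)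
    (hinj : Function.Injective lam) (hlam : ∀ k, (lam k).re < 0)
    (h : HasPoleResidueForm S.transfer lam c b S.D)
    (hne : ∀ k, Matrix.vecMulVec (c k) (b k) ≠ 0) {Δ : ℂ → Matrix (Fin p) (Fin m) ℂ}
    (hΔ : MatRHPDecay 1 Δ) (hpair : ∀ A₁ B₁ C₁, axisPairing Δ (S.variation A₁ B₁ C₁ 0) = 0)
    (k : Fin r) :
    Δ (-lam k) *ᵥ b k = 0 ∧ c k ᵥ* Δ (-lam k) = 0 ∧
      deriv (fun s => c k ⬝ᵥ (Δ s *ᵥ b k)) (-lam k) = 0 := by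
  obtain ⟨x, y, hx, hy, ⟨a, ha⟩, ⟨a', ha'⟩⟩ := exists_eigenvectors_of_residues hE hinj h hne k
  have hA := (isStable_iff hE).1 hS
  have hYx : ∀ s : ℂ, 0 ≤ s.re → resolv (toC S.A) s *ᵥ x = (s - lam k)⁻¹ • x := fun s hs =>
    resolv_mulVec_of_eigenvector (hA s hs) (RHPDecay.sub_ne_zero (hlam k) hs) hx
  have hyY : ∀ s : ℂ, 0 ≤ s.re → y ᵥ* resolv (toC S.A) s = (s - lam k)⁻¹ • y := fun s hs =>
    vecMul_resolv_of_eigenvector (hA s hs) (RHPDecay.sub_ne_zero (hlam k) hs) hy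
  -- Varying C along u yᵀ gives the simple pole u (yᵀB)/(s - λ_k).
  have h1 : ∀ u : Fin p → ℂ, u ⬝ᵥ (Δ (-lam k) *ᵥ b k) = 0 := by
    intro u
    have h2 : u ⬝ᵥ (Δ (-lam k) *ᵥ (y ᵥ* toC S.B)) = 0 := by
      refine bilin_eq_zero_of_axisPairing hΔ (hlam k) ?_
      rw [← hpair 0 0 (Matrix.vecMulVec u y)]
      refine axisPairing_congr Δ fun s hs => ?_
      simp only [variation, transferVariation, Matrix.mul_zero, Matrix.zero_mul, add_zero,
        Matrix.vecMulVec_mul, hyY s hs, Matrix.vecMulVec_smul, Matrix.smul_mul]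
    rw [ha', Matrix.mulVec_smul, dotProduct_smul, h2, smul_zero]
  -- Varying B along x vᵀ gives (Cx) vᵀ/(s - λ_k).
  have h3 : ∀ v : Fin m → ℂ, c k ⬝ᵥ (Δ (-lam k) *ᵥ v) = 0 := by
    intro v
    have h2 : (toC S.C *ᵥ x) ⬝ᵥ (Δ (-lam k) *ᵥ v) = 0 := by
      refine bilin_eq_zero_of_axisPairing hΔ (hlam k) ?_
      rw [← hpair 0 (Matrix.vecMulVec x v) 0]
      refine axisPairing_congr Δ fun s hs => ?_
      simp only [variation, transferVariation, Matrix.mul_zero, Matrix.zero_mul, add_zero, zero_add,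
        Matrix.mul_vecMulVec, ← Matrix.mulVec_mulVec, hYx s hs, Matrix.mulVec_smul,
        Matrix.smul_vecMulVec]
    rw [ha, smul_dotProduct, h2, smul_zero]
  refine ⟨funext fun i => ?_, funext fun j => ?_, ?_⟩
  · simpa using h1 (Pi.single i 1)
  · have := h3 (Pi.single j 1)
    rw [Matrix.dotProduct_mulVec] at this
    simpa using this
  · have h4 : deriv (fun s => (toC S.C *ᵥ x) ⬝ᵥ (Δ s *ᵥ (y ᵥ* toC S.B))) (-lam k) = 0 := by
      refine deriv_bilin_eq_zero_of_axisPairing hΔ (hlam k) ?_ ?_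
      · refine bilin_eq_zero_of_axisPairing hΔ (hlam k) ?_
        rw [← hpair 0 0 (Matrix.vecMulVec (toC S.C *ᵥ x) y)]
        refine axisPairing_congr Δ fun s hs => ?_
        simp only [variation, transferVariation, Matrix.mul_zero, Matrix.zero_mul, add_zero,
          Matrix.vecMulVec_mul, hyY s hs, Matrix.vecMulVec_smul, Matrix.smul_mul]
      -- Varying A along x yᵀ moves the pole and gives the double pole.
      · rw [← hpair (Matrix.vecMulVec x y) 0 0]
        refine axisPairing_congr Δ fun s hs => ?_
        simp only [variation, transferVariation, Matrix.mul_zero, Matrix.zero_mul, add_zero,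
          zero_add, Matrix.mul_vecMulVec, ← Matrix.mulVec_mulVec, hYx s hs, Matrix.mulVec_smul,
          Matrix.smul_vecMulVec, Matrix.smul_mul, Matrix.vecMulVec_mul, hyY s hs,
          Matrix.vecMulVec_smul, smul_smul, pow_two]
    have h5 : (fun s => c k ⬝ᵥ (Δ s *ᵥ b k)) =
        fun s => (a * a') * ((toC S.C *ᵥ x) ⬝ᵥ (Δ s *ᵥ (y ᵥ* toC S.B))) := by
      funext s
      rw [ha, ha', Matrix.mulVec_smul, dotProduct_smul, smul_dotProduct, smul_eq_mul, smul_eq_mul]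
      ring
    rw [h5, deriv_const_mul_field, h4, mul_zero]

end Residues

end LTISystem

/-! ### The two cases combined; conclusion. -/

namespace LTISystem

variable {n m p q r nw : ℕ} {W : LTISystem nw q m} {H : LTISystem n m p} {S : LTISystem r m p}
  {γ : Fin nw → ℂ} {e : Fin nw → Fin m → ℂ} {f : Fin nw → Fin q → ℂ}

/-- The weighted norm sees a system only through its transfer function on the imaginary axis, so
another realization of the same order is equally optimal. -/
theorem IsMinimizer.congr {S' : LTISystem r m p} (h : IsMinimizer W H S)
    (hS' : ∀ s : ℂ, 0 ≤ s.re → S'.transfer s = S.transfer s) : IsMinimizer W H S' := by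
  intro T hT
  refine h2Norm_le_iff.2 (le_of_eq_of_le ?_ (h2Norm_le_iff.1 (h T hT)))
  refine MeasureTheory.lintegral_congr fun ω => ?_
  beta_reduce
  rw [hS' _ (by simp)]

/-- If the pole-residue form of a minimizer has a vanishing term, the difference of the transformed
maps vanishes identically. -/
theorem weightMap_difference_eq_zero (hWE : W.E = 1) (hW : W.IsStable) (hHE : H.E = 1)
    (hH : H.IsStable) (hSE : S.E = 1) (hS : S.IsStable) (hHD : H.D * W.D = 0)
    (hSD : S.D * W.D = 0) (hmin : IsMinimizer W H S) (hγ : ∀ k, (γ k).re < 0)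
    (hWpr : HasPoleResidueForm W.transfer γ e f W.D)
    {Δ : ℂ → Matrix (Fin p) (Fin m) ℂ} (hΔ : MatRHPDecay 1 Δ)
    (h : ∀ s : ℂ, 0 ≤ s.re → (∀ k, s + γ k ≠ 0) →
        Δ s = weightedError W H S s * (poleSum γ e f W.D (-s))ᵀ +
          ∑ k, (s + γ k)⁻¹ • (weightedError W H S (-γ k) * Matrix.vecMulVec (f k) (e k)))
    {lam : Fin r → ℂ} {c : Fin r → Fin p → ℂ} {b : Fin r → Fin m → ℂ}
    (hlam : ∀ k, (lam k).re < 0) (hSpr : HasPoleResidueForm S.transfer lam c b S.D) {k₀ : Fin r}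
    (hk₀ : Matrix.vecMulVec (c k₀) (b k₀) = 0) {s : ℂ} (hs : 0 < s.re) : Δ s = 0 := by
  -- A spare direction with pole -t evaluates each entry of Δ at t.
  have hreal : ∀ (t : ℝ), 0 < t → ∀ i j, Δ t i j = 0 := by
    intro t ht i j
    obtain ⟨S', hE', hS', hD', htr, B₁, C₁, hvar⟩ := exists_realization_variation hSE hS hlam hSpr
      hk₀ (neg_lt_zero.2 ht) (Pi.single i 1) (Pi.single j 1)
    have herr : ∀ z : ℂ, 0 ≤ z.re → weightedError W H S' z = weightedError W H S z := by
      intro z hz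
      rw [weightedError, weightedError, htr z hz]
    have h1 := axisPairing_variation_eq_zero hWE hW hHE hH hE' hS' hHD (hD' ▸ hSD)
      (hmin.congr htr) hγ hWpr hΔ (fun z hz hne => by
        rw [h z hz hne, herr z hz]
        simp only [fun k => herr (-γ k) (by simpa using (hγ k).le)]) 0 (toC B₁) (toC C₁)
    rw [axisPairing_congr Δ hvar] at h1
    have h2 : toC (Matrix.vecMulVec (Pi.single i 1 : Fin p → ℝ) (Pi.single j 1 : Fin m → ℝ)) =
        Matrix.vecMulVec (Pi.single i 1) (Pi.single j 1) := by
      ext a d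
      simp [Matrix.vecMulVec_apply, Pi.single_apply, apply_ite Complex.ofReal]
    rw [h2] at h1
    simpa using bilin_eq_zero_of_axisPairing hΔ (by simpa using ht) h1
  ext i j
  -- The zeros on the real axis accumulate at 1, so the identity theorem applies on the half plane.
  have hfreq : ∃ᶠ z in 𝓝[≠] (1 : ℂ), Δ z i j = 0 := by
    have h1 : Filter.Tendsto (fun t : ℝ => (t : ℂ)) (𝓝[>] 1) (𝓝[≠] 1) := by
      refine tendsto_nhdsWithin_iff.2 ⟨?_, ?_⟩
      · exact (Complex.continuous_ofReal.tendsto' 1 1 (by simp)).mono_left nhdsWithin_le_nhds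
      · filter_upwards [self_mem_nhdsWithin] with t ht
        simpa using (ne_of_gt ht)
    refine h1.frequently (Filter.Eventually.frequently ?_)
    filter_upwards [self_mem_nhdsWithin] with t ht
    exact hreal t (zero_lt_one.trans ht) i j
  exact AnalyticOnNhd.eqOn_zero_of_preconnected_of_frequently_eq_zero (U := {z : ℂ | 0 < z.re})
    (fun z hz => (hΔ i j).analyticAt z (le_of_lt hz))
    (convex_halfSpace_re_gt 0).isPreconnected (show (0 : ℝ) < (1 : ℂ).re by simp) hfreq hs

/-- Interpolation conditions for a minimizer, in terms of the difference of the transformed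
maps. -/
theorem weightMap_difference_interpolation (hWE : W.E = 1) (hW : W.IsStable) (hHE : H.E = 1)
    (hH : H.IsStable) (hSE : S.E = 1) (hS : S.IsStable) (hHD : H.D * W.D = 0)
    (hSD : S.D * W.D = 0) (hmin : IsMinimizer W H S) (hγ : ∀ k, (γ k).re < 0)
    (hWpr : HasPoleResidueForm W.transfer γ e f W.D)
    {Δ : ℂ → Matrix (Fin p) (Fin m) ℂ} (hΔ : MatRHPDecay 1 Δ)
    (h : ∀ s : ℂ, 0 ≤ s.re → (∀ k, s + γ k ≠ 0) →
        Δ s = weightedError W H S s * (poleSum γ e f W.D (-s))ᵀ +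
          ∑ k, (s + γ k)⁻¹ • (weightedError W H S (-γ k) * Matrix.vecMulVec (f k) (e k)))
    {lam : Fin r → ℂ} {c : Fin r → Fin p → ℂ} {b : Fin r → Fin m → ℂ}
    (hinj : Function.Injective lam) (hlam : ∀ k, (lam k).re < 0)
    (hSpr : HasPoleResidueForm S.transfer lam c b S.D) (k : Fin r) :
    Δ (-lam k) *ᵥ b k = 0 ∧ c k ᵥ* Δ (-lam k) = 0 ∧
      deriv (fun s => c k ⬝ᵥ (Δ s *ᵥ b k)) (-lam k) = 0 := by
  by_cases hne : ∀ k, Matrix.vecMulVec (c k) (b k) ≠ 0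
  · exact interpolation_of_axisPairing_eq_zero hSE hS hinj hlam hSpr hne hΔ
      (axisPairing_variation_eq_zero hWE hW hHE hH hSE hS hHD hSD hmin hγ hWpr hΔ h) k
  · push Not at hne
    obtain ⟨k₀, hk₀⟩ := hne
    have h0 : ∀ s : ℂ, 0 < s.re → Δ s = 0 := fun s hs =>
      weightMap_difference_eq_zero hWE hW hHE hH hSE hS hHD hSD hmin hγ hWpr hΔ h hlam hSpr hk₀ hs
    have hre : 0 < (-lam k).re := by simpa using hlam k
    refine ⟨by rw [h0 _ hre, Matrix.zero_mulVec], by rw [h0 _ hre, Matrix.vecMul_zero], ?_⟩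
    have hev : (fun s => c k ⬝ᵥ (Δ s *ᵥ b k)) =ᶠ[𝓝 (-lam k)] fun _ => 0 := by
      filter_upwards [(isOpen_lt continuous_const Complex.continuous_re).mem_nhds hre] with s hs
      rw [h0 s hs, Matrix.zero_mulVec, dotProduct_zero]
    rw [hev.deriv_eq, deriv_const]

theorem hasDerivAt_bilin {G : ℂ → Matrix (Fin p) (Fin m) ℂ} {s : ℂ} (hG : MatAnalyticAt G s)
    (u : Fin p → ℂ) (v : Fin m → ℂ) :
    HasDerivAt (fun z => u ⬝ᵥ (G z *ᵥ v)) (u ⬝ᵥ (matDeriv G s *ᵥ v)) s := by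
  simp only [dotProduct, Matrix.mulVec, matDeriv, Matrix.of_apply]
  exact HasDerivAt.fun_sum fun i _ => (HasDerivAt.fun_sum fun j _ =>
    ((hG i j).differentiableAt.hasDerivAt.mul_const _)).const_mul _

theorem exists_isImpulseResponse_weightMap (hWE : W.E = 1) (hW : W.IsStable) (hHE : H.E = 1)
    (hH : H.IsStable) (hHD : H.D * W.D = 0) (hγ : ∀ k, (γ k).re < 0)
    (hWpr : HasPoleResidueForm W.transfer γ e f W.D) :
    ∃ F, IsImpulseResponse F (weightMap H.transfer W.transfer γ e f) := by
  obtain ⟨A, B, C, hA, h⟩ := exists_weightMap_realization hWE hW hHE hH hHD hγ e f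
  exact exists_isImpulseResponse_of_realization A B C fun s hs =>
    weightMap_eq_of_realization hWpr hA h hs

end LTISystem

/-- The initial value theorem for the Laplace transform, applied to a vector. -/
theorem IsImpulseResponse.tendsto_mul_mulVec {p m : ℕ} {F : ℝ → Matrix (Fin p) (Fin m) ℂ}
    {G : ℂ → Matrix (Fin p) (Fin m) ℂ} (h : IsImpulseResponse F G) (v : Fin m → ℂ) (i : Fin p) :
    Filter.Tendsto (fun t : ℝ => (t : ℂ) * (G t *ᵥ v) i) Filter.atTop (𝓝 ((F 0 *ᵥ v) i)) := by
  simp only [Matrix.mulVec, dotProduct, Finset.mul_sum, ← mul_assoc]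
  exact tendsto_finsetSum _ fun j _ => (h.tendsto_mul i j).mul_const _

theorem mainTheorem7 {n r nw m p q : ℕ}
    -- the stable weight `W`, with poles `γₖ` and residues `eₖ fₖᵀ`
    (W : LTISystem nw q m) (hW : W.IsStable)
    (γ : Fin nw → ℂ) (e : Fin nw → Fin m → ℂ) (f : Fin nw → Fin q → ℂ)
    (hWpr : HasPoleResidueForm W.transfer γ e f W.D)
    -- the full model
    (H : LTISystem n m p) (hH : MemWeightedH2 W.transfer H)
    -- the reduced model, with distinct stable poles `lamₖ` and residues `cₖ bₖᵀ`
    (Hr : LTISystem r m p) (hbest : IsBestWeightedH2Approx W.transfer H Hr)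
    (lam : Fin r → ℂ) (c : Fin r → Fin p → ℂ) (b : Fin r → Fin m → ℂ)
    (hlam : Function.Injective lam) (hlam_neg : ∀ k, (lam k).re < 0)
    (hHrpr : HasPoleResidueForm Hr.transfer lam c b Hr.D) :
    (∀ k : Fin r,
      MatAnalyticAt (weightMap H.transfer W.transfer γ e f) (-lam k) ∧
      MatAnalyticAt (weightMap Hr.transfer W.transfer γ e f) (-lam k) ∧
      weightMap H.transfer W.transfer γ e f (-lam k) *ᵥ b k =
        weightMap Hr.transfer W.transfer γ e f (-lam k) *ᵥ b k ∧
      c k ᵥ* weightMap H.transfer W.transfer γ e f (-lam k) =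
        c k ᵥ* weightMap Hr.transfer W.transfer γ e f (-lam k) ∧
      c k ⬝ᵥ (matDeriv (weightMap H.transfer W.transfer γ e f) (-lam k) *ᵥ b k) =
        c k ⬝ᵥ (matDeriv (weightMap Hr.transfer W.transfer γ e f) (-lam k) *ᵥ b k)) ∧
    (∃ F, IsImpulseResponse F (weightMap H.transfer W.transfer γ e f)) ∧
    (∃ Fr, IsImpulseResponse Fr (weightMap Hr.transfer W.transfer γ e f)) ∧
    (∀ F Fr : ℝ → Matrix (Fin p) (Fin m) ℂ,
      IsImpulseResponse F (weightMap H.transfer W.transfer γ e f) →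
      IsImpulseResponse Fr (weightMap Hr.transfer W.transfer γ e f) →
      ∀ v : Fin m → ℂ, (W.D.map Complex.ofReal)ᵀ *ᵥ v = 0 → F 0 *ᵥ v = Fr 0 *ᵥ v) := by
  obtain ⟨W', hWE, hWD, hWt, hWs⟩ := W.exists_normalized hW
  obtain ⟨H', hHE, -, hHt, hHs⟩ := H.exists_normalized hH.1
  obtain ⟨S, hSE, hSD, hSt, hSs⟩ := Hr.exists_normalized hbest.1.1
  rw [← hWt] at hH hbest hWpr ⊢
  rw [← hHt, ← hSt]
  rw [← hWD] at hWpr ⊢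
  rw [← hSt, ← hSD] at hHrpr
  have hH' : MemWeightedH2 W'.transfer H' := ⟨hHs, by rw [hHt]; exact hH.2⟩
  have hS' : MemWeightedH2 W'.transfer S := ⟨hSs, by rw [hSt]; exact hbest.1.2⟩
  have hmin : LTISystem.IsMinimizer W' H' S := by
    intro T hT
    rw [hHt, hSt]
    exact hbest.2 T hT
  have hHD' := ((LTISystem.memWeightedH2_iff hWE hWs hHE).1 hH').2
  have hSD' := ((LTISystem.memWeightedH2_iff hWE hWs hSE).1 hS').2
  -- From here on all poles of the form of W are stable, and 𝔉 has not changed.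
  obtain ⟨γ', e', hγ', hWpr', hmap⟩ := LTISystem.exists_stable_poles hWE hWs hWpr
  have hmap' : ∀ G : ℂ → Matrix (Fin p) (Fin m) ℂ,
      weightMap G W'.transfer γ e f = weightMap G W'.transfer γ' e' f := fun G => by
    funext s
    rw [weightMap, weightMap, hmap]
  simp only [hmap']
  obtain ⟨Δ, hΔ, hΔeq, hΔerr⟩ := LTISystem.exists_weightMap_difference hWE hWs hHE hHs hSE hSs hHD'
    hSD' hγ' hWpr'
  refine ⟨fun k => ?_, LTISystem.exists_isImpulseResponse_weightMap hWE hWs hHE hHs hHD' hγ' hWpr',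
    LTISystem.exists_isImpulseResponse_weightMap hWE hWs hSE hSs hSD' hγ' hWpr',
    fun F Fr hF hFr v hv => ?_⟩
  · have hre : 0 < (-lam k).re := by simpa using hlam_neg k
    have han := LTISystem.matAnalyticAt_weightMap hWE hWs hHE hHs hHD' hγ' hWpr' hre
    have han' := LTISystem.matAnalyticAt_weightMap hWE hWs hSE hSs hSD' hγ' hWpr' hre
    obtain ⟨h1, h2, h3⟩ := LTISystem.weightMap_difference_interpolation hWE hWs hHE hHs hSE hSs
      hHD' hSD' hmin hγ' hWpr' hΔ hΔerr hlam hlam_neg hHrpr k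
    rw [hΔeq _ hre, Matrix.sub_mulVec, sub_eq_zero] at h1
    rw [hΔeq _ hre, Matrix.vecMul_sub, sub_eq_zero] at h2
    refine ⟨han, han', h1, h2, ?_⟩
    have h4 := (LTISystem.hasDerivAt_bilin han (c k) (b k)).fun_sub
      (LTISystem.hasDerivAt_bilin han' (c k) (b k))
    rw [← sub_eq_zero, ← h4.deriv, ← h3]
    refine Filter.EventuallyEq.deriv_eq ?_
    filter_upwards [(isOpen_lt continuous_const Complex.continuous_re).mem_nhds hre] with s hs
    rw [hΔeq s hs, Matrix.sub_mulVec, dotProduct_sub]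
  -- The feed-through of W is real, so the real and imaginary parts of a kernel vector are kernel
  -- vectors, and variations along real vectors suffice.
  · have hreal : ∀ w : Fin m → ℝ, w ᵥ* W'.D = 0 →
        F 0 *ᵥ (fun l => (w l : ℂ)) = Fr 0 *ᵥ fun l => (w l : ℂ) := by
      intro w hw
      funext i
      have h1 := LTISystem.tendsto_mul_mulVec_of_isMinimizer hWE hWs hHE hHs hSE hSs hHD' hSD' hmin
        hγ' hWpr' hΔ hΔerr hw i
      have h2 := (hF.tendsto_mul_mulVec (fun l => (w l : ℂ)) i).sub
        (hFr.tendsto_mul_mulVec (fun l => (w l : ℂ)) i)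
      refine sub_eq_zero.1 (tendsto_nhds_unique (h2.congr' ?_) h1)
      filter_upwards [Filter.eventually_gt_atTop 0] with t ht
      rw [hΔeq t (by simpa using ht), Matrix.sub_mulVec, Pi.sub_apply, mul_sub]
    have hsum : ∀ j, ∑ l, (W'.D l j : ℂ) * v l = 0 := fun j => by
      simpa [Matrix.mulVec, dotProduct] using congrFun hv j
    have hvre : (fun l => (v l).re) ᵥ* W'.D = 0 := funext fun j => by
      simpa [Matrix.vecMul, dotProduct, mul_comm] using congrArg Complex.re (hsum j)
    have hvim : (fun l => (v l).im) ᵥ* W'.D = 0 := funext fun j => by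
      simpa [Matrix.vecMul, dotProduct, mul_comm] using congrArg Complex.im (hsum j)
    have hvdec : v = (fun l => ((v l).re : ℂ)) + Complex.I • fun l => ((v l).im : ℂ) :=
      funext fun l => by simp [mul_comm Complex.I, Complex.re_add_im]
    rw [hvdec, Matrix.mulVec_add, Matrix.mulVec_add, Matrix.mulVec_smul, Matrix.mulVec_smul,
      hreal _ hvre, hreal _ hvim]
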